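/- **Setting.** Let $\mathscr{M}=(\mathscr{M},\otimes,I)$ be a complete and cocomplete closed symmetric monoidal category, regarded as a 2-category with one object. All 2-categories are small and strict. *Lax functors and their morphisms.* A lax functor $\mathcal{F}:\mathcal{C}\to\mathscr{M}$ assigns to every 1-morphism $f$ of $\mathcal{C}$ an object $\mathcal{F}(f)$ of $\mathscr{M}$, functorially in 2-morphisms, with natural coherent laxity maps $\mathcal{F}(f)\otimes\mathcal{F}(g)\to\mathcal{F}(fg)$ and $I\to\mathcal{F}(\mathrm{Id}_c)$, where $fg$ is the composite of $f:c\to d$ and $g:d\to e$. A morphism $(p,\sigma):\mathcal{F}\to\mathcal{G}$ from $\mathcal{F}:\mathcal{C}\to\mathscr{M}$ to $\mathcal{G}:\mathcal{D}\to\mathscr{M}$ is a strict 2-functor $p:\mathcal{C}\to\mathcal{D}$ with morphisms $\sigma_f:\mathcal{F}(f)\to\mathcal{G}(pf)$ that are natural in 2-morphisms and compatible with the laxity maps. These morphisms are the arrows of a category $\mathscr{M}_{lax}(2\mathrm{Cat})$. The pointwise tensor product of $\mathcal{F}:\mathcal{C}\to\mathscr{M}$ and $\mathcal{E}:\mathcal{B}\to\mathscr{M}$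 is the lax functor $\mathcal{F}\boxtimes\mathcal{E}:\mathcal{C}\times\mathcal{B}\to\mathscr{M}$, $(f,k)\mapsto\mathcal{F}(f)\otimes\mathcal{E}(k)$. *The category $\mathrm{Hom}[\mathcal{F},\mathcal{G}]$.* Its objects are the morphisms $\mathcal{F}\to\mathcal{G}$. Its arrows $(p,\sigma)\to(q,\tau)$ are the nerve-transformations, that is, the strict 2-natural transformations $\alpha:p\to q$ together with morphisms $\eta_c:I\to\mathcal{G}(\alpha_c)$, one for every object $c$, such that for every $f:c\to d$ the composites $$\mathcal{F}(f)\cong\mathcal{F}(f)\otimes I\xrightarrow{\sigma_f\otimes\eta_d}\mathcal{G}(pf)\otimes\mathcal{G}(\alpha_d)\to\mathcal{G}(pf\,\alpha_d),\qquad \mathcal{F}(f)\cong I\otimes\mathcal{F}(f)\xrightarrow{\eta_c\otimes\tau_f}\mathcal{G}(\alpha_c)\otimes\mathcal{G}(qf)\to\mathcal{G}(\alpha_c\,qf)$$ agree. Composition is induced by the laxity maps of $\mathcal{G}$, and the identities are given by $I\to\mathcal{G}(\mathrm{Id})$. Composition with morphisms $\mathcal{F}'\to\mathcal{F}$ and $\mathcal{G}\to\mathcal{G}'$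 gives a functor $\mathrm{Hom}[\mathcal{F},\mathcal{G}]\to\mathrm{Hom}[\mathcal{F}',\mathcal{G}']$. *The internal Hom.* For a strict 2-natural transformation $\alpha$ between the underlying 2-functors of morphisms $(p,\sigma),(q,\tau):\mathcal{F}\to\mathcal{G}$, let $\int\mathcal{G}\alpha$ be the equalizer of the two maps $$\prod_{c}\mathcal{G}(\alpha_c)\rightrightarrows\prod_{f:c\to d}\underline{\mathscr{M}}\big(\mathcal{F}(f),\mathcal{G}(pf\,\alpha_d)\big)$$ transposed to $\mathcal{F}(f)\otimes\mathcal{G}(\alpha_d)\to\mathcal{G}(pf)\otimes\mathcal{G}(\alpha_d)\to\mathcal{G}(pf\,\alpha_d)$ and to $\mathcal{F}(f)\otimes\mathcal{G}(\alpha_c)\cong\mathcal{G}(\alpha_c)\otimes\mathcal{F}(f)\to\mathcal{G}(\alpha_c)\otimes\mathcal{G}(qf)\to\mathcal{G}(\alpha_c\,qf)$; here $\underline{\mathscr{M}}(-,-)$ is the internal hom of $\mathscr{M}$. Let $\mathcal{B}(\mathcal{F},\mathcal{G})$ be the 2-category whose objects are the morphisms $\mathcal{F}\to\mathcal{G}$,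 whose 1-morphisms are the strict 2-natural transformations between the underlying 2-functors, and whose 2-morphisms are the modifications. Then $\mathrm{HOM}(\mathcal{F},\mathcal{G}):\mathcal{B}(\mathcal{F},\mathcal{G})\to\mathscr{M}$ is the lax functor $\alpha\mapsto\int\mathcal{G}\alpha$, with the laxity maps induced componentwise by those of $\mathcal{G}$. It is contravariant in $\mathcal{F}$ and covariant in $\mathcal{G}$ by composition of morphisms. The evaluation $\mathrm{ev}:\mathcal{F}\boxtimes\mathrm{HOM}(\mathcal{F},\mathcal{G})\to\mathcal{G}$ sends $(c,(p,\sigma))$ to $p(c)$ and $(f:c\to d,\ \alpha:(p,\sigma)\to(q,\tau))$ to $pf\,\alpha_d=\alpha_c\,qf$, and its components are $\mathcal{F}(f)\otimes\int\mathcal{G}\alpha\to\mathcal{G}(pf)\otimes\mathcal{G}(\alpha_d)\to\mathcal{G}(pf\,\alpha_d)$. **Theorem.** For all lax functors $\mathcal{E}:\mathcal{B}\to\mathscr{M}$, $\mathcal{F}:\mathcal{C}\to\mathscr{M}$ and $\mathcal{G}:\mathcal{D}\to\mathscr{M}$ there is an isomorphism of categories $$\mathrm{Hom}[\mathcal{F}\boxtimes\mathcal{E},\mathcal{G}]\;\cong\;\mathrm{Hom}[\mathcal{E},\mathrm{HOM}(\mathcal{F},\mathcal{G})],$$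 strictly natural with respect to morphisms $\mathcal{E}'\to\mathcal{E}$, $\mathcal{F}'\to\mathcal{F}$ and $\mathcal{G}\to\mathcal{G}'$. Its inverse sends a morphism $\delta:\mathcal{E}\to\mathrm{HOM}(\mathcal{F},\mathcal{G})$ to $\mathrm{ev}\circ(\mathrm{Id}_{\mathcal{F}}\boxtimes\delta)$. In particular $\mathscr{M}_{lax}(2\mathrm{Cat})$ has an internal Hom for $\boxtimes$: every morphism $\gamma:\mathcal{F}\boxtimes\mathcal{E}\to\mathcal{G}$ factors as $\mathrm{ev}\circ(\mathrm{Id}_{\mathcal{F}}\boxtimes\delta)$ for a unique $\delta:\mathcal{E}\to\mathrm{HOM}(\mathcal{F},\mathcal{G})$. -/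

import Mathlib

open CategoryTheory

universe u u₁

set_option linter.unusedSectionVars false

namespace LaxDiagram

section TwoCategories

open Bicategory

/-- A strict 2-functor: a map on objects, 1-morphisms and 2-morphisms that preserves all the
identities and all the compositions on the nose. -/
abbrev TwoFunctor (C D : Type u) [Bicategory.{u, u} C] [Bicategory.{u, u} D] :=
  StrictPseudofunctorPreCore C D

namespace TwoFunctor

variable {A B C D : Type u} [Bicategory.{u, u} A] [Bicategory.{u, u} B]
  [Bicategory.{u, u} C] [Bicategory.{u, u} D]

/-- The identity 2-functor. -/
@[simps, reducible]
def id (C : Type u) [Bicategory.{u, u} C] : TwoFunctor C C where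
  obj c := c
  map f := f
  map₂ θ := θ
  map₂_whisker_left f g g' η := by simp
  map₂_whisker_right η g := by simp

/-- The composite 2-functor, `p` first. -/
@[simps, reducible]
def comp (p : TwoFunctor B C) (q : TwoFunctor C D) : TwoFunctor B D where
  obj c := q.obj (p.obj c)
  map f := q.map (p.map f)
  map₂ θ := q.map₂ (p.map₂ θ)
  map_id X := by rw [p.map_id, q.map_id]
  map_comp f g := by rw [p.map_comp, q.map_comp]
  map₂_whisker_left f g g' η := by
    simp [p.map₂_whisker_left, q.map₂_whisker_left, PrelaxFunctor.map₂_eqToHom]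
  map₂_whisker_right η g := by
    simp [p.map₂_whisker_right, q.map₂_whisker_right, PrelaxFunctor.map₂_eqToHom]

theorem prod_eqToHom {x y : B × C} {f g : x ⟶ y} (h : f = g) :
    eqToHom h = (eqToHom (congrArg Prod.fst h), eqToHom (congrArg Prod.snd h)) := by
  subst h
  rfl

/-- The product of two 2-functors. -/
@[simps, reducible]
def prod (p : TwoFunctor A B) (q : TwoFunctor C D) : TwoFunctor (A × C) (B × D) where
  obj x := (p.obj x.1, q.obj x.2)
  map f := (p.map f.1, q.map f.2)
  map₂ θ := (p.map₂ θ.1, q.map₂ θ.2)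
  map₂_id f := Prod.ext (p.map₂_id f.1) (q.map₂_id f.2)
  map₂_comp η θ := Prod.ext (p.map₂_comp η.1 θ.1) (q.map₂_comp η.2 θ.2)
  map_id X := Prod.ext (p.map_id X.1) (q.map_id X.2)
  map_comp f g := Prod.ext (p.map_comp f.1 g.1) (q.map_comp f.2 g.2)
  map₂_whisker_left f g g' η := by
    rw [prod_eqToHom, prod_eqToHom]
    exact Prod.ext (p.map₂_whisker_left f.1 η.1) (q.map₂_whisker_left f.2 η.2)
  map₂_whisker_right η g := by
    rw [prod_eqToHom, prod_eqToHom]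
    exact Prod.ext (p.map₂_whisker_right η.1 g.1) (q.map₂_whisker_right η.2 g.2)

end TwoFunctor

variable {C D : Type u} [Bicategory.{u, u} C] [Bicategory.{u, u} D]

/-- A strict 2-natural transformation between strict 2-functors. The `eqToHom`s only identify the
two equal composites `p(f) ≫ α_d = α_c ≫ q(f)`. -/
structure StrictTrans (p q : TwoFunctor C D) where
  app (c : C) : p.obj c ⟶ q.obj c
  naturality {c d : C} (f : c ⟶ d) : p.map f ≫ app d = app c ≫ q.map f
  naturality₂ {c d : C} {f g : c ⟶ d} (θ : f ⟶ g) :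
    p.map₂ θ ▷ app d ≫ eqToHom (naturality g) = eqToHom (naturality f) ≫ app c ◁ q.map₂ θ

/-- A modification between strict 2-natural transformations: the equality of 2-morphisms
`p(f) ◁ Γ_d = Γ_c ▷ q(f)`. -/
structure Modif {p q : TwoFunctor C D} (α β : StrictTrans p q) where
  app (c : C) : α.app c ⟶ β.app c
  naturality {c d : C} (f : c ⟶ d) :
    p.map f ◁ app d ≫ eqToHom (β.naturality f) = eqToHom (α.naturality f) ≫ app c ▷ q.map f

@[ext]
theorem StrictTrans.ext {p q : TwoFunctor C D} {α β : StrictTrans p q}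
    (h : ∀ c, α.app c = β.app c) : α = β := by
  rcases α with ⟨a, _, _⟩
  rcases β with ⟨b, _, _⟩
  obtain rfl : a = b := funext h
  rfl

@[ext]
theorem Modif.ext {p q : TwoFunctor C D} {α β : StrictTrans p q} {Γ Γ' : Modif α β}
    (h : ∀ c, Γ.app c = Γ'.app c) : Γ = Γ' := by
  cases Γ; cases Γ'
  congr 1
  exact funext h

theorem StrictTrans.map₂_whiskerRight {p q : TwoFunctor C D} (α : StrictTrans p q) {c d : C}
    {f g : c ⟶ d} (θ : f ⟶ g) : p.map₂ θ ▷ α.app d =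
      eqToHom (α.naturality f) ≫ α.app c ◁ q.map₂ θ ≫ eqToHom (α.naturality g).symm := by
  have := α.naturality₂ θ =≫ eqToHom (α.naturality g).symm
  simpa using this

theorem Modif.whiskerLeft_app {p q : TwoFunctor C D} {α β : StrictTrans p q} (Γ : Modif α β)
    {c d : C} (f : c ⟶ d) : p.map f ◁ Γ.app d =
      eqToHom (α.naturality f) ≫ Γ.app c ▷ q.map f ≫ eqToHom (β.naturality f).symm := by
  have := Γ.naturality f =≫ eqToHom (β.naturality f).symm
  simpa using this

variable [Strict D]

attribute [local simp] Strict.leftUnitor_eqToIso Strict.rightUnitor_eqToIso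
  Strict.associator_eqToIso Strict.id_comp Strict.comp_id Strict.assoc

instance : CategoryStruct (TwoFunctor C D) where
  Hom p q := StrictTrans p q
  id p :=
    { app c := 𝟙 (p.obj c)
      naturality f := by simp
      naturality₂ θ := by simp }
  comp {p q r} α β :=
    { app c := α.app c ≫ β.app c
      naturality {c d} f := by
        rw [← Strict.assoc, α.naturality, Strict.assoc, β.naturality, Strict.assoc]
      naturality₂ {c d f g} θ := by
        simp [StrictTrans.map₂_whiskerRight] }

instance (p q : TwoFunctor C D) : Category (p ⟶ q) where
  Hom α β := Modif α β
  id α :=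
    { app c := 𝟙 (α.app c)
      naturality f := by simp }
  comp {α β γ} Γ Γ' :=
    { app c := Γ.app c ≫ Γ'.app c
      naturality {c d} f := by
        simp [Modif.whiskerLeft_app] }
  id_comp Γ := Modif.ext fun c => Category.id_comp _
  comp_id Γ := Modif.ext fun c => Category.comp_id _
  assoc Γ Γ' Γ'' := Modif.ext fun c => Category.assoc _ _ _

namespace TwoFunctor

@[simp]
theorem id_app (p : TwoFunctor C D) (c : C) : StrictTrans.app (𝟙 p) c = 𝟙 (p.obj c) := rfl

@[simp]
theorem comp_app {p q r : TwoFunctor C D} (α : p ⟶ q) (β : q ⟶ r) (c : C) :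
    StrictTrans.app (α ≫ β) c = α.app c ≫ β.app c := rfl

@[simp]
theorem id₂_app {p q : TwoFunctor C D} (α : p ⟶ q) (c : C) : Modif.app (𝟙 α) c = 𝟙 (α.app c) := rfl

@[simp]
theorem comp₂_app {p q : TwoFunctor C D} {α β γ : p ⟶ q} (Γ : α ⟶ β) (Γ' : β ⟶ γ) (c : C) :
    Modif.app (Γ ≫ Γ') c = Γ.app c ≫ Γ'.app c := rfl

@[simp]
theorem eqToHom_app {p q : TwoFunctor C D} {α β : p ⟶ q} (h : α = β) (c : C) :
    Modif.app (eqToHom h) c = eqToHom (by rw [h]) := by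
  subst h
  rfl

@[ext]
theorem hom_ext {p q : TwoFunctor C D} {α β : p ⟶ q}
    (h : ∀ c, α.app c = β.app c) : α = β := StrictTrans.ext h

@[ext]
theorem hom₂_ext {p q : TwoFunctor C D} {α β : p ⟶ q} {Γ Γ' : α ⟶ β}
    (h : ∀ c, Γ.app c = Γ'.app c) : Γ = Γ' := Modif.ext h

/-- The left whiskering of a modification. -/
def whiskerL {p q r : TwoFunctor C D} (α : p ⟶ q) {β γ : q ⟶ r} (Γ : β ⟶ γ) :
    α ≫ β ⟶ α ≫ γ := Modif.mk
  (fun c => α.app c ◁ Γ.app c)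
  (fun {c d} f => by
    have h₁ := congr_whiskerLeft (α.naturality f) (Γ.app d)
    have h₂ := Γ.whiskerLeft_app f
    simp only [comp_whiskerLeft, Strict.associator_eqToIso, eqToIso.hom, eqToIso.inv,
      Category.assoc, h₂] at h₁
    rw [← cancel_epi (eqToHom (Strict.assoc (p.map f) (α.app d) (β.app d)))]
    have h₃ := h₁ =≫ (eqToHom (by simpa using (α ≫ γ).naturality f) :
      _ ⟶ StrictTrans.app (α ≫ γ) c ≫ r.map f)
    simp only [Category.assoc, eqToHom_trans] at h₃
    refine h₃.trans ?_
    simp)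

/-- The right whiskering of a modification. -/
def whiskerR {p q r : TwoFunctor C D} {α β : p ⟶ q} (Γ : α ⟶ β) (γ : q ⟶ r) :
    α ≫ γ ⟶ β ≫ γ := Modif.mk
  (fun c => Γ.app c ▷ γ.app c)
  (fun {c d} f => by
    have h₁ := whiskerRight_congr (γ.naturality f) (Γ.app c)
    have h₂ := Γ.whiskerLeft_app f
    simp only [whiskerRight_comp, Strict.associator_eqToIso, eqToIso.hom, eqToIso.inv,
      Category.assoc] at h₁
    have h₃ : Γ.app c ▷ q.map f ▷ γ.app d =
        eqToHom (by simp [γ.naturality f]) ≫ Γ.app c ▷ γ.app c ▷ r.map f ≫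
          eqToHom (by simp [γ.naturality f]) := by
      rw [← cancel_epi (eqToHom (Strict.assoc (α.app c) (q.map f) (γ.app d)).symm),
        ← cancel_mono (eqToHom (Strict.assoc (β.app c) (q.map f) (γ.app d)))]
      simpa using h₁
    have h₄ := congrArg (· ▷ γ.app d) h₂
    simp only [whisker_assoc, Strict.associator_eqToIso, eqToIso.hom, eqToIso.inv,
      comp_whiskerRight, eqToHom_whiskerRight, h₃, Category.assoc, eqToHom_trans,
      eqToHom_trans_assoc] at h₄
    rw [← cancel_epi (eqToHom (Strict.assoc (p.map f) (α.app d) (γ.app d)))]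
    have h₅ := h₄ =≫ (eqToHom (by simpa using (β ≫ γ).naturality f) :
      _ ⟶ StrictTrans.app (β ≫ γ) c ≫ r.map f)
    simp only [Category.assoc, eqToHom_trans] at h₅
    refine h₅.trans ?_
    simp)

@[simp]
theorem whiskerL_app {p q r : TwoFunctor C D} (α : p ⟶ q) {β γ : q ⟶ r} (Γ : β ⟶ γ) (c : C) :
    Modif.app (whiskerL α Γ) c = α.app c ◁ Γ.app c := rfl

@[simp]
theorem whiskerR_app {p q r : TwoFunctor C D} {α β : p ⟶ q} (Γ : α ⟶ β) (γ : q ⟶ r) (c : C) :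
    Modif.app (whiskerR Γ γ) c = Γ.app c ▷ γ.app c := rfl

/-- The 2-category of strict 2-functors, strict 2-natural transformations and modifications. -/
instance : Bicategory (TwoFunctor C D) where
  homCategory p q := inferInstance
  whiskerLeft α _ _ Γ := whiskerL α Γ
  whiskerRight Γ γ := whiskerR Γ γ
  associator α β γ := eqToIso (hom_ext fun c => by simp)
  leftUnitor α := eqToIso (hom_ext fun c => by simp)
  rightUnitor α := eqToIso (hom_ext fun c => by simp)
  whiskerLeft_id α β := hom₂_ext fun c => by simp
  whiskerLeft_comp α β γ δ Γ Γ' := hom₂_ext fun c => by simp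
  id_whiskerLeft Γ := hom₂_ext fun c => by simp
  comp_whiskerLeft α β _ _ Γ := hom₂_ext fun c => by simp
  id_whiskerRight α β := hom₂_ext fun c => by simp
  comp_whiskerRight Γ Γ' β := hom₂_ext fun c => by simp
  whiskerRight_id Γ := hom₂_ext fun c => by simp
  whiskerRight_comp Γ β γ := hom₂_ext fun c => by simp
  whisker_assoc α _ _ Γ β := hom₂_ext fun c => by simp
  whisker_exchange Γ Γ' := hom₂_ext fun c => by simpa using whisker_exchange _ _
  pentagon α β γ δ := hom₂_ext fun c => by simp
  triangle α β := hom₂_ext fun c => by simp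

instance : Strict (TwoFunctor C D) where
  id_comp := by intros; ext; simp
  comp_id := by intros; ext; simp
  assoc := by intros; ext; simp
  leftUnitor_eqToIso _ := rfl
  rightUnitor_eqToIso _ := rfl
  associator_eqToIso _ _ _ := rfl

theorem associator_app {p q r s : TwoFunctor C D} (α : p ⟶ q) (β : q ⟶ r) (γ : r ⟶ s) (c : C) :
    Modif.app (associator α β γ).hom c =
      (associator (StrictTrans.app α c) (StrictTrans.app β c) (StrictTrans.app γ c)).hom := by
  rw [Strict.associator_eqToIso (StrictTrans.app α c)]
  exact eqToHom_app (Strict.assoc α β γ) c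

theorem leftUnitor_app {p q : TwoFunctor C D} (α : p ⟶ q) (c : C) :
    Modif.app (leftUnitor α).hom c = (leftUnitor (StrictTrans.app α c)).hom := by
  rw [Strict.leftUnitor_eqToIso (StrictTrans.app α c)]
  exact eqToHom_app (Strict.id_comp α) c

theorem rightUnitor_app {p q : TwoFunctor C D} (α : p ⟶ q) (c : C) :
    Modif.app (rightUnitor α).hom c = (rightUnitor (StrictTrans.app α c)).hom := by
  rw [Strict.rightUnitor_eqToIso (StrictTrans.app α c)]
  exact eqToHom_app (Strict.comp_id α) c

theorem whisker_swap {w x y z z' : D} {f : w ⟶ x} {g : x ⟶ z} {f' : w ⟶ y} {g' : y ⟶ z}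
    (h : f ≫ g = f' ≫ g') {k l : z ⟶ z'} (η : k ⟶ l) :
    f ◁ g ◁ η = eqToHom (by rw [← Strict.assoc, h, Strict.assoc]) ≫ f' ◁ g' ◁ η ≫
      eqToHom (by rw [← Strict.assoc f g, h, Strict.assoc]) := by
  have h₁ := congr_whiskerLeft h η
  simp only [comp_whiskerLeft, Strict.associator_eqToIso, eqToIso.hom, eqToIso.inv,
    Category.assoc] at h₁
  rw [← cancel_epi (eqToHom (Strict.assoc f g k)),
    ← cancel_mono (eqToHom (Strict.assoc f g l).symm)]
  simpa using h₁

theorem swap_whisker {w x y z z' : D} {f : z ⟶ x} {g : x ⟶ w} {f' : z ⟶ y} {g' : y ⟶ w}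
    (h : f ≫ g = f' ≫ g') {k l : z' ⟶ z} (η : k ⟶ l) :
    η ▷ f ▷ g = eqToHom (by rw [Strict.assoc, h, Strict.assoc]) ≫ η ▷ f' ▷ g' ≫
      eqToHom (by rw [Strict.assoc, ← h, Strict.assoc]) := by
  have h₁ := whiskerRight_congr h η
  simp only [whiskerRight_comp, Strict.associator_eqToIso, eqToIso.hom, eqToIso.inv,
    Category.assoc] at h₁
  rw [← cancel_epi (eqToHom (Strict.assoc k f g).symm),
    ← cancel_mono (eqToHom (Strict.assoc l f g))]
  simpa using h₁

@[simp]
theorem whiskerLeft_app {p q r : TwoFunctor C D} (α : p ⟶ q) {β γ : q ⟶ r} (Γ : β ⟶ γ) (c : C) :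
    Modif.app (α ◁ Γ) c = α.app c ◁ Γ.app c := rfl

@[simp]
theorem whiskerRight_app {p q r : TwoFunctor C D} {α β : p ⟶ q} (Γ : α ⟶ β) (γ : q ⟶ r) (c : C) :
    Modif.app (Γ ▷ γ) c = Γ.app c ▷ γ.app c := rfl

/-- The evaluation 2-functor. A pair of a 1-morphism `f : c ⟶ d` and a transformation `α : p ⟶ q`
is sent to `p(f) ≫ α_d = α_c ≫ q(f)`. -/
@[simps, reducible]
def eval (C D : Type u) [Bicategory.{u, u} C] [Bicategory.{u, u} D] [Strict D] :
    TwoFunctor (C × TwoFunctor C D) D where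
  obj x := x.2.obj x.1
  map {x y} f := x.2.map f.1 ≫ StrictTrans.app f.2 y.1
  map₂ {x y f g} θ := x.2.map₂ θ.1 ▷ StrictTrans.app f.2 y.1 ≫ x.2.map g.1 ◁ Modif.app θ.2 y.1
  map₂_id {x y} f := by simp
  map₂_comp {x y f g h} η θ := by
    simp [whisker_exchange_assoc]
  map_id X := by simp [X.2.map_id]
  map_comp {x y z} f g := by
    change x.2.map (f.1 ≫ g.1) ≫ StrictTrans.app f.2 z.1 ≫ StrictTrans.app g.2 z.1 =
      (x.2.map f.1 ≫ StrictTrans.app f.2 y.1) ≫ y.2.map g.1 ≫ StrictTrans.app g.2 z.1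
    rw [x.2.map_comp, Strict.assoc, Strict.assoc, ← Strict.assoc (x.2.map g.1),
      StrictTrans.naturality, Strict.assoc]
  map₂_whisker_left {x y z} f {g g'} η := by
    change x.2.map₂ (f.1 ◁ η.1) ▷ (StrictTrans.app f.2 z.1 ≫ StrictTrans.app g.2 z.1) ≫
      x.2.map (f.1 ≫ g'.1) ◁ StrictTrans.app f.2 z.1 ◁ Modif.app η.2 z.1 =
      eqToHom _ ≫ (x.2.map f.1 ≫ StrictTrans.app f.2 y.1) ◁ (y.2.map₂ η.1 ▷ StrictTrans.app g.2 z.1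
        ≫ y.2.map g'.1 ◁ Modif.app η.2 z.1) ≫ eqToHom _
    have h₁ := congr_whiskerLeft (x.2.map_comp f.1 g'.1)
      (StrictTrans.app f.2 z.1 ◁ Modif.app η.2 z.1)
    have h₂ := whisker_swap (StrictTrans.naturality f.2 g'.1) (Modif.app η.2 z.1)
    have h₃ := StrictTrans.map₂_whiskerRight f.2 η.1
    simp [x.2.map₂_whisker_left, h₁, h₂, h₃]
  map₂_whisker_right {x y z f f'} η g := by
    change x.2.map₂ (η.1 ▷ g.1) ▷ (StrictTrans.app f.2 z.1 ≫ StrictTrans.app g.2 z.1) ≫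
      x.2.map (f'.1 ≫ g.1) ◁ Modif.app η.2 z.1 ▷ StrictTrans.app g.2 z.1 =
      eqToHom _ ≫ (x.2.map₂ η.1 ▷ StrictTrans.app f.2 y.1
        ≫ x.2.map f'.1 ◁ Modif.app η.2 y.1) ▷ (y.2.map g.1 ≫ StrictTrans.app g.2 z.1) ≫ eqToHom _
    have h₁ := congr_whiskerLeft (x.2.map_comp f'.1 g.1)
      (Modif.app η.2 z.1 ▷ StrictTrans.app g.2 z.1)
    have h₂ := swap_whisker (StrictTrans.naturality f.2 g.1) (x.2.map₂ η.1)
    have h₃ := Modif.whiskerLeft_app η.2 g.1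
    have h₄ := congrArg (· ▷ StrictTrans.app g.2 z.1) h₃
    simp only [whisker_assoc, Strict.associator_eqToIso, eqToIso.hom, eqToIso.inv,
      comp_whiskerRight, eqToHom_whiskerRight] at h₄
    have h₅ : x.2.map g.1 ◁ Modif.app η.2 z.1 ▷ StrictTrans.app g.2 z.1 =
        eqToHom (by rw [← Strict.assoc, StrictTrans.naturality, Strict.assoc]) ≫
          Modif.app η.2 y.1 ▷ y.2.map g.1 ▷ StrictTrans.app g.2 z.1 ≫
          eqToHom (by rw [← StrictTrans.naturality, Strict.assoc]) := by
      rw [← cancel_epi (eqToHom (Strict.assoc _ _ _)),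
        ← cancel_mono (eqToHom (Strict.assoc _ _ _).symm)]
      simpa using h₄
    simp [x.2.map₂_whisker_right, h₁, h₂, h₅]

/-- Whiskering a transformation with 2-functors on both sides. -/
@[simps, reducible]
def whiskerTrans {A B : Type u} [Bicategory.{u, u} A] [Bicategory.{u, u} B] {p q : TwoFunctor C D}
    (r : TwoFunctor A C) (α : StrictTrans p q) (s : TwoFunctor D B) :
    StrictTrans (r.comp (p.comp s)) (r.comp (q.comp s)) where
  app a := s.map (α.app (r.obj a))
  naturality {a b} f := by
    dsimp
    rw [← s.map_comp, α.naturality, s.map_comp]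
  naturality₂ {a b f g} θ := by
    have h := congrArg s.map₂ (α.naturality₂ (r.map₂ θ))
    simp only [PrelaxFunctor.map₂_comp, s.map₂_whisker_right, s.map₂_whisker_left,
      PrelaxFunctor.map₂_eqToHom, Category.assoc, eqToHom_trans, eqToHom_trans_assoc] at h
    rw [← cancel_epi (eqToHom (s.map_comp _ _)), ← cancel_mono (eqToHom (s.map_comp _ _).symm)]
    simpa using h

@[simps, reducible]
def whiskerModif {A B : Type u} [Bicategory.{u, u} A] [Bicategory.{u, u} B] {p q : TwoFunctor C D}
    (r : TwoFunctor A C) {α β : StrictTrans p q} (Γ : Modif α β) (s : TwoFunctor D B) :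
    Modif (whiskerTrans r α s) (whiskerTrans r β s) where
  app a := s.map₂ (Γ.app (r.obj a))
  naturality {a b} f := by
    have h := congrArg s.map₂ (Γ.naturality (r.map f))
    simp only [PrelaxFunctor.map₂_comp, s.map₂_whisker_right, s.map₂_whisker_left,
      PrelaxFunctor.map₂_eqToHom, Category.assoc, eqToHom_trans, eqToHom_trans_assoc] at h
    rw [← cancel_epi (eqToHom (s.map_comp _ _)), ← cancel_mono (eqToHom (s.map_comp _ _).symm)]
    simpa using h

end TwoFunctor

end TwoCategories

section LaxFunctors

open MonoidalCategory

variable {M : Type u₁} [Category.{u} M] [MonoidalCategory M]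

/-- The type of lax functors from the 2-category `C` to the monoidal category `M`, the latter
regarded as a 2-category with one object. -/
abbrev Lax (C : Type u) [Bicategory.{u, u} C] (M : Type u₁) [Category.{u} M]
    [MonoidalCategory M] := LaxFunctor C (MonoidalSingleObj M)

namespace Lax

variable {C : Type u} [Bicategory.{u, u} C] (F : Lax C M)

/-- The value `F(f)` on a 1-morphism, as an object of `M`. -/
def val {a b : C} (f : a ⟶ b) : M := F.map f

/-- The value `F(θ)` on a 2-morphism, as a morphism of `M`. -/
def val₂ {a b : C} {f g : a ⟶ b} (θ : f ⟶ g) : F.val f ⟶ F.val g := F.map₂ θ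

/-- The laxity map `I ⟶ F(i)` for a 1-morphism `i` that equals an identity. -/
def one {a : C} (i : a ⟶ a) (h : i = 𝟙 a) : 𝟙_ M ⟶ F.val i := F.mapId' i h

/-- The laxity map `F(f) ⊗ F(g) ⟶ F(k)` for a 1-morphism `k` that equals `f ≫ g`. -/
def mul {a b c : C} (f : a ⟶ b) (g : b ⟶ c) (k : a ⟶ c) (h : f ≫ g = k) :
    F.val f ⊗ F.val g ⟶ F.val k := F.mapComp' f g k h

@[simp]
theorem val₂_id {a b : C} (f : a ⟶ b) : F.val₂ (𝟙 f) = 𝟙 (F.val f) := F.map₂_id f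

theorem val₂_comp {a b : C} {f g h : a ⟶ b} (θ : f ⟶ g) (κ : g ⟶ h) :
    F.val₂ (θ ≫ κ) = F.val₂ θ ≫ F.val₂ κ := F.map₂_comp θ κ

theorem val₂_eqToHom {a b : C} {f g : a ⟶ b} (h : f = g) :
    F.val₂ (eqToHom h) = eqToHom (by rw [h]) := by
  subst h
  exact F.val₂_id f

theorem one_rfl (a : C) : F.one (𝟙 a) rfl = F.mapId a := F.mapId'_eq_mapId a

theorem mul_rfl {a b c : C} (f : a ⟶ b) (g : b ⟶ c) :
    F.mul f g (f ≫ g) rfl = F.mapComp f g := F.mapComp'_eq_mapComp f g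

theorem one_val₂ {a : C} {i j : a ⟶ a} (h : i = 𝟙 a) (h' : j = 𝟙 a) :
    F.one i h ≫ F.val₂ (eqToHom (h.trans h'.symm)) = F.one j h' := by
  subst h' h
  simp

theorem mul_val₂ {a b c : C} {f : a ⟶ b} {g : b ⟶ c} {k k' : a ⟶ c} (h : f ≫ g = k)
    (h' : k = k') : F.mul f g k h ≫ F.val₂ (eqToHom h') = F.mul f g k' (h.trans h') := by
  subst h' h
  simp

theorem assoc_hom {a b c d : C} (f : a ⟶ b) (g : b ⟶ c) (h : c ⟶ d) :
    F.mul f g (f ≫ g) rfl ▷ F.val h ≫ F.mul (f ≫ g) h ((f ≫ g) ≫ h) rfl ≫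
        F.val₂ (Bicategory.associator f g h).hom =
      (α_ (F.val f) (F.val g) (F.val h)).hom ≫ F.val f ◁ F.mul g h (g ≫ h) rfl ≫
        F.mul f (g ≫ h) (f ≫ g ≫ h) rfl := by
  rw [mul_rfl, mul_rfl, mul_rfl, mul_rfl]
  exact F.map₂_associator f g h

theorem one_mul_hom {a b : C} (f : a ⟶ b) :
    F.one (𝟙 a) rfl ▷ F.val f ≫ F.mul (𝟙 a) f (𝟙 a ≫ f) rfl ≫
      F.val₂ (Bicategory.leftUnitor f).hom = (λ_ (F.val f)).hom := by
  rw [mul_rfl, one_rfl]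
  exact (F.map₂_leftUnitor_hom f).symm

theorem mul_one_hom {a b : C} (f : a ⟶ b) :
    F.val f ◁ F.one (𝟙 b) rfl ≫ F.mul f (𝟙 b) (f ≫ 𝟙 b) rfl ≫
      F.val₂ (Bicategory.rightUnitor f).hom = (ρ_ (F.val f)).hom := by
  rw [mul_rfl, one_rfl]
  exact (F.map₂_rightUnitor_hom f).symm

theorem mul_whiskerRight {a b c : C} {f f' : a ⟶ b} (θ : f ⟶ f') (g : b ⟶ c) :
    F.mul f g (f ≫ g) rfl ≫ F.val₂ (Bicategory.whiskerRight θ g) =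
      F.val₂ θ ▷ F.val g ≫ F.mul f' g (f' ≫ g) rfl := by
  rw [mul_rfl, mul_rfl]
  exact F.mapComp_naturality_left θ g

theorem mul_whiskerLeft {a b c : C} (f : a ⟶ b) {g g' : b ⟶ c} (θ : g ⟶ g') :
    F.mul f g (f ≫ g) rfl ≫ F.val₂ (Bicategory.whiskerLeft f θ) =
      F.val f ◁ F.val₂ θ ≫ F.mul f g' (f ≫ g') rfl := by
  rw [mul_rfl, mul_rfl]
  exact F.mapComp_naturality_right f θ

open Bicategory in
/-- The laxity maps are natural in both variables. -/
theorem mul_naturality {a b c : C} {f f' : a ⟶ b} {g g' : b ⟶ c} {k k' : a ⟶ c}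
    (h : f ≫ g = k) (h' : f' ≫ g' = k') (θ : f ⟶ f') (κ : g ⟶ g') (τ : k ⟶ k')
    (w : τ = eqToHom h.symm ≫ (θ ▷ g ≫ f' ◁ κ) ≫ eqToHom h') :
    F.mul f g k h ≫ F.val₂ τ = (F.val₂ θ ⊗ₘ F.val₂ κ) ≫ F.mul f' g' k' h' := by
  subst h h' w
  rw [eqToHom_refl, eqToHom_refl, Category.id_comp, Category.comp_id, val₂_comp,
    reassoc_of% (F.mul_whiskerRight θ g), F.mul_whiskerLeft f' κ,
    MonoidalCategory.tensorHom_def, Category.assoc]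

variable [Bicategory.Strict C]

theorem mul_assoc' {a b c d : C} {f : a ⟶ b} {g : b ⟶ c} {h : c ⟶ d} {fg : a ⟶ c} {gh : b ⟶ d}
    {k : a ⟶ d} (h₁ : f ≫ g = fg) (h₂ : g ≫ h = gh) (h₃ : fg ≫ h = k) (h₄ : f ≫ gh = k) :
    F.mul f g fg h₁ ▷ F.val h ≫ F.mul fg h k h₃ =
      (α_ (F.val f) (F.val g) (F.val h)).hom ≫ F.val f ◁ F.mul g h gh h₂ ≫ F.mul f gh k h₄ := by
  subst h₁ h₂ h₄
  rw [mul_rfl, mul_rfl, mul_rfl, ← F.mul_val₂ rfl h₃, mul_rfl]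
  have := F.map₂_associator f g h
  rw [Bicategory.Strict.associator_eqToIso] at this
  exact this

theorem one_mul' {a b : C} {i : a ⟶ a} {f : a ⟶ b} (h : i = 𝟙 a) (h' : i ≫ f = f) :
    F.one i h ▷ F.val f ≫ F.mul i f f h' = (λ_ (F.val f)).hom := by
  subst h
  have := F.map₂_leftUnitor f
  rw [Bicategory.Strict.leftUnitor_eqToIso] at this
  have h₁ : (λ_ (F.val f)).inv ≫ F.one (𝟙 a) rfl ▷ F.val f ≫ F.mul (𝟙 a) f _ rfl =
      F.val₂ (eqToHom h'.symm) := by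
    rw [one_rfl, mul_rfl]
    exact this.symm
  rw [← F.mul_val₂ rfl h', ← cancel_epi (λ_ (F.val f)).inv, Iso.inv_hom_id, reassoc_of% h₁,
    ← val₂_comp, eqToHom_trans, eqToHom_refl, val₂_id]

theorem mul_one' {a b : C} {f : a ⟶ b} {i : b ⟶ b} (h : i = 𝟙 b) (h' : f ≫ i = f) :
    F.val f ◁ F.one i h ≫ F.mul f i f h' = (ρ_ (F.val f)).hom := by
  subst h
  have := F.map₂_rightUnitor f
  rw [Bicategory.Strict.rightUnitor_eqToIso] at this
  have h₁ : (ρ_ (F.val f)).inv ≫ F.val f ◁ F.one (𝟙 b) rfl ≫ F.mul f (𝟙 b) _ rfl =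
      F.val₂ (eqToHom h'.symm) := by
    rw [one_rfl, mul_rfl]
    exact this.symm
  rw [← F.mul_val₂ rfl h', ← cancel_epi (ρ_ (F.val f)).inv, Iso.inv_hom_id, reassoc_of% h₁,
    ← val₂_comp, eqToHom_trans, eqToHom_refl, val₂_id]

theorem one_mul_one {a : C} {i j k : a ⟶ a} (hi : i = 𝟙 a) (hj : j = 𝟙 a) (h : i ≫ j = k)
    (hk : k = 𝟙 a) : (F.one i hi ⊗ₘ F.one j hj) ≫ F.mul i j k h =
      (λ_ (𝟙_ M)).hom ≫ F.one k hk := by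
  subst hi hj
  obtain rfl : k = 𝟙 a := hk
  rw [MonoidalCategory.tensorHom_def', Category.assoc, F.one_mul' rfl h]
  exact MonoidalCategory.leftUnitor_naturality _

end Lax

/-- The data of a lax functor from a 2-category to a monoidal category, written out in terms of the
objects and the morphisms of the monoidal category. -/
structure LaxData (C : Type u) [Bicategory.{u, u} C] (M : Type u₁) [Category.{u} M]
    [MonoidalCategory M] where
  val {a b : C} (f : a ⟶ b) : M
  val₂ {a b : C} {f g : a ⟶ b} (θ : f ⟶ g) : val f ⟶ val g
  one (a : C) : 𝟙_ M ⟶ val (𝟙 a)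
  mul {a b c : C} (f : a ⟶ b) (g : b ⟶ c) : val f ⊗ val g ⟶ val (f ≫ g)
  val₂_id {a b : C} (f : a ⟶ b) : val₂ (𝟙 f) = 𝟙 (val f)
  val₂_comp {a b : C} {f g h : a ⟶ b} (θ : f ⟶ g) (κ : g ⟶ h) :
    val₂ (θ ≫ κ) = val₂ θ ≫ val₂ κ
  naturality_left {a b c : C} {f f' : a ⟶ b} (θ : f ⟶ f') (g : b ⟶ c) :
    mul f g ≫ val₂ (Bicategory.whiskerRight θ g) = val₂ θ ▷ val g ≫ mul f' g
  naturality_right {a b c : C} (f : a ⟶ b) {g g' : b ⟶ c} (θ : g ⟶ g') :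
    mul f g ≫ val₂ (Bicategory.whiskerLeft f θ) = val f ◁ val₂ θ ≫ mul f g'
  assoc {a b c d : C} (f : a ⟶ b) (g : b ⟶ c) (h : c ⟶ d) :
    mul f g ▷ val h ≫ mul (f ≫ g) h ≫ val₂ (Bicategory.associator f g h).hom =
      (α_ (val f) (val g) (val h)).hom ≫ val f ◁ mul g h ≫ mul f (g ≫ h)
  one_mul {a b : C} (f : a ⟶ b) :
    one a ▷ val f ≫ mul (𝟙 a) f ≫ val₂ (Bicategory.leftUnitor f).hom = (λ_ (val f)).hom
  mul_one {a b : C} (f : a ⟶ b) :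
    val f ◁ one b ≫ mul f (𝟙 b) ≫ val₂ (Bicategory.rightUnitor f).hom = (ρ_ (val f)).hom

/-- The lax functor given by the data. -/
def LaxData.toLax {C : Type u} [Bicategory.{u, u} C] (S : LaxData C M) : Lax C M where
  obj _ := MonoidalSingleObj.star M
  map f := S.val f
  map₂ θ := S.val₂ θ
  map₂_id f := S.val₂_id f
  map₂_comp θ κ := S.val₂_comp θ κ
  mapId a := S.one a
  mapComp f g := S.mul f g
  mapComp_naturality_left θ g := S.naturality_left θ g
  mapComp_naturality_right f _ _ θ := S.naturality_right f θ
  map₂_associator f g h := S.assoc f g h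
  map₂_leftUnitor {a b} f := by
    have : S.val₂ (Bicategory.leftUnitor f).inv =
        (λ_ (S.val f)).inv ≫ S.one a ▷ S.val f ≫ S.mul (𝟙 a) f := by
      rw [← cancel_epi (λ_ (S.val f)).hom, Iso.hom_inv_id_assoc, ← S.one_mul, Category.assoc,
        Category.assoc, ← S.val₂_comp, Iso.hom_inv_id, S.val₂_id, Category.comp_id]
    exact this
  map₂_rightUnitor {a b} f := by
    have : S.val₂ (Bicategory.rightUnitor f).inv =
        (ρ_ (S.val f)).inv ≫ S.val f ◁ S.one b ≫ S.mul f (𝟙 b) := by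
      rw [← cancel_epi (ρ_ (S.val f)).hom, Iso.hom_inv_id_assoc, ← S.mul_one, Category.assoc,
        Category.assoc, ← S.val₂_comp, Iso.hom_inv_id, S.val₂_id, Category.comp_id]
    exact this

theorem LaxData.toLax_one {C : Type u} [Bicategory.{u, u} C] (S : LaxData C M) {a : C}
    (i : a ⟶ a) (h : i = 𝟙 a) :
    S.toLax.one i h = S.one a ≫ S.val₂ (eqToHom h.symm) := by
  subst h
  rw [Lax.one_rfl, eqToHom_refl, S.val₂_id, Category.comp_id]
  rfl

theorem LaxData.toLax_mul {C : Type u} [Bicategory.{u, u} C] (S : LaxData C M) {a b c : C}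
    (f : a ⟶ b) (g : b ⟶ c) (k : a ⟶ c) (h : f ≫ g = k) :
    S.toLax.mul f g k h = S.mul f g ≫ S.val₂ (eqToHom h) := by
  subst h
  rw [Lax.mul_rfl, eqToHom_refl, S.val₂_id, Category.comp_id]
  rfl

end LaxFunctors

section Morphisms

open MonoidalCategory

variable {M : Type u₁} [Category.{u} M] [MonoidalCategory M]

variable {B C D : Type u} [Bicategory.{u, u} B] [Bicategory.{u, u} C] [Bicategory.{u, u} D]

/-- A morphism from the lax functor `F : C → M` to the lax functor `G : D → M`: a strict 2-functor
`p : C → D` together with an icon from `F` to the restriction of `G` along `p`. -/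
structure LaxMor (F : Lax C M) (G : Lax D M) where
  base : TwoFunctor C D
  app {a b : C} (f : a ⟶ b) : F.val f ⟶ G.val (base.map f)
  naturality {a b : C} {f g : a ⟶ b} (θ : f ⟶ g) :
    F.val₂ θ ≫ app g = app f ≫ G.val₂ (base.map₂ θ)
  one_app (a : C) :
    F.one (𝟙 a) rfl ≫ app (𝟙 a) = G.one (base.map (𝟙 a)) (base.map_id a)
  mul_app {a b c : C} (f : a ⟶ b) (g : b ⟶ c) :
    F.mul f g (f ≫ g) rfl ≫ app (f ≫ g) =
      (app f ⊗ₘ app g) ≫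
        G.mul (base.map f) (base.map g) (base.map (f ≫ g)) (base.map_comp f g).symm

namespace LaxMor

variable {A : Type u} [Bicategory.{u, u} A]
variable {H : Lax A M} {E : Lax B M} {F : Lax C M} {G : Lax D M}

theorem one_app' (σ : LaxMor F G) {a : C} (i : a ⟶ a) (h : i = 𝟙 a) :
    F.one i h ≫ σ.app i = G.one (σ.base.map i) (by rw [h, σ.base.map_id]) := by
  subst h
  exact σ.one_app a

theorem mul_app' (σ : LaxMor F G) {a b c : C} (f : a ⟶ b) (g : b ⟶ c) (k : a ⟶ c)
    (h : f ≫ g = k) :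
    F.mul f g k h ≫ σ.app k = (σ.app f ⊗ₘ σ.app g) ≫
      G.mul (σ.base.map f) (σ.base.map g) (σ.base.map k) (by rw [← h, σ.base.map_comp]) := by
  subst h
  exact σ.mul_app f g

theorem ext_app {σ τ : LaxMor F G} (h : σ.base = τ.base)
    (h' : ∀ {a b : C} (f : a ⟶ b), HEq (σ.app f) (τ.app f)) : σ = τ := by
  rcases σ with ⟨p, s, _, _, _⟩
  rcases τ with ⟨q, t, _, _, _⟩
  obtain rfl : p = q := h
  have : @s = @t := by
    funext a b f
    exact eq_of_heq (h' f)
  subst this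
  rfl

/-- The identity of a lax functor. -/
@[simps]
def id (F : Lax C M) : LaxMor F F where
  base := TwoFunctor.id C
  app f := 𝟙 (F.val f)
  naturality θ := by simp
  one_app a := by simp
  mul_app f g := by simp

/-- The composition of morphisms of lax functors. -/
@[simps]
def comp (σ : LaxMor E F) (τ : LaxMor F G) : LaxMor E G where
  base := σ.base.comp τ.base
  app f := σ.app f ≫ τ.app (σ.base.map f)
  naturality θ := by
    rw [← Category.assoc, σ.naturality, Category.assoc, τ.naturality, Category.assoc]
  one_app a := by
    rw [← Category.assoc, σ.one_app, τ.one_app']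
  mul_app f g := by
    rw [← Category.assoc, σ.mul_app, Category.assoc, τ.mul_app']
    rw [MonoidalCategory.tensorHom_comp_tensorHom_assoc]

end LaxMor

/-- The objects of the category of lax functors with values in `M`: a small strict 2-category
together with a lax functor from it to `M`. -/
structure LaxCat (M : Type u₁) [Category.{u} M] [MonoidalCategory M] where
  index : Type u
  [bicategory : Bicategory.{u, u} index]
  [strict : Bicategory.Strict index]
  functor : Lax index M

attribute [instance] LaxCat.bicategory LaxCat.strict

/-- The category of all lax functors from small strict 2-categories to `M`. -/
instance : Category (LaxCat M) where
  Hom X Y := LaxMor X.functor Y.functor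
  id X := LaxMor.id X.functor
  comp σ τ := σ.comp τ
  id_comp _ := LaxMor.ext_app rfl fun _ => heq_of_eq (Category.id_comp _)
  comp_id _ := LaxMor.ext_app rfl fun _ => heq_of_eq (Category.comp_id _)
  assoc _ _ _ := LaxMor.ext_app rfl fun _ => heq_of_eq (Category.assoc _ _ _)

end Morphisms

section Tensor

open MonoidalCategory

variable {M : Type u₁} [Category.{u} M] [MonoidalCategory M] [SymmetricCategory M]

variable {B C D : Type u} [Bicategory.{u, u} B] [Bicategory.{u, u} C] [Bicategory.{u, u} D]

theorem tensorμ_assoc_aux {X₁ X₂ Y₁ Y₂ Z₁ Z₂ P₁ P₂ Q₁ Q₂ R₁ R₂ S₁ S₂ : M}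
    {m₁ : X₁ ⊗ Y₁ ⟶ P₁} {n₁ : P₁ ⊗ Z₁ ⟶ R₁} {t₁ : R₁ ⟶ S₁} {l₁ : Y₁ ⊗ Z₁ ⟶ Q₁} {k₁ : X₁ ⊗ Q₁ ⟶ S₁}
    {m₂ : X₂ ⊗ Y₂ ⟶ P₂} {n₂ : P₂ ⊗ Z₂ ⟶ R₂} {t₂ : R₂ ⟶ S₂} {l₂ : Y₂ ⊗ Z₂ ⟶ Q₂} {k₂ : X₂ ⊗ Q₂ ⟶ S₂}
    (h₁ : m₁ ▷ Z₁ ≫ n₁ ≫ t₁ = (α_ X₁ Y₁ Z₁).hom ≫ X₁ ◁ l₁ ≫ k₁)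
    (h₂ : m₂ ▷ Z₂ ≫ n₂ ≫ t₂ = (α_ X₂ Y₂ Z₂).hom ≫ X₂ ◁ l₂ ≫ k₂) :
    (tensorμ X₁ X₂ Y₁ Y₂ ≫ (m₁ ⊗ₘ m₂)) ▷ (Z₁ ⊗ Z₂) ≫
      (tensorμ P₁ P₂ Z₁ Z₂ ≫ (n₁ ⊗ₘ n₂)) ≫ (t₁ ⊗ₘ t₂) =
    (α_ _ _ _).hom ≫ (X₁ ⊗ X₂) ◁ (tensorμ Y₁ Y₂ Z₁ Z₂ ≫ (l₁ ⊗ₘ l₂)) ≫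
      tensorμ X₁ X₂ Q₁ Q₂ ≫ (k₁ ⊗ₘ k₂) := by
  have h₃ := tensor_associativity X₁ X₂ Y₁ Y₂ Z₁ Z₂
  simp only [MonoidalCategory.comp_whiskerRight, MonoidalCategory.whiskerLeft_comp,
    Category.assoc, tensorμ_natural_left_assoc, tensorμ_natural_right_assoc,
    MonoidalCategory.tensorHom_comp_tensorHom, h₁, h₂]
  rw [← MonoidalCategory.tensorHom_comp_tensorHom, reassoc_of% h₃]

theorem tensorμ_left_aux {X₁ X₂ P₁ P₂ R₁ R₂ : M}
    {e₁ : 𝟙_ M ⟶ P₁} {n₁ : P₁ ⊗ X₁ ⟶ R₁} {t₁ : R₁ ⟶ X₁}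
    {e₂ : 𝟙_ M ⟶ P₂} {n₂ : P₂ ⊗ X₂ ⟶ R₂} {t₂ : R₂ ⟶ X₂}
    (h₁ : e₁ ▷ X₁ ≫ n₁ ≫ t₁ = (λ_ X₁).hom) (h₂ : e₂ ▷ X₂ ≫ n₂ ≫ t₂ = (λ_ X₂).hom) :
    ((λ_ (𝟙_ M)).inv ≫ (e₁ ⊗ₘ e₂)) ▷ (X₁ ⊗ X₂) ≫
      (tensorμ P₁ P₂ X₁ X₂ ≫ (n₁ ⊗ₘ n₂)) ≫ (t₁ ⊗ₘ t₂) = (λ_ (X₁ ⊗ X₂)).hom := by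
  rw [tensor_left_unitality]
  simp only [MonoidalCategory.comp_whiskerRight, Category.assoc, tensorμ_natural_left_assoc,
    MonoidalCategory.tensorHom_comp_tensorHom, h₁, h₂]

theorem tensorμ_right_aux {X₁ X₂ P₁ P₂ R₁ R₂ : M}
    {e₁ : 𝟙_ M ⟶ P₁} {n₁ : X₁ ⊗ P₁ ⟶ R₁} {t₁ : R₁ ⟶ X₁}
    {e₂ : 𝟙_ M ⟶ P₂} {n₂ : X₂ ⊗ P₂ ⟶ R₂} {t₂ : R₂ ⟶ X₂}
    (h₁ : X₁ ◁ e₁ ≫ n₁ ≫ t₁ = (ρ_ X₁).hom) (h₂ : X₂ ◁ e₂ ≫ n₂ ≫ t₂ = (ρ_ X₂).hom) :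
    (X₁ ⊗ X₂) ◁ ((λ_ (𝟙_ M)).inv ≫ (e₁ ⊗ₘ e₂)) ≫
      (tensorμ X₁ X₂ P₁ P₂ ≫ (n₁ ⊗ₘ n₂)) ≫ (t₁ ⊗ₘ t₂) = (ρ_ (X₁ ⊗ X₂)).hom := by
  rw [tensor_right_unitality]
  simp only [MonoidalCategory.whiskerLeft_comp, Category.assoc, tensorμ_natural_right_assoc,
    MonoidalCategory.tensorHom_comp_tensorHom, h₁, h₂]

theorem tensorμ_hom_aux {X₁ X₂ Y₁ Y₂ X₁' X₂' Y₁' Y₂' Z₁ Z₂ Z₁' Z₂' : M}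
    {m₁ : X₁ ⊗ Y₁ ⟶ Z₁} {m₂ : X₂ ⊗ Y₂ ⟶ Z₂} {n₁ : X₁' ⊗ Y₁' ⟶ Z₁'} {n₂ : X₂' ⊗ Y₂' ⟶ Z₂'}
    {x₁ : X₁ ⟶ X₁'} {x₂ : X₂ ⟶ X₂'} {y₁ : Y₁ ⟶ Y₁'} {y₂ : Y₂ ⟶ Y₂'} {z₁ : Z₁ ⟶ Z₁'}
    {z₂ : Z₂ ⟶ Z₂'} (h₁ : m₁ ≫ z₁ = (x₁ ⊗ₘ y₁) ≫ n₁) (h₂ : m₂ ≫ z₂ = (x₂ ⊗ₘ y₂) ≫ n₂) :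
    (tensorμ X₁ X₂ Y₁ Y₂ ≫ (m₁ ⊗ₘ m₂)) ≫ (z₁ ⊗ₘ z₂) =
      ((x₁ ⊗ₘ x₂) ⊗ₘ (y₁ ⊗ₘ y₂)) ≫ tensorμ X₁' X₂' Y₁' Y₂' ≫ (n₁ ⊗ₘ n₂) := by
  rw [Category.assoc, MonoidalCategory.tensorHom_comp_tensorHom, h₁, h₂,
    ← MonoidalCategory.tensorHom_comp_tensorHom, tensorμ_natural_assoc]

namespace Lax

/-- The data of the pointwise tensor product. -/
def tensorData (F : Lax C M) (E : Lax B M) : LaxData (C × B) M where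
  val f := F.val f.1 ⊗ E.val f.2
  val₂ θ := F.val₂ θ.1 ⊗ₘ E.val₂ θ.2
  one x := (λ_ (𝟙_ M)).inv ≫ (F.one (𝟙 x.1) rfl ⊗ₘ E.one (𝟙 x.2) rfl)
  mul f g := tensorμ (F.val f.1) (E.val f.2) (F.val g.1) (E.val g.2) ≫
    (F.mul f.1 g.1 (f.1 ≫ g.1) rfl ⊗ₘ E.mul f.2 g.2 (f.2 ≫ g.2) rfl)
  val₂_id f := by
    change F.val₂ (𝟙 f.1) ⊗ₘ E.val₂ (𝟙 f.2) = _
    rw [val₂_id, val₂_id, MonoidalCategory.id_tensorHom_id]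
  val₂_comp θ κ := by
    change F.val₂ (θ.1 ≫ κ.1) ⊗ₘ E.val₂ (θ.2 ≫ κ.2) = _
    rw [val₂_comp, val₂_comp, MonoidalCategory.tensorHom_comp_tensorHom]
  naturality_left θ g := by
    rw [← MonoidalCategory.tensorHom_id, ← MonoidalCategory.id_tensorHom_id]
    refine tensorμ_hom_aux ?_ ?_ <;> rw [MonoidalCategory.tensorHom_id]
    · exact F.mul_whiskerRight θ.1 g.1
    · exact E.mul_whiskerRight θ.2 g.2
  naturality_right f _ _ θ := by
    rw [← MonoidalCategory.id_tensorHom, ← MonoidalCategory.id_tensorHom_id]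
    refine tensorμ_hom_aux ?_ ?_ <;> rw [MonoidalCategory.id_tensorHom]
    · exact F.mul_whiskerLeft f.1 θ.1
    · exact E.mul_whiskerLeft f.2 θ.2
  assoc f g h := tensorμ_assoc_aux (F.assoc_hom f.1 g.1 h.1) (E.assoc_hom f.2 g.2 h.2)
  one_mul f := tensorμ_left_aux (F.one_mul_hom f.1) (E.one_mul_hom f.2)
  mul_one f := tensorμ_right_aux (F.mul_one_hom f.1) (E.mul_one_hom f.2)

/-- The pointwise tensor product `F ⊠ E`, with `(F ⊠ E)(f, k) = F(f) ⊗ E(k)`. -/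
def tensor (F : Lax C M) (E : Lax B M) : Lax (C × B) M := (tensorData F E).toLax

theorem tensor_one (F : Lax C M) (E : Lax B M) {x : C × B} (i : x ⟶ x) (h : i = 𝟙 x) :
    (F.tensor E).one i h = (λ_ (𝟙_ M)).inv ≫
      (F.one i.1 (congrArg Prod.fst h) ⊗ₘ E.one i.2 (congrArg Prod.snd h)) := by
  subst h
  refine (LaxData.toLax_one _ _ _).trans ?_
  rw [eqToHom_refl, LaxData.val₂_id, Category.comp_id]
  rfl

theorem tensor_mul (F : Lax C M) (E : Lax B M) {x y z : C × B} (f : x ⟶ y) (g : y ⟶ z)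
    (k : x ⟶ z) (h : f ≫ g = k) :
    (F.tensor E).mul f g k h = tensorμ (F.val f.1) (E.val f.2) (F.val g.1) (E.val g.2) ≫
      (F.mul f.1 g.1 k.1 (congrArg Prod.fst h) ⊗ₘ E.mul f.2 g.2 k.2 (congrArg Prod.snd h)) := by
  subst h
  refine (LaxData.toLax_mul _ _ _ _ _).trans ?_
  rw [eqToHom_refl, LaxData.val₂_id, Category.comp_id]
  rfl

end Lax

/-- The pointwise tensor product of two morphisms of lax functors. -/
def LaxMor.tensor {B' C' : Type u} [Bicategory.{u, u} B'] [Bicategory.{u, u} C']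
    {F : Lax C M} {F' : Lax C' M} {E : Lax B M} {E' : Lax B' M}
    (φ : LaxMor F F') (ε : LaxMor E E') : LaxMor (F.tensor E) (F'.tensor E') where
  base := φ.base.prod ε.base
  app f := φ.app f.1 ⊗ₘ ε.app f.2
  naturality {a b f g} θ := by
    change (F.val₂ θ.1 ⊗ₘ E.val₂ θ.2) ≫ (φ.app g.1 ⊗ₘ ε.app g.2) =
      (φ.app f.1 ⊗ₘ ε.app f.2) ≫ (F'.val₂ (φ.base.map₂ θ.1) ⊗ₘ E'.val₂ (ε.base.map₂ θ.2))
    simp only [MonoidalCategory.tensorHom_comp_tensorHom, LaxMor.naturality]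
  one_app a := by
    rw [Lax.tensor_one, Lax.tensor_one, ← φ.one_app', ← ε.one_app',
      ← MonoidalCategory.tensorHom_comp_tensorHom, ← Category.assoc]
    rfl
  mul_app f g := by
    rw [Lax.tensor_mul, Lax.tensor_mul]
    exact tensorμ_hom_aux (φ.mul_app' f.1 g.1 _ rfl) (ε.mul_app' f.2 g.2 _ rfl)

/-- The object part of the pointwise tensor product on the category of lax functors. -/
def LaxCat.tensorObj (X Y : LaxCat M) : LaxCat M where
  index := X.index × Y.index
  functor := X.functor.tensor Y.functor

/-- The morphism part of the pointwise tensor product on the category of lax functors. -/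
def LaxCat.tensorHom {X X' Y Y' : LaxCat M} (φ : X ⟶ X') (ε : Y ⟶ Y') :
    X.tensorObj Y ⟶ X'.tensorObj Y' := LaxMor.tensor φ ε

end Tensor

section NerveTransformations

open MonoidalCategory

variable {M : Type u₁} [Category.{u} M] [MonoidalCategory M]

variable {C D : Type u} [Bicategory.{u, u} C] [Bicategory.{u, u} D] [Bicategory.Strict D]
variable {F : Lax C M} {G : Lax D M}

/-- A nerve-transformation between two morphisms `σ, τ : F ⟶ G` of lax functors: a strict 2-natural
transformation `α` between the underlying 2-functors with a family of elements `I ⟶ G(α_c)` that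
makes the hexagon commute for every 1-morphism `f : c ⟶ d`. -/
structure NerveTrans (σ τ : LaxMor F G) where
  trans : StrictTrans σ.base τ.base
  elt (c : C) : 𝟙_ M ⟶ G.val (trans.app c)
  hexagon {c d : C} (f : c ⟶ d) :
    (ρ_ (F.val f)).inv ≫ (σ.app f ⊗ₘ elt d) ≫
        G.mul (σ.base.map f) (trans.app d) (σ.base.map f ≫ trans.app d) rfl =
      (λ_ (F.val f)).inv ≫ (elt c ⊗ₘ τ.app f) ≫
        G.mul (trans.app c) (τ.base.map f) (σ.base.map f ≫ trans.app d) (trans.naturality f).symm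

theorem NerveTrans.ext_elt {σ τ : LaxMor F G} {η θ : NerveTrans σ τ}
    (h : ∀ c, η.trans.app c = θ.trans.app c)
    (h' : ∀ c, η.elt c ≫ G.val₂ (eqToHom (h c)) = θ.elt c) : η = θ := by
  rcases η with ⟨α, x, _⟩
  rcases θ with ⟨β, y, _⟩
  obtain rfl : α = β := StrictTrans.ext h
  obtain rfl : x = y := by
    funext c
    simpa using h' c
  rfl

variable [SymmetricCategory M]

/-- The equation of the hexagon for a family of generalized elements `X ⟶ G(α_c)`. -/
def Compat (σ τ : LaxMor F G) (α : StrictTrans σ.base τ.base) {X : M}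
    (x : ∀ c, X ⟶ G.val (α.app c)) : Prop :=
  ∀ ⦃c d : C⦄ (f : c ⟶ d),
    (σ.app f ⊗ₘ x d) ≫ G.mul (σ.base.map f) (α.app d) (σ.base.map f ≫ α.app d) rfl =
      (β_ (F.val f) X).hom ≫ (x c ⊗ₘ τ.app f) ≫
        G.mul (α.app c) (τ.base.map f) (σ.base.map f ≫ α.app d) (α.naturality f).symm

theorem tensorHom_whiskerRight_assoc {X Y X' Y' Z W : M} (f : X ⟶ X') (g : Y ⟶ Y') (m : X' ⟶ Z)
    (n : Z ⊗ Y' ⟶ W) : (f ⊗ₘ g) ≫ m ▷ Y' ≫ n = ((f ≫ m) ⊗ₘ g) ≫ n := by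
  rw [← Category.assoc, ← MonoidalCategory.tensorHom_id,
    MonoidalCategory.tensorHom_comp_tensorHom, Category.comp_id]

theorem tensorHom_whiskerLeft_assoc {X Y X' Y' Z W : M} (f : X ⟶ X') (g : Y ⟶ Y') (m : Y' ⟶ Z)
    (n : X' ⊗ Z ⟶ W) : (f ⊗ₘ g) ≫ X' ◁ m ≫ n = (f ⊗ₘ (g ≫ m)) ≫ n := by
  rw [← Category.assoc, ← MonoidalCategory.id_tensorHom,
    MonoidalCategory.tensorHom_comp_tensorHom, Category.comp_id]

theorem whiskerRight_tensorHom_assoc {X Y X' Y' Z W : M} (m : Z ⟶ X) (f : X ⟶ X') (g : Y ⟶ Y')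
    (n : X' ⊗ Y' ⟶ W) : m ▷ Y ≫ (f ⊗ₘ g) ≫ n = ((m ≫ f) ⊗ₘ g) ≫ n := by
  rw [← Category.assoc, ← MonoidalCategory.tensorHom_id,
    MonoidalCategory.tensorHom_comp_tensorHom, Category.id_comp]

theorem whiskerLeft_tensorHom_assoc {X Y X' Y' Z W : M} (m : Z ⟶ Y) (f : X ⟶ X') (g : Y ⟶ Y')
    (n : X' ⊗ Y' ⟶ W) : X ◁ m ≫ (f ⊗ₘ g) ≫ n = (f ⊗ₘ (m ≫ g)) ≫ n := by
  rw [← Category.assoc, ← MonoidalCategory.id_tensorHom,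
    MonoidalCategory.tensorHom_comp_tensorHom, Category.id_comp]

theorem compat_mul_aux {P X Y S T U Ac Ad Bc Bd ST TU ABc ABd K : M}
    {s : P ⟶ S} {t : P ⟶ T} {v : P ⟶ U} {xc : X ⟶ Ac} {xd : X ⟶ Ad} {yc : Y ⟶ Bc} {yd : Y ⟶ Bd}
    {m₁ : S ⊗ Ad ⟶ ST} {m₂ : Ac ⊗ T ⟶ ST} {m₃ : T ⊗ Bd ⟶ TU} {m₄ : Bc ⊗ U ⟶ TU}
    {mc : Ac ⊗ Bc ⟶ ABc} {md : Ad ⊗ Bd ⟶ ABd}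
    {n₁ : S ⊗ ABd ⟶ K} {n₂ : ST ⊗ Bd ⟶ K} {n₃ : Ac ⊗ TU ⟶ K} {n₄ : ABc ⊗ U ⟶ K}
    (h₁ : (s ⊗ₘ xd) ≫ m₁ = (β_ P X).hom ≫ (xc ⊗ₘ t) ≫ m₂)
    (h₂ : (t ⊗ₘ yd) ≫ m₃ = (β_ P Y).hom ≫ (yc ⊗ₘ v) ≫ m₄)
    (a₁ : m₁ ▷ Bd ≫ n₂ = (α_ S Ad Bd).hom ≫ S ◁ md ≫ n₁)
    (a₂ : m₂ ▷ Bd ≫ n₂ = (α_ Ac T Bd).hom ≫ Ac ◁ m₃ ≫ n₃)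
    (a₃ : mc ▷ U ≫ n₄ = (α_ Ac Bc U).hom ≫ Ac ◁ m₄ ≫ n₃) :
    (s ⊗ₘ ((xd ⊗ₘ yd) ≫ md)) ≫ n₁ =
      (β_ P (X ⊗ Y)).hom ≫ (((xc ⊗ₘ yc) ≫ mc) ⊗ₘ v) ≫ n₄ := by
  calc (s ⊗ₘ ((xd ⊗ₘ yd) ≫ md)) ≫ n₁
      = (s ⊗ₘ (xd ⊗ₘ yd)) ≫ S ◁ md ≫ n₁ := by rw [tensorHom_whiskerLeft_assoc]
    _ = (s ⊗ₘ (xd ⊗ₘ yd)) ≫ (α_ S Ad Bd).inv ≫ m₁ ▷ Bd ≫ n₂ := by rw [a₁]; simp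
    _ = (α_ P X Y).inv ≫ (((s ⊗ₘ xd) ≫ m₁) ⊗ₘ yd) ≫ n₂ := by
        rw [MonoidalCategory.associator_inv_naturality_assoc]
        rw [tensorHom_whiskerRight_assoc]
    _ = (α_ P X Y).inv ≫ (β_ P X).hom ▷ Y ≫ ((xc ⊗ₘ t) ⊗ₘ yd) ≫ m₂ ▷ Bd ≫ n₂ := by
        rw [h₁, tensorHom_whiskerRight_assoc, whiskerRight_tensorHom_assoc]
    _ = (α_ P X Y).inv ≫ (β_ P X).hom ▷ Y ≫ (α_ X P Y).hom ≫
          (xc ⊗ₘ ((t ⊗ₘ yd) ≫ m₃)) ≫ n₃ := by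
        rw [a₂, MonoidalCategory.associator_naturality_assoc, tensorHom_whiskerLeft_assoc]
    _ = (α_ P X Y).inv ≫ (β_ P X).hom ▷ Y ≫ (α_ X P Y).hom ≫ X ◁ (β_ P Y).hom ≫
          (xc ⊗ₘ (yc ⊗ₘ v)) ≫ Ac ◁ m₄ ≫ n₃ := by
        rw [h₂, tensorHom_whiskerLeft_assoc, whiskerLeft_tensorHom_assoc]
    _ = (α_ P X Y).inv ≫ (β_ P X).hom ▷ Y ≫ (α_ X P Y).hom ≫ X ◁ (β_ P Y).hom ≫
          (xc ⊗ₘ (yc ⊗ₘ v)) ≫ (α_ Ac Bc U).inv ≫ mc ▷ U ≫ n₄ := by rw [a₃]; simp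
    _ = _ := by
        rw [MonoidalCategory.associator_inv_naturality_assoc,
          BraidedCategory.braiding_tensor_right_hom, tensorHom_whiskerRight_assoc]
        simp only [Category.assoc]

theorem compat_one_aux {P S Ic Id : M} (s : P ⟶ S) {ec : 𝟙_ M ⟶ Ic} {ed : 𝟙_ M ⟶ Id}
    {m₁ : S ⊗ Id ⟶ S} {m₂ : Ic ⊗ S ⟶ S}
    (h₁ : S ◁ ed ≫ m₁ = (ρ_ S).hom) (h₂ : ec ▷ S ≫ m₂ = (λ_ S).hom) :
    (s ⊗ₘ ed) ≫ m₁ = (β_ P (𝟙_ M)).hom ≫ (ec ⊗ₘ s) ≫ m₂ := by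
  rw [MonoidalCategory.tensorHom_def, MonoidalCategory.tensorHom_def', Category.assoc,
    Category.assoc, h₁, h₂]
  simp

theorem elt_mul_aux {A B N AB BN K L : M} {e₁ : 𝟙_ M ⟶ A} {e₂ : 𝟙_ M ⟶ B} {e₃ : 𝟙_ M ⟶ N}
    {m : A ⊗ B ⟶ AB} {n : AB ⊗ N ⟶ L} {v : L ⟶ K} {n' : AB ⊗ N ⟶ K} {l : B ⊗ N ⟶ BN}
    {k : A ⊗ BN ⟶ K} (h₀ : n ≫ v = n') (h : m ▷ N ≫ n' = (α_ A B N).hom ≫ A ◁ l ≫ k) :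
    ((λ_ (𝟙_ M)).inv ≫ (((λ_ (𝟙_ M)).inv ≫ (e₁ ⊗ₘ e₂) ≫ m) ⊗ₘ e₃) ≫ n) ≫ v =
      (λ_ (𝟙_ M)).inv ≫ (e₁ ⊗ₘ ((λ_ (𝟙_ M)).inv ≫ (e₂ ⊗ₘ e₃) ≫ l)) ≫ k := by
  have h₁ : (((λ_ (𝟙_ M)).inv ≫ (e₁ ⊗ₘ e₂) ≫ m) ⊗ₘ e₃) ≫ n' =
      (λ_ (𝟙_ M)).inv ▷ 𝟙_ M ≫ ((e₁ ⊗ₘ e₂) ⊗ₘ e₃) ≫ m ▷ N ≫ n' := by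
    rw [tensorHom_whiskerRight_assoc, whiskerRight_tensorHom_assoc]
  have h₂ : (e₁ ⊗ₘ ((λ_ (𝟙_ M)).inv ≫ (e₂ ⊗ₘ e₃) ≫ l)) ≫ k =
      𝟙_ M ◁ (λ_ (𝟙_ M)).inv ≫ (e₁ ⊗ₘ (e₂ ⊗ₘ e₃)) ≫ A ◁ l ≫ k := by
    rw [tensorHom_whiskerLeft_assoc, whiskerLeft_tensorHom_assoc]
  have h₃ : (λ_ (𝟙_ M)).inv ▷ 𝟙_ M ≫ (α_ (𝟙_ M) (𝟙_ M) (𝟙_ M)).hom =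
      𝟙_ M ◁ (λ_ (𝟙_ M)).inv := by monoidal
  rw [Category.assoc, Category.assoc, h₀, h₁, h₂, h,
    MonoidalCategory.associator_naturality_assoc, reassoc_of% h₃]

namespace Compat

variable {σ τ υ : LaxMor F G}

theorem at_eq {α : StrictTrans σ.base τ.base} {X : M} {x : ∀ c, X ⟶ G.val (α.app c)}
    (hx : Compat σ τ α x) {c d : C} (f : c ⟶ d) (k : σ.base.obj c ⟶ τ.base.obj d)
    (hk : σ.base.map f ≫ α.app d = k) :
    (σ.app f ⊗ₘ x d) ≫ G.mul (σ.base.map f) (α.app d) k hk =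
      (β_ (F.val f) X).hom ≫ (x c ⊗ₘ τ.app f) ≫
        G.mul (α.app c) (τ.base.map f) k ((α.naturality f).symm.trans hk) := by
  subst hk
  exact hx f

theorem of_eq {α : StrictTrans σ.base τ.base} {X : M} {x : ∀ c, X ⟶ G.val (α.app c)}
    (h : ∀ (c d : C) (f : c ⟶ d), ∃ (k : σ.base.obj c ⟶ τ.base.obj d)
      (hk : σ.base.map f ≫ α.app d = k) (hk' : α.app c ≫ τ.base.map f = k),
      (σ.app f ⊗ₘ x d) ≫ G.mul (σ.base.map f) (α.app d) k hk =
      (β_ (F.val f) X).hom ≫ (x c ⊗ₘ τ.app f) ≫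
        G.mul (α.app c) (τ.base.map f) k hk') :
    Compat σ τ α x := by
  intro c d f
  obtain ⟨k, rfl, _, h⟩ := h c d f
  exact h

theorem precomp {α : StrictTrans σ.base τ.base} {X Y : M} (y : Y ⟶ X)
    {x : ∀ c, X ⟶ G.val (α.app c)} (hx : Compat σ τ α x) : Compat σ τ α fun c => y ≫ x c := by
  intro c d f
  have h := (F.val f) ◁ y ≫= hx f
  rw [BraidedCategory.braiding_naturality_right_assoc, whiskerLeft_tensorHom_assoc,
    whiskerRight_tensorHom_assoc] at h
  exact h

theorem one (σ : LaxMor F G) :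
    Compat σ σ (𝟙 σ.base : σ.base ⟶ σ.base) fun c => G.one (𝟙 (σ.base.obj c)) rfl :=
  of_eq (α := (𝟙 σ.base : σ.base ⟶ σ.base)) fun _ _ f => ⟨σ.base.map f, Bicategory.Strict.comp_id _, Bicategory.Strict.id_comp _,
    compat_one_aux (σ.app f) (G.mul_one' rfl _) (G.one_mul' rfl _)⟩

theorem mul {α : σ.base ⟶ τ.base} {β : τ.base ⟶ υ.base} {X Y : M}
    {x : ∀ c, X ⟶ G.val (StrictTrans.app α c)} {y : ∀ c, Y ⟶ G.val (StrictTrans.app β c)}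
    (hx : Compat σ τ α x) (hy : Compat τ υ β y) :
    Compat σ υ (α ≫ β : σ.base ⟶ υ.base) fun c =>
      (x c ⊗ₘ y c) ≫ G.mul (StrictTrans.app α c) (StrictTrans.app β c) _ rfl :=
  of_eq (α := (α ≫ β : σ.base ⟶ υ.base)) fun c d f => by
    have h₁ := StrictTrans.naturality α f
    have h₂ := StrictTrans.naturality β f
    have h₃ : (StrictTrans.app α c ≫ τ.base.map f) ≫ StrictTrans.app β d =
        σ.base.map f ≫ StrictTrans.app α d ≫ StrictTrans.app β d := by
      rw [← h₁, Bicategory.Strict.assoc]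
    have h₄ : StrictTrans.app α c ≫ τ.base.map f ≫ StrictTrans.app β d =
        σ.base.map f ≫ StrictTrans.app α d ≫ StrictTrans.app β d := by
      rw [← h₃, Bicategory.Strict.assoc]
    have h₅ : (StrictTrans.app α c ≫ StrictTrans.app β c) ≫ υ.base.map f =
        σ.base.map f ≫ StrictTrans.app α d ≫ StrictTrans.app β d := by
      rw [← h₄, h₂, Bicategory.Strict.assoc]
    exact ⟨_, rfl, h₅, compat_mul_aux (hx f) (hy f)
      (G.mul_assoc' rfl rfl (Bicategory.Strict.assoc _ _ _) rfl)
      (G.mul_assoc' _ rfl (Bicategory.Strict.assoc _ _ _) h₄)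
      (G.mul_assoc' rfl _ h₅ h₄)⟩

theorem modif {α β : StrictTrans σ.base τ.base} (Γ : Modif α β) {X : M}
    {x : ∀ c, X ⟶ G.val (α.app c)} (hx : Compat σ τ α x) :
    Compat σ τ β fun c => x c ≫ G.val₂ (Γ.app c) := by
  intro c d f
  have h := hx f =≫ G.val₂ (Bicategory.whiskerLeft (σ.base.map f) (Γ.app d))
  simp only [Category.assoc] at h
  rw [G.mul_naturality rfl rfl (𝟙 _) (Γ.app d) _ (by simp),
    G.mul_naturality _ (β.naturality f).symm (Γ.app c) (𝟙 _) _
      (by rw [Γ.whiskerLeft_app]; simp)] at h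
  rw [MonoidalCategory.tensorHom_comp_tensorHom_assoc,
    MonoidalCategory.tensorHom_comp_tensorHom_assoc, Lax.val₂_id, Lax.val₂_id,
    Category.comp_id, Category.comp_id] at h
  exact h

theorem whisker {C' D' : Type u} [Bicategory.{u, u} C'] [Bicategory.{u, u} D']
    [Bicategory.Strict D'] {F' : Lax C' M} {G' : Lax D' M} (φ : LaxMor F' F) (ψ : LaxMor G G')
    {α : StrictTrans σ.base τ.base} {X : M} {x : ∀ c, X ⟶ G.val (α.app c)}
    (hx : Compat σ τ α x) :
    Compat (φ.comp (σ.comp ψ)) (φ.comp (τ.comp ψ)) (TwoFunctor.whiskerTrans φ.base α ψ.base)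
      fun c => x (φ.base.obj c) ≫ ψ.app (α.app (φ.base.obj c)) :=
  of_eq fun c d f => by
    refine ⟨ψ.base.map (σ.base.map (φ.base.map f) ≫ α.app (φ.base.obj d)),
      (ψ.base.map_comp _ _).symm, ?_, ?_⟩
    · rw [α.naturality]
      exact (ψ.base.map_comp _ _).symm
    · have h := φ.app f ▷ X ≫= (hx (φ.base.map f) =≫ ψ.app _)
      rw [Category.assoc, ψ.mul_app', Category.assoc, Category.assoc, ψ.mul_app',
        BraidedCategory.braiding_naturality_left_assoc,
        MonoidalCategory.tensorHom_comp_tensorHom_assoc,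
        MonoidalCategory.tensorHom_comp_tensorHom_assoc, whiskerRight_tensorHom_assoc,
        whiskerLeft_tensorHom_assoc] at h
      exact h

end Compat

namespace NerveTrans

variable {σ τ υ : LaxMor F G}

theorem compat (η : NerveTrans σ τ) : Compat σ τ η.trans η.elt := by
  intro c d f
  rw [← cancel_epi (ρ_ (F.val f)).inv, η.hexagon f]
  simp

/-- A nerve-transformation from a strict 2-natural transformation and a compatible family of
elements. -/
@[simps]
def ofCompat (α : StrictTrans σ.base τ.base) (x : ∀ c, 𝟙_ M ⟶ G.val (α.app c))
    (hx : Compat σ τ α x) : NerveTrans σ τ where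
  trans := α
  elt := x
  hexagon f := by
    rw [hx f]
    simp

/-- The identity nerve-transformation. Its elements are the laxity maps `I ⟶ G(id)`. -/
@[simps!]
def id (σ : LaxMor F G) : NerveTrans σ σ :=
  ofCompat (𝟙 σ.base : σ.base ⟶ σ.base) (fun c => G.one (𝟙 (σ.base.obj c)) rfl) (Compat.one σ)

/-- The composition of nerve-transformations. Its elements are the composites
`I ≅ I ⊗ I ⟶ G(α_c) ⊗ G(β_c) ⟶ G(α_c ≫ β_c)`. -/
@[simps!]
def comp (η : NerveTrans σ τ) (θ : NerveTrans τ υ) : NerveTrans σ υ :=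
  ofCompat (CategoryStruct.comp (obj := TwoFunctor C D) η.trans θ.trans)
    (fun c => (λ_ (𝟙_ M)).inv ≫ (η.elt c ⊗ₘ θ.elt c) ≫
      G.mul (η.trans.app c) (θ.trans.app c) (η.trans.app c ≫ θ.trans.app c) rfl)
    ((Compat.mul (α := η.trans) (β := θ.trans) η.compat θ.compat).precomp _)

end NerveTrans

theorem elt_one_left_aux {A B K : M} {e : 𝟙_ M ⟶ A} {x : 𝟙_ M ⟶ B} {m : A ⊗ B ⟶ K} {v : K ⟶ B}
    {n : A ⊗ B ⟶ B} (h₁ : m ≫ v = n) (h : e ▷ B ≫ n = (λ_ B).hom) :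
    ((λ_ (𝟙_ M)).inv ≫ (e ⊗ₘ x) ≫ m) ≫ v = x := by
  rw [MonoidalCategory.tensorHom_def', Category.assoc, Category.assoc, Category.assoc, h₁, h]
  simp

theorem elt_one_right_aux {A B K : M} {e : 𝟙_ M ⟶ A} {x : 𝟙_ M ⟶ B} {m : B ⊗ A ⟶ K} {v : K ⟶ B}
    {n : B ⊗ A ⟶ B} (h₁ : m ≫ v = n) (h : B ◁ e ≫ n = (ρ_ B).hom) :
    ((λ_ (𝟙_ M)).inv ≫ (x ⊗ₘ e) ≫ m) ≫ v = x := by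
  rw [MonoidalCategory.tensorHom_def, Category.assoc, Category.assoc, Category.assoc, h₁, h]
  simp [MonoidalCategory.unitors_inv_equal]

theorem comp_comp_aux {X Y Z W : M} {e : X ⟶ Y} {p : Y ⟶ Z} {q : X ⟶ Z} {v : Z ⟶ W} {r : X ⟶ W}
    (h₁ : e ≫ p = q) (h₂ : q ≫ v = r) : (e ≫ p) ≫ v = r := by
  rw [h₁, h₂]

theorem elt_whisker_aux {X U V A B K A' B' K' L : M} {l : X ⟶ U ⊗ V} {a : U ⟶ A} {b : V ⟶ B}
    {m : A ⊗ B ⟶ K} {p : K ⟶ K'} {p₁ : A ⟶ A'} {p₂ : B ⟶ B'} {n : A' ⊗ B' ⟶ K'} {v : K' ⟶ L}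
    {n' : A' ⊗ B' ⟶ L} (h₁ : m ≫ p = (p₁ ⊗ₘ p₂) ≫ n) (h₂ : n ≫ v = n') :
    ((l ≫ (a ⊗ₘ b) ≫ m) ≫ p) ≫ v = l ≫ ((a ≫ p₁) ⊗ₘ (b ≫ p₂)) ≫ n' := by
  simp only [Category.assoc, reassoc_of% h₁, h₂, MonoidalCategory.tensorHom_comp_tensorHom_assoc]

/-- The category of morphisms from `F` to `G` and nerve-transformations. -/
instance : Category (LaxMor F G) where
  Hom σ τ := NerveTrans σ τ
  id σ := NerveTrans.id σ
  comp η θ := NerveTrans.comp η θ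
  id_comp {σ τ} η := NerveTrans.ext_elt (fun _ => Bicategory.Strict.id_comp _) fun _ =>
    elt_one_left_aux (G.mul_val₂ _ _) (G.one_mul' rfl _)
  comp_id {σ τ} η := NerveTrans.ext_elt (fun _ => Bicategory.Strict.comp_id _) fun _ =>
    elt_one_right_aux (G.mul_val₂ _ _) (G.mul_one' rfl _)
  assoc {σ τ υ ω} η θ κ := NerveTrans.ext_elt (fun _ => Bicategory.Strict.assoc _ _ _) fun _ =>
    elt_mul_aux (G.mul_val₂ _ _) (G.mul_assoc' rfl rfl _ rfl)

namespace LaxMor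

/-- The functor `Hom[F, G] ⥤ Hom[F', G']` given by the composition with a morphism `φ : F' ⟶ F` and
a morphism `ψ : G ⟶ G'`. -/
def whisker {C' D' : Type u} [Bicategory.{u, u} C'] [Bicategory.{u, u} D']
    [Bicategory.Strict D'] {F' : Lax C' M} {G' : Lax D' M} (φ : LaxMor F' F) (ψ : LaxMor G G') :
    LaxMor F G ⥤ LaxMor F' G' where
  obj σ := φ.comp (σ.comp ψ)
  map {σ τ} η := NerveTrans.ofCompat (σ := φ.comp (σ.comp ψ)) (τ := φ.comp (τ.comp ψ))
    (TwoFunctor.whiskerTrans φ.base (NerveTrans.trans η) ψ.base)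
    (fun c => NerveTrans.elt η (φ.base.obj c) ≫ ψ.app (η.trans.app (φ.base.obj c)))
    (Compat.whisker φ ψ (NerveTrans.compat η))
  map_id σ := NerveTrans.ext_elt (fun _ => ψ.base.map_id _) fun _ =>
    comp_comp_aux (ψ.one_app' _ rfl) (G'.one_val₂ _ rfl)
  map_comp {σ τ υ} η θ := NerveTrans.ext_elt (fun _ => ψ.base.map_comp _ _) fun _ =>
    elt_whisker_aux (ψ.mul_app' _ _ _ rfl) (G'.mul_val₂ _ _)

end LaxMor

end NerveTransformations

noncomputable section InternalHom

open MonoidalCategory Limits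

variable {M : Type u₁} [Category.{u} M] [MonoidalCategory M] [SymmetricCategory M]
  [MonoidalClosed M] [HasLimits M]

variable {C D : Type u} [Bicategory.{u, u} C] [Bicategory.{u, u} D] [Bicategory.Strict D]
variable {F : Lax C M} {G : Lax D M}

/-- The first of the two parallel maps: on the factor of `f : c ⟶ d` it is the transpose of
`F(f) ⊗ G(α_d) ⟶ G(p f) ⊗ G(α_d) ⟶ G(p f ≫ α_d)`. -/
def integralFst (σ τ : LaxMor F G) (α : StrictTrans σ.base τ.base) :
    (∏ᶜ fun c : C => G.val (α.app c)) ⟶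
      ∏ᶜ fun f : Σ x : C × C, x.1 ⟶ x.2 =>
        (ihom (F.val f.2)).obj (G.val (σ.base.map f.2 ≫ α.app f.1.2)) :=
  Pi.lift fun f => MonoidalClosed.curry
    ((σ.app f.2 ⊗ₘ Pi.π (fun c : C => G.val (α.app c)) f.1.2) ≫
      G.mul (σ.base.map f.2) (α.app f.1.2) (σ.base.map f.2 ≫ α.app f.1.2) rfl)

/-- The second of the two parallel maps: on the factor of `f : c ⟶ d` it is the transpose of
`F(f) ⊗ G(α_c) ≅ G(α_c) ⊗ F(f) ⟶ G(α_c) ⊗ G(q f) ⟶ G(α_c ≫ q f)`. -/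
def integralSnd (σ τ : LaxMor F G) (α : StrictTrans σ.base τ.base) :
    (∏ᶜ fun c : C => G.val (α.app c)) ⟶
      ∏ᶜ fun f : Σ x : C × C, x.1 ⟶ x.2 =>
        (ihom (F.val f.2)).obj (G.val (σ.base.map f.2 ≫ α.app f.1.2)) :=
  Pi.lift fun f => MonoidalClosed.curry
    ((β_ (F.val f.2) (∏ᶜ fun c : C => G.val (α.app c))).hom ≫
      (Pi.π (fun c : C => G.val (α.app c)) f.1.1 ⊗ₘ τ.app f.2) ≫
      G.mul (α.app f.1.1) (τ.base.map f.2) (σ.base.map f.2 ≫ α.app f.1.2)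
        (α.naturality f.2).symm)

/-- The object `∫ G(α)` of `M`, the equalizer of the two parallel maps. -/
def integral (σ τ : LaxMor F G) (α : StrictTrans σ.base τ.base) : M :=
  equalizer (integralFst σ τ α) (integralSnd σ τ α)

namespace integral

variable {σ τ υ : LaxMor F G}

/-- The projection `∫ G(α) ⟶ G(α_c)`. -/
def π (α : StrictTrans σ.base τ.base) (c : C) : integral σ τ α ⟶ G.val (α.app c) :=
  equalizer.ι (integralFst σ τ α) (integralSnd σ τ α) ≫ Pi.π (fun c : C => G.val (α.app c)) c

theorem hom_ext {α : StrictTrans σ.base τ.base} {X : M} {f g : X ⟶ integral σ τ α}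
    (h : ∀ c, f ≫ π α c = g ≫ π α c) : f = g := by
  refine equalizer.hom_ext (Pi.hom_ext _ _ fun c => ?_)
  exact (Category.assoc _ _ _).trans ((h c).trans (Category.assoc _ _ _).symm)

theorem compat_iff (α : StrictTrans σ.base τ.base) {X : M}
    (x : X ⟶ ∏ᶜ fun c : C => G.val (α.app c)) :
    (x ≫ integralFst σ τ α = x ≫ integralSnd σ τ α) ↔
      Compat σ τ α fun c => x ≫ Pi.π (fun c : C => G.val (α.app c)) c := by
  have key : ∀ {c d : C} (f : c ⟶ d),
      (x ≫ integralFst σ τ α ≫ Pi.π _ ⟨(c, d), f⟩ = x ≫ integralSnd σ τ α ≫ Pi.π _ ⟨(c, d), f⟩) ↔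
      (σ.app f ⊗ₘ (x ≫ Pi.π (fun c : C => G.val (α.app c)) d)) ≫
        G.mul (σ.base.map f) (α.app d) (σ.base.map f ≫ α.app d) rfl =
      (β_ (F.val f) X).hom ≫ ((x ≫ Pi.π (fun c : C => G.val (α.app c)) c) ⊗ₘ τ.app f) ≫
        G.mul (α.app c) (τ.base.map f) (σ.base.map f ≫ α.app d) (α.naturality f).symm := by
    intro c d f
    rw [integralFst, integralSnd, limit.lift_π, limit.lift_π]
    dsimp only [Fan.mk_pt, Fan.mk_π_app]
    rw [← MonoidalClosed.curry_natural_left, ← MonoidalClosed.curry_natural_left,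
      (MonoidalClosed.curry_injective).eq_iff, whiskerLeft_tensorHom_assoc,
      BraidedCategory.braiding_naturality_right_assoc, whiskerRight_tensorHom_assoc]
  constructor
  · intro h c d f
    rw [← key]
    simp only [← Category.assoc, h]
  · intro h
    refine Pi.hom_ext _ _ fun f => ?_
    rw [Category.assoc, Category.assoc]
    exact (key f.2).2 (h f.2)

theorem compat (α : StrictTrans σ.base τ.base) : Compat σ τ α (π α) :=
  (compat_iff α _).1 (equalizer.condition _ _)

/-- The morphism into `∫ G(α)` given by a compatible family. -/
def lift (α : StrictTrans σ.base τ.base) {X : M} (x : ∀ c, X ⟶ G.val (α.app c))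
    (hx : Compat σ τ α x) : X ⟶ integral σ τ α :=
  equalizer.lift (Pi.lift x) ((compat_iff α _).2 (by simpa using hx))

theorem lift_π (α : StrictTrans σ.base τ.base) {X : M} (x : ∀ c, X ⟶ G.val (α.app c))
    (hx : Compat σ τ α x) (c : C) : lift α x hx ≫ π α c = x c := by
  refine (Category.assoc _ _ _).symm.trans ?_
  refine (congrArg (· ≫ Pi.π (fun c : C => G.val (α.app c)) c) (equalizer.lift_ι _ _)).trans ?_
  exact limit.lift_π _ _

end integral

variable (F G) in
/-- The classifying 2-category of `F` and `G`. Its objects are the morphisms `F ⟶ G`; its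
1-morphisms are the strict 2-natural transformations `α` between the underlying 2-functors, each
carrying the object `∫ G(α)`; its 2-morphisms are the modifications. -/
abbrev Classifying := Bicategory.InducedBicategory (TwoFunctor C D)
  (LaxMor.base : LaxMor F G → TwoFunctor C D)

namespace HOM

theorem assoc_aux {A B N AB BN K K' A' B' N' AB' BN' L L' : M}
    {pA : A ⟶ A'} {pB : B ⟶ B'} {pN : N ⟶ N'} {pAB : AB ⟶ AB'} {pBN : BN ⟶ BN'} {pL : K ⟶ L}
    {pK : K' ⟶ L'} {m₁ : A ⊗ B ⟶ AB} {m₂ : AB ⊗ N ⟶ K} {v : K ⟶ K'} {m₃ : B ⊗ N ⟶ BN}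
    {m₄ : A ⊗ BN ⟶ K'} {n₁ : A' ⊗ B' ⟶ AB'} {n₂ : AB' ⊗ N' ⟶ L} {w : L ⟶ L'} {n₃ : B' ⊗ N' ⟶ BN'}
    {n₄ : A' ⊗ BN' ⟶ L'} (h₁ : m₁ ≫ pAB = (pA ⊗ₘ pB) ≫ n₁) (h₂ : m₂ ≫ pL = (pAB ⊗ₘ pN) ≫ n₂)
    (h₃ : m₃ ≫ pBN = (pB ⊗ₘ pN) ≫ n₃) (h₄ : m₄ ≫ pK = (pA ⊗ₘ pBN) ≫ n₄) (hv : v ≫ pK = pL ≫ w)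
    (h : n₁ ▷ N' ≫ n₂ ≫ w = (α_ A' B' N').hom ≫ A' ◁ n₃ ≫ n₄) :
    (m₁ ▷ N ≫ m₂ ≫ v) ≫ pK = ((α_ A B N).hom ≫ A ◁ m₃ ≫ m₄) ≫ pK := by
  rw [Category.assoc, Category.assoc, Category.assoc, Category.assoc, hv, h₄, reassoc_of% h₂,
    whiskerRight_tensorHom_assoc, whiskerLeft_tensorHom_assoc, h₁, h₃,
    ← tensorHom_whiskerRight_assoc, ← tensorHom_whiskerLeft_assoc, h,
    MonoidalCategory.associator_naturality_assoc]

theorem comp_aux {A A₁ A' L L₁ L' : M} {V : A ⟶ A'} {V₁ : A ⟶ A₁} {V₂ : A₁ ⟶ A'} {p : A' ⟶ L'}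
    {q : A ⟶ L} {r : A₁ ⟶ L₁} {w : L ⟶ L'} {w₁ : L ⟶ L₁} {w₂ : L₁ ⟶ L'} (h : V ≫ p = q ≫ w)
    (hw : w = w₁ ≫ w₂) (h₁ : V₁ ≫ r = q ≫ w₁) (h₂ : V₂ ≫ p = r ≫ w₂) :
    V ≫ p = (V₁ ≫ V₂) ≫ p := by
  rw [Category.assoc, h₂, reassoc_of% h₁, h, hw]

theorem one_mul_aux {A A' E E' K L : M} {e : 𝟙_ M ⟶ E} {e' : 𝟙_ M ⟶ E'} {p : E ⟶ E'} {q : A ⟶ A'}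
    {m : E ⊗ A ⟶ K} {v : K ⟶ A} {r : K ⟶ L} {m' : E' ⊗ A' ⟶ L} {v' : L ⟶ A'} (h₁ : e ≫ p = e')
    (h₂ : m ≫ r = (p ⊗ₘ q) ≫ m') (h₃ : v ≫ q = r ≫ v')
    (h : e' ▷ A' ≫ m' ≫ v' = (λ_ A').hom) :
    (e ▷ A ≫ m ≫ v) ≫ q = (λ_ A).hom ≫ q := by
  rw [Category.assoc, Category.assoc, h₃, reassoc_of% h₂, whiskerRight_tensorHom_assoc, h₁,
    MonoidalCategory.tensorHom_def', Category.assoc, h, MonoidalCategory.leftUnitor_naturality]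

theorem mul_one_aux {A A' E E' K L : M} {e : 𝟙_ M ⟶ E} {e' : 𝟙_ M ⟶ E'} {p : E ⟶ E'} {q : A ⟶ A'}
    {m : A ⊗ E ⟶ K} {v : K ⟶ A} {r : K ⟶ L} {m' : A' ⊗ E' ⟶ L} {v' : L ⟶ A'} (h₁ : e ≫ p = e')
    (h₂ : m ≫ r = (q ⊗ₘ p) ≫ m') (h₃ : v ≫ q = r ≫ v')
    (h : A' ◁ e' ≫ m' ≫ v' = (ρ_ A').hom) :
    (A ◁ e ≫ m ≫ v) ≫ q = (ρ_ A).hom ≫ q := by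
  rw [Category.assoc, Category.assoc, h₃, reassoc_of% h₂, whiskerLeft_tensorHom_assoc, h₁,
    MonoidalCategory.tensorHom_def, Category.assoc, h, MonoidalCategory.rightUnitor_naturality]

theorem left_aux {A B A' K K' B₀ A₀ A₀' L L' : M} {m : A ⊗ B ⟶ K} {v : K ⟶ K'} {p : K' ⟶ L'}
    {t : A ⟶ A'} {m' : A' ⊗ B ⟶ K'} {n : A₀ ⊗ B₀ ⟶ L} {n' : A₀' ⊗ B₀ ⟶ L'} {r : K ⟶ L}
    {w : L ⟶ L'} {s : A₀ ⟶ A₀'} {a : A ⟶ A₀} {a' : A' ⟶ A₀'} {b : B ⟶ B₀}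
    (h₁ : m ≫ r = (a ⊗ₘ b) ≫ n) (h₂ : v ≫ p = r ≫ w) (h₃ : m' ≫ p = (a' ⊗ₘ b) ≫ n')
    (h₄ : t ≫ a' = a ≫ s) (h : n ≫ w = s ▷ B₀ ≫ n') :
    (m ≫ v) ≫ p = (t ▷ B ≫ m') ≫ p := by
  rw [Category.assoc, Category.assoc, h₂, reassoc_of% h₁, h₃, h, whiskerRight_tensorHom_assoc, h₄,
    tensorHom_whiskerRight_assoc]

theorem right_aux {A B A' K K' B₀ A₀ A₀' L L' : M} {m : B ⊗ A ⟶ K} {v : K ⟶ K'} {p : K' ⟶ L'}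
    {t : A ⟶ A'} {m' : B ⊗ A' ⟶ K'} {n : B₀ ⊗ A₀ ⟶ L} {n' : B₀ ⊗ A₀' ⟶ L'} {r : K ⟶ L}
    {w : L ⟶ L'} {s : A₀ ⟶ A₀'} {a : A ⟶ A₀} {a' : A' ⟶ A₀'} {b : B ⟶ B₀}
    (h₁ : m ≫ r = (b ⊗ₘ a) ≫ n) (h₂ : v ≫ p = r ≫ w) (h₃ : m' ≫ p = (b ⊗ₘ a') ≫ n')
    (h₄ : t ≫ a' = a ≫ s) (h : n ≫ w = B₀ ◁ s ≫ n') :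
    (m ≫ v) ≫ p = (B ◁ t ≫ m') ≫ p := by
  rw [Category.assoc, Category.assoc, h₂, reassoc_of% h₁, h₃, h, whiskerLeft_tensorHom_assoc, h₄,
    tensorHom_whiskerLeft_assoc]

variable {σ τ υ : LaxMor F G}

/-- The map `∫ G(α) ⟶ ∫ G(β)` given by a modification `α ⟶ β`. -/
def val₂ {α β : StrictTrans σ.base τ.base} (Γ : Modif α β) : integral σ τ α ⟶ integral σ τ β :=
  integral.lift β (fun c => integral.π α c ≫ G.val₂ (Γ.app c)) ((integral.compat α).modif Γ)

theorem val₂_π {α β : StrictTrans σ.base τ.base} (Γ : Modif α β) (c : C) :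
    val₂ Γ ≫ integral.π β c = integral.π α c ≫ G.val₂ (Γ.app c) := integral.lift_π _ _ _ _

/-- The map `I ⟶ ∫ G(𝟙 p)`. -/
def one (σ : LaxMor F G) : 𝟙_ M ⟶ integral σ σ (𝟙 σ.base : σ.base ⟶ σ.base) :=
  integral.lift (𝟙 σ.base : σ.base ⟶ σ.base) _ (Compat.one σ)

theorem one_π (σ : LaxMor F G) (c : C) :
    one σ ≫ integral.π (𝟙 σ.base : σ.base ⟶ σ.base) c = G.one (𝟙 (σ.base.obj c)) rfl :=
  integral.lift_π _ _ (Compat.one σ) c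

/-- The map `∫ G(α) ⊗ ∫ G(β) ⟶ ∫ G(α ≫ β)`. -/
def mul (α : σ.base ⟶ τ.base) (β : τ.base ⟶ υ.base) :
    integral σ τ α ⊗ integral τ υ β ⟶ integral σ υ (α ≫ β : σ.base ⟶ υ.base) :=
  integral.lift (α ≫ β : σ.base ⟶ υ.base) _ (Compat.mul (integral.compat α) (integral.compat β))

theorem mul_π (α : σ.base ⟶ τ.base) (β : τ.base ⟶ υ.base) (c : C) :
    mul α β ≫ integral.π (α ≫ β : σ.base ⟶ υ.base) c =
      (integral.π α c ⊗ₘ integral.π β c) ≫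
        G.mul (StrictTrans.app α c) (StrictTrans.app β c)
          (StrictTrans.app α c ≫ StrictTrans.app β c) rfl :=
  integral.lift_π _ _ (Compat.mul (integral.compat α) (integral.compat β)) c

variable (F G) in
/-- The data of the lax functor `HOM(F, G)`. -/
def data : LaxData (Classifying F G) M where
  val {σ τ} α := integral (F := F) (G := G) σ τ α.hom
  val₂ {σ τ α β} Γ := val₂ (F := F) (G := G) (σ := σ) (τ := τ) Γ.hom
  one σ := one (F := F) (G := G) σ
  mul {σ τ υ} α β := mul (F := F) (G := G) (σ := σ) (τ := τ) (υ := υ) α.hom β.hom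
  val₂_id {σ τ} α := integral.hom_ext (F := F) (G := G) (σ := σ) (τ := τ) fun c => by
    refine (val₂_π _ c).trans ?_
    refine (congrArg (integral.π (F := F) (G := G) (σ := σ) (τ := τ) α.hom c ≫ ·)
      (G.val₂_id _)).trans ?_
    rw [Category.comp_id, Category.id_comp]
  val₂_comp {σ τ α β γ} Γ Γ' := integral.hom_ext (F := F) (G := G) (σ := σ) (τ := τ) fun c =>
    comp_aux (val₂_π _ c) (G.val₂_comp _ _) (val₂_π _ c) (val₂_π _ c)
  naturality_left {σ τ υ α β} Γ γ := integral.hom_ext (F := F) (G := G) (σ := σ) (τ := υ) fun c =>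
    left_aux (mul_π _ _ c) (val₂_π _ c) (mul_π _ _ c) (val₂_π _ c) (G.mul_whiskerRight _ _)
  naturality_right {σ τ υ} γ α β Γ := integral.hom_ext (F := F) (G := G) (σ := σ) (τ := υ)
    fun c =>
    right_aux (mul_π _ _ c) (val₂_π _ c) (mul_π _ _ c) (val₂_π _ c) (G.mul_whiskerLeft _ _)
  assoc {σ τ υ ω} α β γ := integral.hom_ext (F := F) (G := G) (σ := σ) (τ := ω) fun c =>
    assoc_aux (mul_π _ _ c) (mul_π _ _ c) (mul_π _ _ c) (mul_π _ _ c) (val₂_π _ c) (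
      (congrArg (fun t => _ ≫ _ ≫ G.val₂ t)
        (TwoFunctor.associator_app α.hom β.hom γ.hom c)).trans
        (G.assoc_hom _ _ _))
  one_mul {σ τ} α := integral.hom_ext (F := F) (G := G) (σ := σ) (τ := τ) fun c =>
    one_mul_aux (one_π _ c) (mul_π _ _ c) (val₂_π _ c) (
      (congrArg (fun t => _ ≫ _ ≫ G.val₂ t)
        (TwoFunctor.leftUnitor_app α.hom c)).trans
        (G.one_mul_hom _))
  mul_one {σ τ} α := integral.hom_ext (F := F) (G := G) (σ := σ) (τ := τ) fun c =>
    mul_one_aux (one_π _ c) (mul_π _ _ c) (val₂_π _ c) (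
      (congrArg (fun t => _ ≫ _ ≫ G.val₂ t)
        (TwoFunctor.rightUnitor_app α.hom c)).trans
        (G.mul_one_hom _))

end HOM

end InternalHom

noncomputable section Evaluation

open MonoidalCategory Limits

variable {M : Type u₁} [Category.{u} M] [MonoidalCategory M] [SymmetricCategory M]

theorem assoc_tensorHom_aux {X Y Z X' Y' Z' P Q K : M} {a : X ⟶ X'} {b : Y ⟶ Y'} {c : Z ⟶ Z'}
    {m : X' ⊗ Y' ⟶ P} {n : P ⊗ Z' ⟶ K} {l : Y' ⊗ Z' ⟶ Q} {k : X' ⊗ Q ⟶ K}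
    (h : m ▷ Z' ≫ n = (α_ X' Y' Z').hom ≫ X' ◁ l ≫ k) :
    (((a ⊗ₘ b) ≫ m) ⊗ₘ c) ≫ n = (α_ X Y Z).hom ≫ (a ⊗ₘ ((b ⊗ₘ c) ≫ l)) ≫ k := by
  rw [← tensorHom_whiskerRight_assoc, h, MonoidalCategory.associator_naturality_assoc,
    tensorHom_whiskerLeft_assoc]

theorem tensorμ_exchange (P A Q B : M) : tensorμ P A Q B ≫ (α_ P Q (A ⊗ B)).hom ≫
    P ◁ ((α_ Q A B).inv ≫ (β_ Q A).hom ▷ B ≫ (α_ A Q B).hom) = (α_ P A (Q ⊗ B)).hom := by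
  have h : (β_ A Q).hom ▷ B ≫ (β_ Q A).hom ▷ B = 𝟙 _ := by
    rw [← MonoidalCategory.comp_whiskerRight, SymmetricCategory.symmetry,
      MonoidalCategory.id_whiskerRight]
  simp only [tensorμ, Category.assoc, Iso.inv_hom_id_assoc, ← MonoidalCategory.whiskerLeft_comp,
    Iso.hom_inv_id_assoc, reassoc_of% h, Iso.inv_hom_id, MonoidalCategory.whiskerLeft_id,
    Category.comp_id]

theorem ev_mul_aux {P A Q B S S₂ T Ad Ae Be SS AB SA TB N R K : M} {s₁ : P ⟶ S} {s₂ : Q ⟶ S₂}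
    {t : Q ⟶ T} {ad : A ⟶ Ad} {ae : A ⟶ Ae} {b : B ⟶ Be} {m₁ : S ⊗ S₂ ⟶ SS} {m₂ : Ae ⊗ Be ⟶ AB}
    {m₃ : SS ⊗ AB ⟶ K} {m₄ : S ⊗ Ad ⟶ SA} {m₅ : T ⊗ Be ⟶ TB} {m₆ : SA ⊗ TB ⟶ K}
    {n₁ : S₂ ⊗ Ae ⟶ N} {n₂ : Ad ⊗ T ⟶ N} {q : N ⊗ Be ⟶ R} {r : S ⊗ R ⟶ K} {x₁ : S₂ ⊗ AB ⟶ R}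
    {x₂ : Ad ⊗ TB ⟶ R} (h : (s₂ ⊗ₘ ae) ≫ n₁ = (β_ Q A).hom ≫ (ad ⊗ₘ t) ≫ n₂)
    (h₁ : m₁ ▷ AB ≫ m₃ = (α_ S S₂ AB).hom ≫ S ◁ x₁ ≫ r)
    (h₂ : n₁ ▷ Be ≫ q = (α_ S₂ Ae Be).hom ≫ S₂ ◁ m₂ ≫ x₁)
    (h₃ : m₄ ▷ TB ≫ m₆ = (α_ S Ad TB).hom ≫ S ◁ x₂ ≫ r)
    (h₄ : n₂ ▷ Be ≫ q = (α_ Ad T Be).hom ≫ Ad ◁ m₅ ≫ x₂) :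
    tensorμ P A Q B ≫ (((s₁ ⊗ₘ s₂) ≫ m₁) ⊗ₘ ((ae ⊗ₘ b) ≫ m₂)) ≫ m₃ =
      (((s₁ ⊗ₘ ad) ≫ m₄) ⊗ₘ ((t ⊗ₘ b) ≫ m₅)) ≫ m₆ := by
  have e : (s₂ ⊗ₘ ((ae ⊗ₘ b) ≫ m₂)) ≫ x₁ =
      ((α_ Q A B).inv ≫ (β_ Q A).hom ▷ B ≫ (α_ A Q B).hom) ≫ (ad ⊗ₘ ((t ⊗ₘ b) ≫ m₅)) ≫ x₂ := by
    have e₁ := assoc_tensorHom_aux (a := s₂) (b := ae) (c := b) h₂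
    have e₂ := assoc_tensorHom_aux (a := ad) (b := t) (c := b) h₄
    rw [h, ← whiskerRight_tensorHom_assoc, e₂] at e₁
    rw [← cancel_epi (α_ Q A B).hom, ← e₁]
    simp only [Category.assoc, Iso.hom_inv_id_assoc]
  rw [assoc_tensorHom_aux h₁, assoc_tensorHom_aux h₃, e, ← whiskerLeft_tensorHom_assoc,
    ← tensorμ_exchange P A Q B]
  simp only [Category.assoc]

theorem ev_naturality_aux {P P' H H' S S' A A' K K' : M} {p : P ⟶ P'} {q : H ⟶ H'} {s : P ⟶ S}
    {s' : P' ⟶ S'} {a : H ⟶ A} {a' : H' ⟶ A'} {u : S ⟶ S'} {v : A ⟶ A'} {m : S ⊗ A ⟶ K}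
    {m' : S' ⊗ A' ⟶ K'} {w : K ⟶ K'} (h₁ : p ≫ s' = s ≫ u) (h₂ : q ≫ a' = a ≫ v)
    (h₃ : m ≫ w = (u ⊗ₘ v) ≫ m') :
    (p ⊗ₘ q) ≫ (s' ⊗ₘ a') ≫ m' = ((s ⊗ₘ a) ≫ m) ≫ w := by
  rw [Category.assoc, h₃, MonoidalCategory.tensorHom_comp_tensorHom_assoc,
    MonoidalCategory.tensorHom_comp_tensorHom_assoc, h₁, h₂]

theorem tensorμ_comp_aux {P A Q B PQ AB S S' K : M} {m : P ⊗ Q ⟶ PQ} {n : A ⊗ B ⟶ AB}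
    {s : PQ ⟶ S} {a : AB ⟶ S'} {x : P ⊗ Q ⟶ S} {y : A ⊗ B ⟶ S'} {k : S ⊗ S' ⟶ K}
    (h₁ : m ≫ s = x) (h₂ : n ≫ a = y) :
    (tensorμ P A Q B ≫ (m ⊗ₘ n)) ≫ (s ⊗ₘ a) ≫ k = tensorμ P A Q B ≫ (x ⊗ₘ y) ≫ k := by
  rw [Category.assoc, MonoidalCategory.tensorHom_comp_tensorHom_assoc, h₁, h₂]

theorem ev_one_aux {P H S A K : M} {e₁ : 𝟙_ M ⟶ P} {e₂ : 𝟙_ M ⟶ H} {s : P ⟶ S} {a : H ⟶ A}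
    {m : S ⊗ A ⟶ K} {x : 𝟙_ M ⟶ S} {y : 𝟙_ M ⟶ A} {z : 𝟙_ M ⟶ K} (h₁ : e₁ ≫ s = x)
    (h₂ : e₂ ≫ a = y) (h : (x ⊗ₘ y) ≫ m = (λ_ (𝟙_ M)).hom ≫ z) :
    ((λ_ (𝟙_ M)).inv ≫ (e₁ ⊗ₘ e₂)) ≫ (s ⊗ₘ a) ≫ m = z := by
  rw [Category.assoc, MonoidalCategory.tensorHom_comp_tensorHom_assoc, h₁, h₂, h,
    Iso.inv_hom_id_assoc]

variable [MonoidalClosed M] [HasLimits M]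

variable {C D : Type u} [Bicategory.{u, u} C] [Bicategory.{u, u} D] [Bicategory.Strict D]

/-- The internal hom `HOM(F, G)`, a lax functor on the classifying 2-category of `F` and `G`. -/
def HOM (F : Lax C M) (G : Lax D M) : Lax (Classifying F G) M := (HOM.data F G).toLax

variable {F : Lax C M} {G : Lax D M}

namespace HOM

/-- The projection `HOM(F, G)(α) = ∫ G(α) ⟶ G(α_c)`. -/
def π {σ τ : Classifying F G} (α : σ ⟶ τ) (c : C) :
    (HOM F G).val α ⟶ G.val (StrictTrans.app α.hom c) :=
  integral.π (F := F) (G := G) (σ := σ) (τ := τ) α.hom c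

theorem π_compat {σ τ : Classifying F G} (α : σ ⟶ τ) :
    Compat (F := F) (G := G) σ τ α.hom (π α) := integral.compat _

theorem hom_val₂_π {σ τ : Classifying F G} {α β : σ ⟶ τ} (Γ : α ⟶ β) (c : C) :
    (HOM F G).val₂ Γ ≫ π β c = π α c ≫ G.val₂ (Modif.app Γ.hom c) := val₂_π _ _

theorem hom_one_π {σ : Classifying F G} (i : σ ⟶ σ) (h : i = 𝟙 σ) (c : C) :
    (HOM F G).one i h ≫ π i c =
      G.one (StrictTrans.app i.hom c) (by rw [h]; rfl) := by
  subst h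
  refine Eq.trans ?_ (one_π (F := F) (G := G) σ c)
  rw [Lax.one_rfl]
  rfl

theorem hom_mul_π {σ τ υ : Classifying F G} (α : σ ⟶ τ) (β : τ ⟶ υ) (γ : σ ⟶ υ) (h : α ≫ β = γ)
    (c : C) :
    (HOM F G).mul α β γ h ≫ π γ c = (π α c ⊗ₘ π β c) ≫
      G.mul (StrictTrans.app α.hom c) (StrictTrans.app β.hom c) (StrictTrans.app γ.hom c)
        (by rw [← h]; rfl) := by
  subst h
  refine Eq.trans ?_ (mul_π (F := F) (G := G) (σ := σ) (τ := τ) (υ := υ) α.hom β.hom c)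
  rw [Lax.mul_rfl]
  rfl

variable (F G) in
/-- The forgetful 2-functor from the classifying 2-category to the 2-category of 2-functors. -/
@[simps, reducible]
def forget : TwoFunctor (Classifying F G) (TwoFunctor C D) where
  obj σ := LaxMor.base (F := F) (G := G) σ
  map α := α.hom
  map₂ Γ := Γ.hom
  map₂_whisker_left f g g' η := by
    simp
  map₂_whisker_right η g := by
    simp

variable (F G) in
/-- The evaluation `F ⊠ HOM(F, G) ⟶ G`. For a pair of a 1-morphism `f : c ⟶ d` and a transformation
`α : σ ⟶ τ` it is `F(f) ⊗ ∫ G(α) ⟶ G(σ f) ⊗ G(α_d) ⟶ G(σ f ≫ α_d)`. -/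
def ev : LaxMor (F.tensor (HOM F G)) G where
  base := ((TwoFunctor.id C).prod (forget F G)).comp (TwoFunctor.eval C D)
  app {x y} f :=
    (LaxMor.app (F := F) (G := G) x.2 f.1 ⊗ₘ π f.2 y.1) ≫
      G.mul ((LaxMor.base (F := F) (G := G) x.2).map f.1) (StrictTrans.app f.2.hom y.1) _ rfl
  naturality {x y f g} θ := by
    have h₁ := LaxMor.naturality (F := F) (G := G) x.2 θ.1
    have h₂ := hom_val₂_π (F := F) (G := G) θ.2 y.1
    have h₃ := G.mul_naturality rfl rfl
      ((LaxMor.base (F := F) (G := G) x.2).map₂ θ.1) (Modif.app θ.2.hom y.1) _ rfl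
    rw [eqToHom_refl, eqToHom_refl, Category.id_comp, Category.comp_id] at h₃
    exact ev_naturality_aux h₁ h₂ h₃
  one_app x := by
    rw [Lax.tensor_one]
    exact ev_one_aux (LaxMor.one_app (F := F) (G := G) x.2 x.1) (hom_one_π _ rfl x.1)
      (G.one_mul_one _ _ _ _)
  mul_app {x y z} f g := by
    rw [Lax.tensor_mul]
    have h₁ := LaxMor.mul_app (F := F) (G := G) x.2 f.1 g.1
    have h₂ := hom_mul_π (F := F) (G := G) f.2 g.2 _ rfl z.1
    refine (tensorμ_comp_aux h₁ h₂).trans ?_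
    have h₃ : (LaxMor.base (F := F) (G := G) x.2).map g.1 ≫ StrictTrans.app f.2.hom z.1 =
      StrictTrans.app f.2.hom y.1 ≫ (LaxMor.base (F := F) (G := G) y.2).map g.1 :=
        StrictTrans.naturality f.2.hom g.1
    have h₄ : (LaxMor.base (F := F) (G := G) x.2).map g.1 ≫ StrictTrans.app f.2.hom z.1 ≫
        StrictTrans.app g.2.hom z.1 = StrictTrans.app f.2.hom y.1 ≫
          (LaxMor.base (F := F) (G := G) y.2).map g.1 ≫ StrictTrans.app g.2.hom z.1 := by
      rw [← Bicategory.Strict.assoc, h₃, Bicategory.Strict.assoc]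
    have h₅ : (LaxMor.base (F := F) (G := G) x.2).map f.1 ≫ StrictTrans.app f.2.hom y.1 ≫
          (LaxMor.base (F := F) (G := G) y.2).map g.1 ≫ StrictTrans.app g.2.hom z.1 =
        (LaxMor.base (F := F) (G := G) x.2).map (f.1 ≫ g.1) ≫
          StrictTrans.app f.2.hom z.1 ≫ StrictTrans.app g.2.hom z.1 := by
      rw [← h₄, ← Bicategory.Strict.assoc, ← (LaxMor.base (F := F) (G := G) x.2).map_comp f.1 g.1]
    have h₆ : ((LaxMor.base (F := F) (G := G) x.2).map f.1 ≫ StrictTrans.app f.2.hom y.1) ≫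
          (LaxMor.base (F := F) (G := G) y.2).map g.1 ≫ StrictTrans.app g.2.hom z.1 =
        (LaxMor.base (F := F) (G := G) x.2).map (f.1 ≫ g.1) ≫
          StrictTrans.app f.2.hom z.1 ≫ StrictTrans.app g.2.hom z.1 := by
      rw [← h₅, Bicategory.Strict.assoc]
    have h₇ := (Bicategory.Strict.assoc (StrictTrans.app f.2.hom y.1)
      ((LaxMor.base (F := F) (G := G) y.2).map g.1) (StrictTrans.app g.2.hom z.1))
    have h₈ := (Bicategory.Strict.assoc ((LaxMor.base (F := F) (G := G) x.2).map g.1)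
      (StrictTrans.app f.2.hom z.1) (StrictTrans.app g.2.hom z.1))
    exact ev_mul_aux (π_compat f.2 g.1)
      (G.mul_assoc' ((LaxMor.base (F := F) (G := G) x.2).map_comp f.1 g.1).symm h₄ rfl h₅)
      (G.mul_assoc' rfl rfl (h₈.trans h₄) h₄) (G.mul_assoc' rfl rfl h₆ h₅)
      (G.mul_assoc' h₃.symm rfl (h₈.trans h₄) rfl)

end HOM

end Evaluation

noncomputable section Functoriality

open MonoidalCategory Limits

variable {M : Type u₁} [Category.{u} M] [MonoidalCategory M] [SymmetricCategory M]
  [MonoidalClosed M] [HasLimits M]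

variable {C D C' D' : Type u} [Bicategory.{u, u} C] [Bicategory.{u, u} D]
  [Bicategory.Strict D] [Bicategory.{u, u} C'] [Bicategory.{u, u} D'] [Bicategory.Strict D']
variable {F : Lax C M} {G : Lax D M} {F' : Lax C' M} {G' : Lax D' M}

namespace HOM

theorem map_naturality_aux {I J I' J' A B A' B' : M} {v : I ⟶ J} {l₁ : I ⟶ I'} {l₂ : J ⟶ J'}
    {v' : I' ⟶ J'} {a : I ⟶ A} {b : J ⟶ B} {a' : I' ⟶ A'} {b' : J' ⟶ B'} {s : A ⟶ A'} {t : B ⟶ B'}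
    {w : A ⟶ B} {w' : A' ⟶ B'} (h₁ : l₁ ≫ a' = a ≫ s) (h₂ : l₂ ≫ b' = b ≫ t) (h₃ : v ≫ b = a ≫ w)
    (h₄ : v' ≫ b' = a' ≫ w') (h₅ : w ≫ t = s ≫ w') : (v ≫ l₂) ≫ b' = (l₁ ≫ v') ≫ b' := by
  rw [Category.assoc, Category.assoc, h₂, h₄, reassoc_of% h₁, reassoc_of% h₃, h₅]

theorem map_one_aux {U I I' A A' : M} {e : U ⟶ I} {l : I ⟶ I'} {a : I ⟶ A} {a' : I' ⟶ A'}
    {s : A ⟶ A'} {x : U ⟶ A} {e' : U ⟶ I'} {x' : U ⟶ A'} (h₁ : l ≫ a' = a ≫ s) (h₂ : e ≫ a = x)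
    (h₃ : e' ≫ a' = x') (h : x ≫ s = x') : (e ≫ l) ≫ a' = e' ≫ a' := by
  rw [Category.assoc, h₁, reassoc_of% h₂, h, h₃]

theorem map_mul_aux {I J K I' J' K' A B L A' B' L' : M} {m : I ⊗ J ⟶ K} {m' : I' ⊗ J' ⟶ K'}
    {l₁ : I ⟶ I'} {l₂ : J ⟶ J'} {l₃ : K ⟶ K'} {a : I ⟶ A} {b : J ⟶ B} {k : K ⟶ L} {a' : I' ⟶ A'}
    {b' : J' ⟶ B'} {k' : K' ⟶ L'} {s : A ⟶ A'} {t : B ⟶ B'} {r : L ⟶ L'} {n : A ⊗ B ⟶ L}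
    {n' : A' ⊗ B' ⟶ L'} (h₁ : l₁ ≫ a' = a ≫ s) (h₂ : l₂ ≫ b' = b ≫ t) (h₃ : l₃ ≫ k' = k ≫ r)
    (h₄ : m ≫ k = (a ⊗ₘ b) ≫ n) (h₅ : m' ≫ k' = (a' ⊗ₘ b') ≫ n') (h₆ : n ≫ r = (s ⊗ₘ t) ≫ n') :
    (m ≫ l₃) ≫ k' = ((l₁ ⊗ₘ l₂) ≫ m') ≫ k' := by
  rw [Category.assoc, Category.assoc, h₃, h₅, reassoc_of% h₄, h₆,
    MonoidalCategory.tensorHom_comp_tensorHom_assoc,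
    MonoidalCategory.tensorHom_comp_tensorHom_assoc, h₁, h₂]

theorem eqToHom_comp_app {σ τ : Classifying F G} {α α' β β' : σ ⟶ τ} (h : α = α') (Γ : α' ⟶ β')
    (h' : β' = β) (c : C) : Modif.app (eqToHom h ≫ Γ ≫ eqToHom h').hom c =
      eqToHom (by rw [h]) ≫ Modif.app Γ.hom c ≫ eqToHom (by rw [h']) := by
  subst h h'
  rw [eqToHom_refl, eqToHom_refl, eqToHom_refl, eqToHom_refl, Category.id_comp, Category.comp_id,
    Category.id_comp, Category.comp_id]

/-- The composite `F' ⟶ F ⟶ G ⟶ G'`. -/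
def mapObj (φ : LaxMor F' F) (ψ : LaxMor G G') (σ : Classifying F G) : Classifying F' G' :=
  LaxMor.comp φ (LaxMor.comp (E := F) (F := G) (G := G') σ ψ)

/-- The 2-functor between the classifying 2-categories given by the composition with `φ : F' ⟶ F`
and `ψ : G ⟶ G'`. -/
def mapBase (φ : LaxMor F' F) (ψ : LaxMor G G') :
    TwoFunctor (Classifying F G) (Classifying F' G') where
  obj σ := mapObj φ ψ σ
  map {σ τ} α := Bicategory.InducedBicategory.mkHom (X := mapObj φ ψ σ) (Y := mapObj φ ψ τ)
    (TwoFunctor.whiskerTrans φ.base α.hom ψ.base)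
  map₂ {σ τ α β} Γ := Bicategory.InducedBicategory.Hom₂.mk
    (TwoFunctor.whiskerModif φ.base Γ.hom ψ.base)
  map₂_id {σ τ} α := Bicategory.InducedBicategory.hom₂_ext (Modif.ext fun c =>
    ψ.base.map₂_id _)
  map₂_comp {σ τ α β γ} Γ Γ' := Bicategory.InducedBicategory.hom₂_ext (Modif.ext fun c =>
    ψ.base.map₂_comp _ _)
  map_id σ := Bicategory.InducedBicategory.hom_ext (StrictTrans.ext fun c => ψ.base.map_id _)
  map_comp α β := Bicategory.InducedBicategory.hom_ext (StrictTrans.ext fun c =>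
    ψ.base.map_comp _ _)
  map₂_whisker_left {σ τ υ} γ α β Γ := Bicategory.InducedBicategory.hom₂_ext (Modif.ext fun c => by
    refine Eq.trans ?_ (eqToHom_comp_app (F := F') (G := G') _ _ _ c).symm
    exact ψ.base.map₂_whisker_left _ _)
  map₂_whisker_right {σ τ υ α β} Γ γ := Bicategory.InducedBicategory.hom₂_ext (Modif.ext fun c => by
    refine Eq.trans ?_ (eqToHom_comp_app (F := F') (G := G') _ _ _ c).symm
    exact ψ.base.map₂_whisker_right _ _)

/-- The map `∫ G(α) ⟶ ∫ G'(ψ α φ)`. -/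
def mapApp (φ : LaxMor F' F) (ψ : LaxMor G G') {σ τ : Classifying F G} (α : σ ⟶ τ) :
    (HOM F G).val α ⟶ (HOM F' G').val ((mapBase φ ψ).map α) :=
  integral.lift (F := F') (G := G') (σ := mapObj φ ψ σ) (τ := mapObj φ ψ τ)
    (TwoFunctor.whiskerTrans φ.base α.hom ψ.base) _ (Compat.whisker φ ψ (π_compat α))

theorem mapApp_π (φ : LaxMor F' F) (ψ : LaxMor G G') {σ τ : Classifying F G} (α : σ ⟶ τ)
    (c : C') : mapApp φ ψ α ≫ π ((mapBase φ ψ).map α) c =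
      π α (φ.base.obj c) ≫ ψ.app (StrictTrans.app α.hom (φ.base.obj c)) :=
  integral.lift_π (F := F') (G := G') (σ := mapObj φ ψ σ) (τ := mapObj φ ψ τ)
    (TwoFunctor.whiskerTrans φ.base α.hom ψ.base) _ (Compat.whisker φ ψ (π_compat α)) c

theorem hom_ext {σ τ : Classifying F G} {α : σ ⟶ τ} {X : M} {f g : X ⟶ (HOM F G).val α}
    (h : ∀ c, f ≫ π α c = g ≫ π α c) : f = g :=
  integral.hom_ext (F := F) (G := G) (σ := σ) (τ := τ) h

/-- The functoriality `HOM(F, G) ⟶ HOM(F', G')` of the internal hom. -/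
def map (φ : LaxMor F' F) (ψ : LaxMor G G') : LaxMor (HOM F G) (HOM F' G') where
  base := mapBase φ ψ
  app {σ τ} α := mapApp φ ψ α
  naturality {σ τ α β} Γ := hom_ext fun c => by
    have h₁ := mapApp_π φ ψ α c
    have h₂ := mapApp_π φ ψ β c
    have h₃ := hom_val₂_π Γ (φ.base.obj c)
    have h₄ := hom_val₂_π ((mapBase φ ψ).map₂ Γ) c
    have h₅ := ψ.naturality (Modif.app Γ.hom (φ.base.obj c))
    exact map_naturality_aux h₁ h₂ h₃ h₄ h₅
  one_app σ := hom_ext fun c => by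
    have h₁ := mapApp_π φ ψ (𝟙 σ) c
    have h₂ := hom_one_π (𝟙 σ) rfl (φ.base.obj c)
    have h₃ := hom_one_π ((mapBase φ ψ).map (𝟙 σ)) ((mapBase φ ψ).map_id σ) c
    exact map_one_aux h₁ h₂ h₃ (ψ.one_app' _ _)
  mul_app {σ τ υ} α β := hom_ext fun c => by
    have h₁ := mapApp_π φ ψ α c
    have h₂ := mapApp_π φ ψ β c
    have h₃ := mapApp_π φ ψ (α ≫ β) c
    have h₄ := hom_mul_π α β _ rfl (φ.base.obj c)
    have h₅ := hom_mul_π ((mapBase φ ψ).map α) ((mapBase φ ψ).map β) _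
      ((mapBase φ ψ).map_comp α β).symm c
    have h₆ := ψ.mul_app' (StrictTrans.app α.hom (φ.base.obj c))
      (StrictTrans.app β.hom (φ.base.obj c)) _ rfl
    exact map_mul_aux h₁ h₂ h₃ h₄ h₅ h₆

end HOM

/-- The internal hom of two objects of the category of lax functors. -/
def LaxCat.homObj (X Y : LaxCat M) : LaxCat M where
  index := Classifying X.functor Y.functor
  functor := HOM X.functor Y.functor

/-- The functoriality of the internal hom, contravariant in the first variable. -/
def LaxCat.homMap {X X' Y Y' : LaxCat M} (φ : X' ⟶ X) (ψ : Y ⟶ Y') :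
    X.homObj Y ⟶ X'.homObj Y' := HOM.map φ ψ

/-- The evaluation morphism. -/
def LaxCat.ev (X Y : LaxCat M) : X.tensorObj (X.homObj Y) ⟶ Y := HOM.ev X.functor Y.functor

end Functoriality

section HomCategories

variable {M : Type u₁} [Category.{u} M] [MonoidalCategory M] [SymmetricCategory M]

/-- The category `Hom[X, Y]` of morphisms of lax functors from `X` to `Y` and
nerve-transformations. -/
def LaxCat.homCat (X Y : LaxCat M) : Cat.{u, u} := Cat.of (LaxMor X.functor Y.functor)

/-- The functor `Hom[X, Y] ⥤ Hom[X', Y']` given by the composition with `φ : X' ⟶ X` and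
`ψ : Y ⟶ Y'`. -/
def LaxCat.homCatMap {X X' Y Y' : LaxCat M} (φ : X' ⟶ X) (ψ : Y ⟶ Y') :
    X.homCat Y ⟶ X'.homCat Y' := (LaxMor.whisker φ ψ).toCatHom

/-- A morphism of lax functors, as an object of the category `Hom[X, Y]`. -/
def LaxCat.homCatObj {X Y : LaxCat M} (φ : X ⟶ Y) : X.homCat Y := φ

end HomCategories

end LaxDiagram

/-! Every 1-morphism of C × B factors as (f, k) = (f, 1)(1, k), and every 2-morphism factors
accordingly. The sections c ↦ (c, b) and b ↦ (c, b) lift to morphisms `inl F E b : F ⟶ F ⊠ E` and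
`inr F E c : E ⟶ F ⊠ E`, which insert the units I ⟶ E(1_b) and I ⟶ F(1_c). By the unit laws, the
laxity map of F ⊠ E multiplies the inserted F(f) and E(k) back to the identity of F(f) ⊗ E(k). A
morphism γ out of F ⊠ E is therefore determined by its restrictions along all `inl` and `inr`
(`LaxMor.tensor_ext`). Dually, a morphism δ into HOM(F, G) is determined by its values on objects
and its composites with the evaluations `evAt F G c` (`HOM.lax_ext`), because transformations and
modifications are families of components and ∫ G(α) is detected by its projections.

These two families of data correspond. Restricting ev ∘ (Id ⊠ δ) along `inl` at b gives δ(b), and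
along `inr` at c it gives δ followed by `evAt` at c (`inl_comp_uncurry`, `inr_comp_uncurry`). In the
other direction there is a coevaluation E ⟶ HOM(F, F ⊠ E) that sends b to `inl F E b` and becomes
`inr F E c` after evaluation at c. It lands in the equalizers because F(f) and E(k) can be
multiplied in either order with the same result, up to the symmetry of M. Currying is coevaluation
followed by HOM(F, γ). Both round trips and the naturality on objects then follow by comparing
restrictions.

For arrows, a nerve-transformation between uncurried morphisms has components and elements indexed
by pairs (c, b). For fixed b, the hexagons over C say that the elements form a point of ∫ G(α_b);
for fixed c, the hexagons over B are the projection at c of the hexagons of a nerve-transformation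
into HOM(F, G). Hexagons compose along (f, 1)(1, k), so these two families imply all the others
(`Compat.ofSections`). Uncurrying is thus a fully faithful functor that is bijective on objects,
that is, an isomorphism of categories. -/

namespace LaxDiagram

/-! ### Heterogeneous equality in 2-categories -/

section HeterogeneousEquality

open Bicategory

variable {B C D : Type u} [Bicategory.{u, u} B] [Bicategory.{u, u} C] [Bicategory.{u, u} D]

theorem comp_heq {x y z x' y' z' : D} {f : x ⟶ y} {g : y ⟶ z} {f' : x' ⟶ y'} {g' : y' ⟶ z'}
    (hx : x = x') (hy : y = y') (hz : z = z') (hf : HEq f f') (hg : HEq g g') :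
    HEq (f ≫ g) (f' ≫ g') := by
  subst hx hy hz hf hg
  rfl

theorem comp₂_heq {x y x' y' : D} {f g h : x ⟶ y} {f' g' h' : x' ⟶ y'} {η : f ⟶ g} {θ : g ⟶ h}
    {η' : f' ⟶ g'} {θ' : g' ⟶ h'} (hx : x = x') (hy : y = y') (hf : HEq f f') (hg : HEq g g')
    (hh : HEq h h') (hη : HEq η η') (hθ : HEq θ θ') : HEq (η ≫ θ) (η' ≫ θ') := by
  subst hx hy hf hg hh hη hθ
  rfl

theorem whiskerLeft_heq {x y z x' y' z' : D} {f : x ⟶ y} {g h : y ⟶ z} {f' : x' ⟶ y'}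
    {g' h' : y' ⟶ z'} {η : g ⟶ h} {η' : g' ⟶ h'} (hx : x = x') (hy : y = y') (hz : z = z')
    (hf : HEq f f') (hg : HEq g g') (hh : HEq h h') (hη : HEq η η') :
    HEq (f ◁ η) (f' ◁ η') := by
  subst hx hy hz hf hg hh hη
  rfl

theorem whiskerRight_heq {x y z x' y' z' : D} {f g : x ⟶ y} {h : y ⟶ z} {f' g' : x' ⟶ y'}
    {h' : y' ⟶ z'} {η : f ⟶ g} {η' : f' ⟶ g'} (hx : x = x') (hy : y = y') (hz : z = z')
    (hf : HEq f f') (hg : HEq g g') (hh : HEq h h') (hη : HEq η η') :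
    HEq (η ▷ h) (η' ▷ h') := by
  subst hx hy hz hf hg hh hη
  rfl

/-- Turns the form in which naturality of transformations is stated into a heterogeneous equality,
which composes without bookkeeping of endpoints. The converse is `comp_eqToHom_of_heq`. -/
theorem heq_of_comp_eqToHom {x y : D} {f g f' g' : x ⟶ y} {η : f ⟶ g} {η' : f' ⟶ g'}
    (hf : f = f') (hg : g = g') (h : η ≫ eqToHom hg = eqToHom hf ≫ η') : HEq η η' := by
  subst hf hg
  simpa using h

theorem eqToHom_comp_comp_eqToHom_heq {x y : D} {f g f' g' : x ⟶ y} (η : f' ⟶ g')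
    (hf : f = f') (hg : g' = g) : HEq (eqToHom hf ≫ η ≫ eqToHom hg) η := by
  subst hf hg
  simp

/-- Only the three layers of data matter, the laws being propositions. The layers are identified in
the order objects, 1-morphisms, 2-morphisms, since the type of each depends on the one before. -/
theorem TwoFunctor.hext {p q : TwoFunctor C D} (h₀ : ∀ c, p.obj c = q.obj c)
    (h₁ : ∀ {c d : C} (f : c ⟶ d), HEq (p.map f) (q.map f))
    (h₂ : ∀ {c d : C} {f g : c ⟶ d} (θ : f ⟶ g), HEq (p.map₂ θ) (q.map₂ θ)) : p = q := by
  rcases p with ⟨⟨⟨⟨po, pm⟩, pt⟩, _, _⟩, _, _, _, _⟩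
  rcases q with ⟨⟨⟨⟨qo, qm⟩, qt⟩, _, _⟩, _, _, _, _⟩
  obtain rfl : po = qo := funext h₀
  obtain rfl : @pm = @qm := by
    funext c d f
    exact eq_of_heq (h₁ f)
  obtain rfl : @pt = @qt := by
    funext c d f g θ
    exact eq_of_heq (h₂ θ)
  rfl

/-- A strict 2-natural transformation with new endpoints and new components that are equal to the
old ones. -/
def StrictTrans.copy {p q p' q' : TwoFunctor C D} (α : StrictTrans p q) (hp : p = p') (hq : q = q')
    (a : ∀ c, p'.obj c ⟶ q'.obj c) (h : ∀ c, HEq (α.app c) (a c)) : StrictTrans p' q' where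
  app := a
  naturality f := by
    subst hp hq
    obtain rfl : α.app = a := funext fun c => eq_of_heq (h c)
    exact α.naturality f
  naturality₂ θ := by
    subst hp hq
    obtain rfl : α.app = a := funext fun c => eq_of_heq (h c)
    exact α.naturality₂ θ

end HeterogeneousEquality

/-! ### Extensionality for morphisms and nerve-transformations -/

section LaxHeterogeneousEquality

open MonoidalCategory

variable {M : Type u₁} [Category.{u} M] [MonoidalCategory M]

variable {B C D : Type u} [Bicategory.{u, u} B] [Bicategory.{u, u} C] [Bicategory.{u, u} D]

/-- Morphisms into values of G at equal 1-morphisms are compared by the transport `G.val₂ (eqToHom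
_)`, which is how the unit and multiplication laws produce their equations. -/
theorem Lax.heq_of_comp_val₂ (G : Lax D M) {x y : D} {f f' : x ⟶ y} {X : M} {s : X ⟶ G.val f}
    {s' : X ⟶ G.val f'} (hf : f = f') (h : s ≫ G.val₂ (eqToHom hf) = s') : HEq s s' := by
  subst hf
  simpa using h

theorem Lax.tensorHom_comp_mul_heq (G : Lax D M) {x y z x' y' z' : D} {f : x ⟶ y} {g : y ⟶ z}
    {k : x ⟶ z} {f' : x' ⟶ y'} {g' : y' ⟶ z'} {k' : x' ⟶ z'} {X Y : M} {s : X ⟶ G.val f}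
    {t : Y ⟶ G.val g} {s' : X ⟶ G.val f'} {t' : Y ⟶ G.val g'} (h : f ≫ g = k) (h' : f' ≫ g' = k')
    (hx : x = x') (hy : y = y') (hz : z = z') (hf : HEq f f') (hg : HEq g g') (hs : HEq s s')
    (ht : HEq t t') : HEq ((s ⊗ₘ t) ≫ G.mul f g k h) ((s' ⊗ₘ t') ≫ G.mul f' g' k' h') := by
  subst hx hy hz hf hg hs ht h h'
  rfl

namespace LaxMor

variable {A : Type u} [Bicategory.{u, u} A]
variable {H : Lax A M} {E : Lax B M} {F : Lax C M} {G : Lax D M}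

theorem hext {σ τ : LaxMor F G} (h₀ : ∀ c, σ.base.obj c = τ.base.obj c)
    (h₁ : ∀ {c d : C} (f : c ⟶ d), HEq (σ.base.map f) (τ.base.map f))
    (h₂ : ∀ {c d : C} {f g : c ⟶ d} (θ : f ⟶ g), HEq (σ.base.map₂ θ) (τ.base.map₂ θ))
    (h₃ : ∀ {c d : C} (f : c ⟶ d), HEq (σ.app f) (τ.app f)) : σ = τ :=
  ext_app (TwoFunctor.hext h₀ h₁ h₂) h₃

theorem comp_assoc (σ : LaxMor H E) (τ : LaxMor E F) (υ : LaxMor F G) :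
    (σ.comp τ).comp υ = σ.comp (τ.comp υ) :=
  ext_app rfl fun _ => heq_of_eq (Category.assoc _ _ _)

theorem id_comp (σ : LaxMor F G) : (LaxMor.id F).comp σ = σ :=
  ext_app rfl fun _ => heq_of_eq (Category.id_comp _)

theorem obj_congr {σ τ : LaxMor F G} (h : σ = τ) (c : C) : σ.base.obj c = τ.base.obj c := by
  rw [h]

theorem map_heq {σ τ : LaxMor F G} (h : σ = τ) {c d : C} (f : c ⟶ d) :
    HEq (σ.base.map f) (τ.base.map f) := by
  rw [h]

theorem map₂_heq {σ τ : LaxMor F G} (h : σ = τ) {c d : C} {f g : c ⟶ d} (θ : f ⟶ g) :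
    HEq (σ.base.map₂ θ) (τ.base.map₂ θ) := by
  rw [h]

theorem app_heq {σ τ : LaxMor F G} (h : σ = τ) {c d : C} (f : c ⟶ d) :
    HEq (σ.app f) (τ.app f) := by
  rw [h]

end LaxMor

theorem NerveTrans.hext [Bicategory.Strict D] {F : Lax C M} {G : Lax D M} {σ τ σ' τ' : LaxMor F G}
    (hσ : σ = σ') (hτ : τ = τ') {η : NerveTrans σ τ} {η' : NerveTrans σ' τ'}
    (h : ∀ c, HEq (η.trans.app c) (η'.trans.app c)) (h' : ∀ c, HEq (η.elt c) (η'.elt c)) :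
    HEq η η' := by
  subst hσ hτ
  rcases η with ⟨α, x, _⟩
  rcases η' with ⟨β, y, _⟩
  obtain rfl : α = β := StrictTrans.ext fun c => eq_of_heq (h c)
  obtain rfl : x = y := funext fun c => eq_of_heq (h' c)
  rfl

/-- The endpoints obtained by restricting a composite are often only provably equal to the expected
morphisms. This moves the hexagons across such an equality while the components and the elements
stay the same. -/
theorem Compat.copy [SymmetricCategory M] [Bicategory.Strict D] {F : Lax C M} {G : Lax D M}
    {σ τ σ' τ' : LaxMor F G} (hσ : σ = σ') (hτ : τ = τ') {α : StrictTrans σ.base τ.base}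
    {α' : StrictTrans σ'.base τ'.base} (hα : ∀ c, HEq (α.app c) (α'.app c)) {X : M}
    {x : ∀ c, X ⟶ G.val (α.app c)} {x' : ∀ c, X ⟶ G.val (α'.app c)} (h : ∀ c, HEq (x c) (x' c))
    (hx : Compat σ τ α x) : Compat σ' τ' α' x' := by
  subst hσ hτ
  obtain rfl : α = α' := StrictTrans.ext fun c => eq_of_heq (hα c)
  obtain rfl : x = x' := funext fun c => eq_of_heq (h c)
  exact hx

end LaxHeterogeneousEquality

/-! ### Coherence of the middle-four interchange with units -/

section Coherence

open MonoidalCategory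

variable {M : Type u₁} [Category.{u} M] [MonoidalCategory M] [SymmetricCategory M]

theorem unit_tensorμ_right (P Q : M) :
    ((ρ_ P).inv ⊗ₘ (ρ_ Q).inv) ≫ tensorμ P (𝟙_ M) Q (𝟙_ M) =
      (ρ_ (P ⊗ Q)).inv ≫ (P ⊗ Q) ◁ (λ_ (𝟙_ M)).inv := by
  have h := rightUnitor_monoidal P Q
  rw [← cancel_mono ((P ⊗ Q) ◁ (λ_ (𝟙_ M)).hom), ← cancel_mono (ρ_ (P ⊗ Q)).hom,
    Category.assoc, Category.assoc, ← h]
  simp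

theorem unit_tensorμ_left (P Q : M) :
    ((λ_ P).inv ⊗ₘ (λ_ Q).inv) ≫ tensorμ (𝟙_ M) P (𝟙_ M) Q =
      (λ_ (P ⊗ Q)).inv ≫ (λ_ (𝟙_ M)).inv ▷ (P ⊗ Q) := by
  have h := leftUnitor_monoidal P Q
  rw [← cancel_mono ((λ_ (𝟙_ M)).hom ▷ (P ⊗ Q)), ← cancel_mono (λ_ (P ⊗ Q)).hom,
    Category.assoc, Category.assoc, ← h]
  simp

/-- The two factors that `tensorμ` swaps are both the unit, and the braiding of the unit with itself
is the identity. -/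
theorem unit_tensorμ_middle (P X : M) :
    ((ρ_ P).inv ⊗ₘ (λ_ X).inv) ≫ tensorμ P (𝟙_ M) (𝟙_ M) X =
      ((ρ_ P).inv ⊗ₘ (λ_ X).inv) := by
  have h : (β_ (𝟙_ M) (𝟙_ M)).hom = 𝟙 _ := by
    simp [← MonoidalCategory.unitors_equal]
  simp only [tensorμ, h]
  monoidal

/-- With units on the outside, `tensorμ` reduces to the braiding of X and P, which cancels the
braiding in front. This cancellation is where the braiding has to be a symmetry. -/
theorem unit_tensorμ_outer (P X : M) :
    (β_ P X).hom ≫ ((λ_ X).inv ⊗ₘ (ρ_ P).inv) ≫ tensorμ (𝟙_ M) X P (𝟙_ M) =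
      ((λ_ P).inv ⊗ₘ (ρ_ X).inv) := by
  have h : ((λ_ X).inv ⊗ₘ (ρ_ P).inv) ≫ tensorμ (𝟙_ M) X P (𝟙_ M) =
      (β_ X P).hom ≫ ((λ_ P).inv ⊗ₘ (ρ_ X).inv) := by
    have e : ((λ_ X).inv ⊗ₘ (ρ_ P).inv) ≫ (α_ (𝟙_ M) X (P ⊗ 𝟙_ M)).hom ≫
        𝟙_ M ◁ (α_ X P (𝟙_ M)).inv = (λ_ (X ⊗ P)).inv ≫ 𝟙_ M ◁ (ρ_ (X ⊗ P)).inv := by monoidal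
    have e' : (λ_ (P ⊗ X)).inv ≫ 𝟙_ M ◁ (ρ_ (P ⊗ X)).inv ≫ 𝟙_ M ◁ (α_ P X (𝟙_ M)).hom ≫
        (α_ (𝟙_ M) P (X ⊗ 𝟙_ M)).inv = ((λ_ P).inv ⊗ₘ (ρ_ X).inv) := by monoidal
    rw [← e']
    simp only [tensorμ]
    -- What remains is to slide the braiding through the right and then the left unitor.
    rw [reassoc_of% e]
    simp only [← MonoidalCategory.whiskerLeft_comp_assoc]
    rw [← MonoidalCategory.rightUnitor_inv_naturality_assoc]
    simp only [MonoidalCategory.whiskerLeft_comp, Category.assoc]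
    rw [← MonoidalCategory.leftUnitor_inv_naturality_assoc]
  rw [h, SymmetricCategory.symmetry_assoc]

end Coherence

/-! ### The sections of the pointwise tensor product -/

section TensorSections

open MonoidalCategory

variable {M : Type u₁} [Category.{u} M] [MonoidalCategory M] [SymmetricCategory M]

/-- The second tensor factor contains only units: e₁ and e₂ multiply to e₃, and `unit_tensorμ_right`
separates them from P and Q. This is the multiplicativity of `inl`; `inr_mul_aux` is its mirror
image. -/
theorem inl_mul_aux {P Q R U V W : M} {m : P ⊗ Q ⟶ R} {e₁ : 𝟙_ M ⟶ U} {e₂ : 𝟙_ M ⟶ V}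
    {e₃ : 𝟙_ M ⟶ W} {n : U ⊗ V ⟶ W} (h : (e₁ ⊗ₘ e₂) ≫ n = (λ_ (𝟙_ M)).hom ≫ e₃) :
    m ≫ (ρ_ R).inv ≫ R ◁ e₃ = (((ρ_ P).inv ≫ P ◁ e₁) ⊗ₘ ((ρ_ Q).inv ≫ Q ◁ e₂)) ≫
      tensorμ P U Q V ≫ (m ⊗ₘ n) := by
  have h₁ := tensorμ_natural (𝟙 P) e₁ (𝟙 Q) e₂
  rw [MonoidalCategory.id_tensorHom_id, MonoidalCategory.id_tensorHom,
    MonoidalCategory.id_tensorHom, MonoidalCategory.id_tensorHom] at h₁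
  have h₂ : (P ⊗ Q) ◁ (e₁ ⊗ₘ e₂) ≫ (m ⊗ₘ n) =
      (P ⊗ Q) ◁ (λ_ (𝟙_ M)).hom ≫ (m ⊗ₘ e₃) := by
    rw [← MonoidalCategory.id_tensorHom, ← MonoidalCategory.id_tensorHom,
      MonoidalCategory.tensorHom_comp_tensorHom, MonoidalCategory.tensorHom_comp_tensorHom, h]
  rw [← MonoidalCategory.tensorHom_comp_tensorHom, Category.assoc, reassoc_of% h₁, h₂,
    reassoc_of% (unit_tensorμ_right P Q), ← MonoidalCategory.whiskerLeft_comp_assoc,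
    Iso.inv_hom_id, MonoidalCategory.whiskerLeft_id, Category.id_comp,
    MonoidalCategory.tensorHom_def, MonoidalCategory.rightUnitor_inv_naturality_assoc]

theorem inr_mul_aux {P Q R U V W : M} {m : P ⊗ Q ⟶ R} {e₁ : 𝟙_ M ⟶ U} {e₂ : 𝟙_ M ⟶ V}
    {e₃ : 𝟙_ M ⟶ W} {n : U ⊗ V ⟶ W} (h : (e₁ ⊗ₘ e₂) ≫ n = (λ_ (𝟙_ M)).hom ≫ e₃) :
    m ≫ (λ_ R).inv ≫ e₃ ▷ R = (((λ_ P).inv ≫ e₁ ▷ P) ⊗ₘ ((λ_ Q).inv ≫ e₂ ▷ Q)) ≫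
      tensorμ U P V Q ≫ (n ⊗ₘ m) := by
  have h₁ := tensorμ_natural e₁ (𝟙 P) e₂ (𝟙 Q)
  rw [MonoidalCategory.id_tensorHom_id, MonoidalCategory.tensorHom_id,
    MonoidalCategory.tensorHom_id, MonoidalCategory.tensorHom_id] at h₁
  have h₂ : (e₁ ⊗ₘ e₂) ▷ (P ⊗ Q) ≫ (n ⊗ₘ m) =
      (λ_ (𝟙_ M)).hom ▷ (P ⊗ Q) ≫ (e₃ ⊗ₘ m) := by
    rw [← MonoidalCategory.tensorHom_id, ← MonoidalCategory.tensorHom_id,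
      MonoidalCategory.tensorHom_comp_tensorHom, MonoidalCategory.tensorHom_comp_tensorHom, h]
  rw [← MonoidalCategory.tensorHom_comp_tensorHom, Category.assoc, reassoc_of% h₁, h₂,
    reassoc_of% (unit_tensorμ_left P Q), ← MonoidalCategory.comp_whiskerRight_assoc,
    Iso.inv_hom_id, MonoidalCategory.id_whiskerRight, Category.id_comp,
    MonoidalCategory.tensorHom_def', MonoidalCategory.leftUnitor_inv_naturality_assoc]

theorem inl_naturality_aux {P P' U : M} (p : P ⟶ P') (e : 𝟙_ M ⟶ U) :
    p ≫ (ρ_ P').inv ≫ P' ◁ e = ((ρ_ P).inv ≫ P ◁ e) ≫ (p ⊗ₘ 𝟙 U) := by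
  simp [MonoidalCategory.whisker_exchange]

theorem inr_naturality_aux {P P' U : M} (p : P ⟶ P') (e : 𝟙_ M ⟶ U) :
    p ≫ (λ_ P').inv ≫ e ▷ P' = ((λ_ P).inv ≫ e ▷ P) ≫ (𝟙 U ⊗ₘ p) := by
  simp [← MonoidalCategory.whisker_exchange]

theorem inl_one_aux {P U : M} (p : 𝟙_ M ⟶ P) (e : 𝟙_ M ⟶ U) :
    p ≫ (ρ_ P).inv ≫ P ◁ e = (λ_ (𝟙_ M)).inv ≫ (p ⊗ₘ e) := by
  rw [MonoidalCategory.tensorHom_def, MonoidalCategory.rightUnitor_inv_naturality_assoc,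
    MonoidalCategory.unitors_inv_equal]

theorem inr_one_aux {P U : M} (p : 𝟙_ M ⟶ P) (e : 𝟙_ M ⟶ U) :
    p ≫ (λ_ P).inv ≫ e ▷ P = (λ_ (𝟙_ M)).inv ≫ (e ⊗ₘ p) := by
  rw [MonoidalCategory.tensorHom_def', MonoidalCategory.leftUnitor_inv_naturality_assoc]

/-- By naturality the inserted units move past the interchange, which is then trivial because it
swaps two copies of I. In each tensor factor a unit law remains. -/
theorem inl_inr_mul_aux {P X U V : M} {e : 𝟙_ M ⟶ U} {e' : 𝟙_ M ⟶ V} {m : P ⊗ V ⟶ P}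
    {n : U ⊗ X ⟶ X} (h₁ : P ◁ e' ≫ m = (ρ_ P).hom) (h₂ : e ▷ X ≫ n = (λ_ X).hom) :
    (((ρ_ P).inv ≫ P ◁ e) ⊗ₘ ((λ_ X).inv ≫ e' ▷ X)) ≫ tensorμ P U V X ≫ (m ⊗ₘ n) = 𝟙 _ := by
  have h := tensorμ_natural (𝟙 P) e e' (𝟙 X)
  simp only [MonoidalCategory.id_tensorHom, MonoidalCategory.tensorHom_id] at h
  rw [← MonoidalCategory.tensorHom_comp_tensorHom, Category.assoc, reassoc_of% h,
    MonoidalCategory.tensorHom_comp_tensorHom, h₁, h₂,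
    reassoc_of% (unit_tensorμ_middle P X), MonoidalCategory.tensorHom_comp_tensorHom,
    Iso.inv_hom_id, Iso.inv_hom_id, MonoidalCategory.id_tensorHom_id]

theorem inr_inl_mul_aux {P X U V : M} {e : 𝟙_ M ⟶ U} {e' : 𝟙_ M ⟶ V} {m : V ⊗ P ⟶ P}
    {n : X ⊗ U ⟶ X} (h₁ : e' ▷ P ≫ m = (λ_ P).hom) (h₂ : X ◁ e ≫ n = (ρ_ X).hom) :
    (β_ P X).hom ≫ (((λ_ X).inv ≫ e' ▷ X) ⊗ₘ ((ρ_ P).inv ≫ P ◁ e)) ≫ tensorμ V X P U ≫ (m ⊗ₘ n) =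
      𝟙 _ := by
  have h := tensorμ_natural e' (𝟙 X) (𝟙 P) e
  simp only [MonoidalCategory.id_tensorHom, MonoidalCategory.tensorHom_id] at h
  rw [← MonoidalCategory.tensorHom_comp_tensorHom, Category.assoc, reassoc_of% h,
    MonoidalCategory.tensorHom_comp_tensorHom, h₁, h₂,
    reassoc_of% (unit_tensorμ_outer P X), MonoidalCategory.tensorHom_comp_tensorHom,
    Iso.inv_hom_id, Iso.inv_hom_id, MonoidalCategory.id_tensorHom_id]

variable {B C D : Type u} [Bicategory.{u, u} B] [Bicategory.{u, u} C] [Bicategory.{u, u} D]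
  [Bicategory.Strict B] [Bicategory.Strict C]

/-- The 2-functor `c ↦ (c, b)`. -/
@[reducible]
def TwoFunctor.inl (C : Type u) [Bicategory.{u, u} C] (b : B) : TwoFunctor C (C × B) where
  obj c := (c, b)
  map f := (f, 𝟙 b)
  map₂ θ := (θ, 𝟙 (𝟙 b))
  map₂_id f := rfl
  map₂_comp η θ := Prod.ext rfl (Category.comp_id _).symm
  map_id c := rfl
  map_comp f g := Prod.ext rfl (Bicategory.Strict.comp_id _).symm
  map₂_whisker_left f g g' η := by
    rw [prod_eqToHom, prod_eqToHom]
    refine Prod.ext ?_ ?_ <;> simp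
  map₂_whisker_right η g := by
    rw [prod_eqToHom, prod_eqToHom]
    refine Prod.ext ?_ ?_ <;> simp

/-- The 2-functor `b ↦ (c, b)`. -/
@[reducible]
def TwoFunctor.inr (B : Type u) [Bicategory.{u, u} B] (c : C) : TwoFunctor B (C × B) where
  obj b := (c, b)
  map f := (𝟙 c, f)
  map₂ θ := (𝟙 (𝟙 c), θ)
  map₂_id f := rfl
  map₂_comp η θ := Prod.ext (Category.comp_id _).symm rfl
  map_id c := rfl
  map_comp f g := Prod.ext (Bicategory.Strict.comp_id _).symm rfl
  map₂_whisker_left f g g' η := by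
    rw [prod_eqToHom, prod_eqToHom]
    refine Prod.ext ?_ ?_ <;> simp
  map₂_whisker_right η g := by
    rw [prod_eqToHom, prod_eqToHom]
    refine Prod.ext ?_ ?_ <;> simp

namespace LaxMor

variable (F : Lax C M) (E : Lax B M)

/-- The morphism `F ⟶ F ⊠ E` over `c ↦ (c, b)`. -/
def inl (b : B) : LaxMor F (F.tensor E) where
  base := TwoFunctor.inl C b
  app f := (ρ_ (F.val f)).inv ≫ F.val f ◁ E.one (𝟙 b) rfl
  naturality {c d f g} θ := by
    refine (inl_naturality_aux (F.val₂ θ) (E.one (𝟙 b) rfl)).trans ?_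
    rw [← E.val₂_id]
    rfl
  one_app c := by
    rw [Lax.tensor_one]
    exact inl_one_aux _ _
  mul_app {c d e} f g := by
    rw [Lax.tensor_mul]
    exact inl_mul_aux (E.one_mul_one _ _ _ _)

/-- The morphism `E ⟶ F ⊠ E` over `b ↦ (c, b)`. -/
def inr (c : C) : LaxMor E (F.tensor E) where
  base := TwoFunctor.inr B c
  app k := (λ_ (E.val k)).inv ≫ F.one (𝟙 c) rfl ▷ E.val k
  naturality {b d f g} θ := by
    refine (inr_naturality_aux (E.val₂ θ) (F.one (𝟙 c) rfl)).trans ?_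
    rw [← F.val₂_id]
    rfl
  one_app b := by
    rw [Lax.tensor_one]
    exact inr_one_aux _ _
  mul_app {b d e} f g := by
    rw [Lax.tensor_mul]
    exact inr_mul_aux (F.one_mul_one _ _ _ _)

variable {F E}

theorem inl_comp_inr {x y : C × B} (f : x ⟶ y) :
    CategoryStruct.comp (X := x) (Y := (y.1, x.2)) (Z := y) (f.1, 𝟙 x.2) (𝟙 y.1, f.2) = f :=
  Prod.ext (Bicategory.Strict.comp_id _) (Bicategory.Strict.id_comp _)

theorem inr_comp_inl {x y : C × B} (f : x ⟶ y) :
    CategoryStruct.comp (X := x) (Y := (x.1, y.2)) (Z := y) (𝟙 x.1, f.2) (f.1, 𝟙 y.2) = f :=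
  Prod.ext (Bicategory.Strict.id_comp _) (Bicategory.Strict.comp_id _)

/-- The unit laws of F and E recover F(f) ⊗ E(k) from the two inserted factors. A multiplicative map
out of F ⊠ E is therefore fixed by its values on the sections. -/
theorem inl_inr_mul {x y : C × B} (f : x ⟶ y) :
    ((inl F E x.2).app f.1 ⊗ₘ (inr F E y.1).app f.2) ≫
      (F.tensor E).mul (a := x) (b := (y.1, x.2)) (c := y) (f.1, 𝟙 x.2) (𝟙 y.1, f.2) f
        (inl_comp_inr f) = 𝟙 ((F.tensor E).val f) := by
  rw [Lax.tensor_mul]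
  exact inl_inr_mul_aux (F.mul_one' _ _) (E.one_mul' _ _)

/-- The same recovery for the opposite factorization (1, k)(f, 1). Together with `inl_inr_mul` it
gives the hexagon of the coevaluation. -/
theorem inr_inl_mul {x y : C × B} (f : x ⟶ y) :
    (β_ (F.val f.1) (E.val f.2)).hom ≫
      ((inr F E x.1).app f.2 ⊗ₘ (inl F E y.2).app f.1) ≫
      (F.tensor E).mul (a := x) (b := (x.1, y.2)) (c := y) (𝟙 x.1, f.2) (f.1, 𝟙 y.2) f
        (inr_comp_inl f) = 𝟙 ((F.tensor E).val f) := by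
  rw [Lax.tensor_mul]
  exact inr_inl_mul_aux (F.one_mul' _ _) (E.mul_one' _ _)

end LaxMor

end TensorSections

/-! ### Morphisms out of a tensor product are determined on sections -/

section TensorExt

open Bicategory

variable {B C D : Type u} [Bicategory.{u, u} B] [Bicategory.{u, u} C] [Bicategory.{u, u} D]
  [Bicategory.Strict B] [Bicategory.Strict C]

namespace TwoFunctor

/-- A 2-morphism (θ, κ) is the horizontal composite of (θ, 1) and (1, κ), written as two
whiskerings; the outer `eqToHom`s account for the factorizations of its source and target. -/
theorem prod_hom₂_eq {x y : C × B} {f g : x ⟶ y} (θ : f ⟶ g) :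
    θ = eqToHom (LaxMor.inl_comp_inr f).symm ≫
      (whiskerRight (a := x) (b := (y.1, x.2)) (c := y) (f := (f.1, 𝟙 x.2)) (g := (g.1, 𝟙 x.2))
          (θ.1, 𝟙 (𝟙 x.2)) (𝟙 y.1, f.2) ≫
        whiskerLeft (a := x) (b := (y.1, x.2)) (c := y) (g.1, 𝟙 x.2) (g := (𝟙 y.1, f.2))
          (h := (𝟙 y.1, g.2)) (𝟙 (𝟙 y.1), θ.2)) ≫
      eqToHom (LaxMor.inl_comp_inr g) := by
  rw [prod_eqToHom, prod_eqToHom]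
  refine Prod.ext ?_ ?_
  · simp [Strict.rightUnitor_eqToIso]
  · simp [Strict.leftUnitor_eqToIso]

theorem map_eq_inl_comp_inr (p : TwoFunctor (C × B) D) {x y : C × B} (f : x ⟶ y) :
    p.map f = ((inl C x.2).comp p).map f.1 ≫ ((inr B y.1).comp p).map f.2 :=
  (congrArg p.map (LaxMor.inl_comp_inr f)).symm.trans (p.map_comp _ _)

theorem map₂_eq_inl_comp_inr (p : TwoFunctor (C × B) D) {x y : C × B} {f g : x ⟶ y} (θ : f ⟶ g) :
    p.map₂ θ = eqToHom (map_eq_inl_comp_inr p f) ≫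
      (((inl C x.2).comp p).map₂ θ.1 ▷ ((inr B y.1).comp p).map f.2 ≫
        ((inl C x.2).comp p).map g.1 ◁ ((inr B y.1).comp p).map₂ θ.2) ≫
      eqToHom (map_eq_inl_comp_inr p g).symm := by
  conv_lhs => rw [prod_hom₂_eq θ]
  rw [p.map₂_comp, p.map₂_comp, p.map₂_comp, PrelaxFunctor.map₂_eqToHom,
    PrelaxFunctor.map₂_eqToHom, p.map₂_whisker_left, p.map₂_whisker_right]
  simp

end TwoFunctor

open TwoFunctor

variable {M : Type u₁} [Category.{u} M] [MonoidalCategory M] [SymmetricCategory M]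
variable {E : Lax B M} {F : Lax C M} {G : Lax D M}

namespace LaxMor

open MonoidalCategory in
-- Multiplicativity of γ is applied to (f, 1)(1, k) and precomposed with the two inserted factors;
-- by `inl_inr_mul` the left side collapses to the component of γ.
theorem app_eq_inl_inr (γ : LaxMor (F.tensor E) G) {x y : C × B} (f : x ⟶ y) :
    γ.app f = (((inl F E x.2).comp γ).app f.1 ⊗ₘ ((inr F E y.1).comp γ).app f.2) ≫
      G.mul (((inl F E x.2).comp γ).base.map f.1) (((inr F E y.1).comp γ).base.map f.2)
        (γ.base.map f) (map_eq_inl_comp_inr γ.base f).symm := by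
  have h := γ.mul_app' (a := x) (b := (y.1, x.2)) (c := y) (f.1, 𝟙 x.2) (𝟙 y.1, f.2) f
    (inl_comp_inr f)
  have h' := ((inl F E x.2).app f.1 ⊗ₘ (inr F E y.1).app f.2) ≫= h
  refine Eq.trans ?_ (h'.trans ?_)
  · refine Eq.trans (Category.id_comp _).symm (Eq.trans ?_ (Category.assoc _ _ _))
    exact congrArg (· ≫ γ.app f) (inl_inr_mul f).symm
  · exact MonoidalCategory.tensorHom_comp_tensorHom_assoc _ _ _ _ _

/-- Each value of γ, on 1-morphisms, on 2-morphisms and on the objects of M, is an explicit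
expression in the restrictions of γ, so equal restrictions force equal values. -/
theorem tensor_ext {γ γ' : LaxMor (F.tensor E) G}
    (hl : ∀ b, (inl F E b).comp γ = (inl F E b).comp γ')
    (hr : ∀ c, (inr F E c).comp γ = (inr F E c).comp γ') : γ = γ' := by
  have h₀ : ∀ x, γ.base.obj x = γ'.base.obj x := fun x => obj_congr (hl x.2) x.1
  have h₁ : ∀ {x y} (f : x ⟶ y), HEq (γ.base.map f) (γ'.base.map f) := fun {x y} f => by
    rw [map_eq_inl_comp_inr γ.base f, map_eq_inl_comp_inr γ'.base f]
    exact comp_heq (h₀ _) (h₀ _) (h₀ _) (map_heq (hl x.2) f.1) (map_heq (hr y.1) f.2)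
  refine hext h₀ h₁ ?_ ?_
  · intro x y f g θ
    rw [map₂_eq_inl_comp_inr γ.base θ, map₂_eq_inl_comp_inr γ'.base θ]
    refine (eqToHom_comp_comp_eqToHom_heq _ _ _).trans
      (HEq.trans ?_ (eqToHom_comp_comp_eqToHom_heq _ _ _).symm)
    have hf := map_heq (hr y.1) f.2
    have hg := map_heq (hl x.2) g.1
    have hg' := map_heq (hr y.1) g.2
    have hf' := map_heq (hl x.2) f.1
    refine comp₂_heq (h₀ _) (h₀ _) (comp_heq (h₀ _) (h₀ _) (h₀ _) hf' hf)
      (comp_heq (h₀ _) (h₀ _) (h₀ _) hg hf) (comp_heq (h₀ _) (h₀ _) (h₀ _) hg hg')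
      (whiskerRight_heq (h₀ _) (h₀ _) (h₀ _) hf' hg hf (map₂_heq (hl x.2) θ.1))
      (whiskerLeft_heq (h₀ _) (h₀ _) (h₀ _) hg hf hg' (map₂_heq (hr y.1) θ.2))
  · intro x y f
    rw [app_eq_inl_inr γ f, app_eq_inl_inr γ' f]
    exact G.tensorHom_comp_mul_heq _ _ (h₀ _) (h₀ _) (h₀ _) (map_heq (hl x.2) f.1)
      (map_heq (hr y.1) f.2) (app_heq (hl x.2) f.1) (app_heq (hr y.1) f.2)

end LaxMor

end TensorExt

/-! ### Naturality of the sections -/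

section TensorNaturality

open MonoidalCategory

variable {M : Type u₁} [Category.{u} M] [MonoidalCategory M] [SymmetricCategory M]

variable {B C B' C' : Type u} [Bicategory.{u, u} B] [Bicategory.{u, u} C] [Bicategory.{u, u} B']
  [Bicategory.{u, u} C'] [Bicategory.Strict B] [Bicategory.Strict C] [Bicategory.Strict B']
  [Bicategory.Strict C']
variable {E : Lax B M} {F : Lax C M} {E' : Lax B' M} {F' : Lax C' M}

theorem inl_tensor_aux {P Q U V W : M} {e : 𝟙_ M ⟶ U} {p : P ⟶ Q} {q : U ⟶ V} {v : V ⟶ W}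
    {e' : 𝟙_ M ⟶ W} (h : (e ≫ q) ≫ v = e') :
    (((ρ_ P).inv ≫ P ◁ e) ≫ (p ⊗ₘ q)) ≫ (𝟙 Q ⊗ₘ v) = p ≫ (ρ_ Q).inv ≫ Q ◁ e' := by
  rw [Category.assoc, Category.assoc, MonoidalCategory.tensorHom_comp_tensorHom,
    ← MonoidalCategory.id_tensorHom, MonoidalCategory.tensorHom_comp_tensorHom,
    Category.id_comp, Category.comp_id, ← Category.assoc, h, MonoidalCategory.tensorHom_def,
    MonoidalCategory.rightUnitor_inv_naturality_assoc]

theorem inr_tensor_aux {P Q U V W : M} {e : 𝟙_ M ⟶ U} {p : P ⟶ Q} {q : U ⟶ V} {v : V ⟶ W}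
    {e' : 𝟙_ M ⟶ W} (h : (e ≫ q) ≫ v = e') :
    (((λ_ P).inv ≫ e ▷ P) ≫ (q ⊗ₘ p)) ≫ (v ⊗ₘ 𝟙 Q) = p ≫ (λ_ Q).inv ≫ e' ▷ Q := by
  rw [Category.assoc, Category.assoc, MonoidalCategory.tensorHom_comp_tensorHom,
    ← MonoidalCategory.tensorHom_id, MonoidalCategory.tensorHom_comp_tensorHom,
    Category.id_comp, Category.comp_id, ← Category.assoc, h, MonoidalCategory.tensorHom_def',
    MonoidalCategory.leftUnitor_inv_naturality_assoc]

namespace LaxMor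

theorem tensorHom_val₂_heq (F : Lax C M) (E : Lax B M) {c d : C} {a b : B} {f f' : c ⟶ d}
    {k k' : a ⟶ b} (hf : f = f') (hk : k = k') {X : M} {s : X ⟶ F.val f ⊗ E.val k}
    {s' : X ⟶ F.val f' ⊗ E.val k'}
    (h : s ≫ (F.val₂ (eqToHom hf) ⊗ₘ E.val₂ (eqToHom hk)) = s') : HEq s s' := by
  subst hf hk
  rw [eqToHom_refl, eqToHom_refl, Lax.val₂_id, Lax.val₂_id, MonoidalCategory.id_tensorHom_id,
    Category.comp_id] at h
  exact heq_of_eq h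

theorem prodMk_heq {x y : C × B} {f f' g g' : x.1 ⟶ y.1} {k k' l l' : x.2 ⟶ y.2} (hf : f = f')
    (hg : g = g') (hk : k = k') (hl : l = l') {η : f ⟶ g} {η' : f' ⟶ g'} {θ : k ⟶ l}
    {θ' : k' ⟶ l'} (h : HEq η η') (h' : HEq θ θ') :
    HEq ((η, θ) : Quiver.Hom (V := x ⟶ y) (f, k) (g, l))
      ((η', θ') : Quiver.Hom (V := x ⟶ y) (f', k') (g', l')) := by
  subst hf hg hk hl h h'
  rfl

theorem id_heq {c d : C} {f g : c ⟶ d} {η : f ⟶ f} (h : η = 𝟙 f) (hf : f = g) :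
    HEq η (𝟙 g) := by
  subst hf h
  rfl

/-- The two sides differ by ε(1_b) against 1_{ε(b)}. These are equal but not definitionally, so
1-morphisms, 2-morphisms and components are compared heterogeneously; for the components the unit
axiom of ε is what is needed. -/
theorem inl_comp_tensor (φ : LaxMor F F') (ε : LaxMor E E') (b : B) :
    (inl F E b).comp (φ.tensor ε) = φ.comp (inl F' E' (ε.base.obj b)) := by
  refine hext (fun _ => rfl) (fun f => heq_of_eq (Prod.ext rfl (ε.base.map_id b))) ?_ ?_
  · intro c d f g θ
    exact prodMk_heq (x := (φ.base.obj c, ε.base.obj b)) (y := (φ.base.obj d, ε.base.obj b))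
      rfl rfl (ε.base.map_id b) (ε.base.map_id b) HEq.rfl
      (id_heq (f := ε.base.map (𝟙 b)) (ε.base.map₂_id _) (ε.base.map_id b))
  · intro c d f
    refine tensorHom_val₂_heq F' E' rfl (ε.base.map_id b) ?_
    rw [eqToHom_refl, Lax.val₂_id]
    exact inl_tensor_aux (comp_comp_aux (ε.one_app' _ rfl) (E'.one_val₂ _ rfl))

theorem inr_comp_tensor (φ : LaxMor F F') (ε : LaxMor E E') (c : C) :
    (inr F E c).comp (φ.tensor ε) = ε.comp (inr F' E' (φ.base.obj c)) := by
  refine hext (fun _ => rfl) (fun f => heq_of_eq (Prod.ext (φ.base.map_id c) rfl)) ?_ ?_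
  · intro a b f g θ
    exact prodMk_heq (x := (φ.base.obj c, ε.base.obj a)) (y := (φ.base.obj c, ε.base.obj b))
      (φ.base.map_id c) (φ.base.map_id c) rfl rfl
      (id_heq (f := φ.base.map (𝟙 c)) (φ.base.map₂_id _) (φ.base.map_id c)) HEq.rfl
  · intro a b f
    refine tensorHom_val₂_heq F' E' (φ.base.map_id c) rfl ?_
    rw [eqToHom_refl, Lax.val₂_id]
    exact inr_tensor_aux (comp_comp_aux (φ.one_app' _ rfl) (F'.one_val₂ _ rfl))

end LaxMor

end TensorNaturality

/-! ### Whiskering with identities -/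

section UnitWhiskers

open Bicategory

variable {D : Type u} [Bicategory.{u, u} D] [Bicategory.Strict D]

/-- The 1-morphism i is kept general because in the application it is σ(1_c), which is an identity
only up to a proof. -/
theorem unit_whisker_heq {x y : D} {i : x ⟶ x} {g h : x ⟶ y} {η : i ⟶ i} (hi : i = 𝟙 x)
    (hη : η = 𝟙 i) (θ : g ⟶ h) : HEq (η ▷ g ≫ i ◁ θ) θ := by
  subst hi hη
  refine heq_of_comp_eqToHom (Strict.id_comp _) (Strict.id_comp _) ?_
  simp [Strict.leftUnitor_eqToIso]

theorem whisker_unit_heq {x y : D} {i : y ⟶ y} {g h : x ⟶ y} {η : i ⟶ i} (hi : i = 𝟙 y)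
    (hη : η = 𝟙 i) (θ : g ⟶ h) : HEq (θ ▷ i ≫ h ◁ η) θ := by
  subst hi hη
  refine heq_of_comp_eqToHom (Strict.comp_id _) (Strict.comp_id _) ?_
  simp [Strict.rightUnitor_eqToIso]

theorem unit_whiskerLeft_comp_eqToHom {x y : D} {g h : x ⟶ y} (θ : g ⟶ h)
    (p : 𝟙 x ≫ h = h ≫ 𝟙 y) (q : 𝟙 x ≫ g = g ≫ 𝟙 y) :
    𝟙 x ◁ θ ≫ eqToHom p = eqToHom q ≫ θ ▷ 𝟙 y := by
  simp [Strict.leftUnitor_eqToIso, Strict.rightUnitor_eqToIso]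

theorem whiskerLeft_id_comp_eqToHom {x y : D} (f : x ⟶ y)
    (p q : f ≫ 𝟙 y = 𝟙 x ≫ f) :
    f ◁ 𝟙 (𝟙 y) ≫ eqToHom p = eqToHom q ≫ 𝟙 (𝟙 x) ▷ f := by
  simp

end UnitWhiskers

/-! ### Evaluation at an object and coevaluation -/

noncomputable section HomSections

open MonoidalCategory Limits

variable {M : Type u₁} [Category.{u} M] [MonoidalCategory M] [SymmetricCategory M]
  [MonoidalClosed M] [HasLimits M]

variable {B C D C' D' : Type u} [Bicategory.{u, u} B] [Bicategory.{u, u} C] [Bicategory.{u, u} D]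
  [Bicategory.{u, u} C'] [Bicategory.{u, u} D'] [Bicategory.Strict B] [Bicategory.Strict C]
  [Bicategory.Strict D] [Bicategory.Strict C'] [Bicategory.Strict D']
variable {E : Lax B M} {F : Lax C M} {G : Lax D M} {F' : Lax C' M} {G' : Lax D' M}

namespace HOM

theorem hom_heq {σ τ σ' τ' : Classifying F G} (hσ : σ = σ') (hτ : τ = τ') {α : σ ⟶ τ}
    {α' : σ' ⟶ τ'} (h : ∀ c, HEq (StrictTrans.app α.hom c) (StrictTrans.app α'.hom c)) :
    HEq α α' := by
  subst hσ hτ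
  exact heq_of_eq (Bicategory.InducedBicategory.hom_ext
    (StrictTrans.ext fun c => eq_of_heq (h c)))

theorem hom₂_heq {σ τ σ' τ' : Classifying F G} (hσ : σ = σ') (hτ : τ = τ') {α β : σ ⟶ τ}
    {α' β' : σ' ⟶ τ'} (hα : HEq α α') (hβ : HEq β β') {Γ : α ⟶ β} {Γ' : α' ⟶ β'}
    (h : ∀ c, HEq (Modif.app Γ.hom c) (Modif.app Γ'.hom c)) : HEq Γ Γ' := by
  subst hσ hτ hα hβ
  exact heq_of_eq (Bicategory.InducedBicategory.hom₂_ext (Modif.ext fun c => eq_of_heq (h c)))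

theorem heq_of_comp_π {σ τ σ' τ' : Classifying F G} (hσ : σ = σ') (hτ : τ = τ') {α : σ ⟶ τ}
    {α' : σ' ⟶ τ'} (hα : HEq α α') {X : M} {s : X ⟶ (HOM F G).val α} {s' : X ⟶ (HOM F G).val α'}
    (h : ∀ c, HEq (s ≫ π α c) (s' ≫ π α' c)) : HEq s s' := by
  subst hσ hτ hα
  exact heq_of_eq (hom_ext fun c => eq_of_heq (h c))

variable (F G) in
/-- The evaluation at an object `c`, a morphism `HOM(F, G) ⟶ G`. -/
def evAt (c : C) : LaxMor (HOM F G) G where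
  base :=
    { obj σ := (LaxMor.base (F := F) (G := G) σ).obj c
      map α := StrictTrans.app α.hom c
      map₂ Γ := Modif.app Γ.hom c
      map₂_whisker_left f g g' η := by
        -- Composites of transformations are componentwise by definition, so both `eqToHom`s are
        -- identities.
        rw [eqToHom_refl, eqToHom_refl, Category.id_comp, Category.comp_id]
        rfl
      map₂_whisker_right η g := by
        rw [eqToHom_refl, eqToHom_refl, Category.id_comp, Category.comp_id]
        rfl }
  app α := π α c
  naturality Γ := hom_val₂_π Γ c
  one_app σ := hom_one_π (𝟙 σ) rfl c
  mul_app α β := hom_mul_π α β _ rfl c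

/-- Evaluation at every c detects transformations, modifications and morphisms into ∫ G(α). It does
not see the values p(f) and σ_f of an object (p, σ), hence the separate hypothesis on objects. -/
theorem lax_ext {δ δ' : LaxMor E (HOM F G)} (h : ∀ b, δ.base.obj b = δ'.base.obj b)
    (h' : ∀ c, δ.comp (evAt F G c) = δ'.comp (evAt F G c)) : δ = δ' := by
  have h₁ : ∀ {a b : B} (k : a ⟶ b), HEq (δ.base.map k) (δ'.base.map k) := fun {a b} k =>
    hom_heq (h a) (h b) fun c => LaxMor.map_heq (h' c) k
  refine LaxMor.hext h h₁ ?_ ?_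
  · intro a b k l κ
    exact hom₂_heq (h a) (h b) (h₁ k) (h₁ l) fun c => LaxMor.map₂_heq (h' c) κ
  · intro a b k
    exact heq_of_comp_π (h a) (h b) (h₁ k) fun c => LaxMor.app_heq (h' c) k

theorem map_comp_evAt (φ : LaxMor F' F) (ψ : LaxMor G G') (c : C') :
    (map φ ψ).comp (evAt F' G' c) = (evAt F G (φ.base.obj c)).comp ψ :=
  LaxMor.ext_app rfl fun α => heq_of_eq (mapApp_π φ ψ α c)

theorem inr_comp_ev_aux {H U P A K L : M} {e : 𝟙_ M ⟶ U} {p : U ⟶ P} {q : H ⟶ A} {m : P ⊗ A ⟶ K}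
    {v : K ⟶ L} {e' : 𝟙_ M ⟶ P} {n : P ⊗ A ⟶ L} {r : A ⟶ L} (h₁ : e ≫ p = e') (h₂ : m ≫ v = n)
    (h₃ : e' ▷ A ≫ n = (λ_ A).hom ≫ r) :
    (((λ_ H).inv ≫ e ▷ H) ≫ (p ⊗ₘ q) ≫ m) ≫ v = q ≫ r := by
  rw [Category.assoc, Category.assoc, Category.assoc, h₂, whiskerRight_tensorHom_assoc, h₁,
    MonoidalCategory.tensorHom_def', Category.assoc, h₃,
    MonoidalCategory.leftUnitor_naturality_assoc, Iso.inv_hom_id_assoc]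

theorem inl_comp_ev_aux {H U P A K L : M} {e : 𝟙_ M ⟶ U} {p : U ⟶ P} {q : H ⟶ A} {m : A ⊗ P ⟶ K}
    {v : K ⟶ L} {e' : 𝟙_ M ⟶ P} {n : A ⊗ P ⟶ L} {r : A ⟶ L} (h₁ : e ≫ p = e') (h₂ : m ≫ v = n)
    (h₃ : A ◁ e' ≫ n = (ρ_ A).hom ≫ r) :
    (((ρ_ H).inv ≫ H ◁ e) ≫ (q ⊗ₘ p) ≫ m) ≫ v = q ≫ r := by
  rw [Category.assoc, Category.assoc, Category.assoc, h₂, whiskerLeft_tensorHom_assoc, h₁,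
    MonoidalCategory.tensorHom_def, Category.assoc, h₃,
    MonoidalCategory.rightUnitor_naturality_assoc, Iso.inv_hom_id_assoc]

/-- Evaluating at 1_c turns σ(1_c) ≫ α_c into α_c. On components, σ carries the unit of F to the
unit of G, which the left unit law then removes. -/
theorem inr_comp_ev (c : C) : (LaxMor.inr F (HOM F G) c).comp (ev F G) = evAt F G c := by
  have h : ∀ σ : LaxMor F G, σ.base.map (𝟙 c) = 𝟙 (σ.base.obj c) := fun σ => σ.base.map_id c
  refine LaxMor.hext (fun _ => rfl) (fun {σ τ} α => heq_of_eq ?_) ?_ ?_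
  · exact (congrArg (· ≫ StrictTrans.app α.hom c) (h σ)).trans (Bicategory.Strict.id_comp _)
  · intro σ τ α β Γ
    exact unit_whisker_heq (h σ) (PrelaxFunctor.map₂_id _ _) (Modif.app Γ.hom c)
  · intro σ τ α
    refine Lax.heq_of_comp_val₂ G ((congrArg (· ≫ StrictTrans.app α.hom c) (h σ)).trans
      (Bicategory.Strict.id_comp _)) ?_
    refine (inr_comp_ev_aux (LaxMor.one_app' (F := F) (G := G) σ (𝟙 c) rfl) (G.mul_val₂ _ _)
      ((G.one_mul' (h σ) ?_).trans (Category.comp_id _).symm)).trans (Category.comp_id _)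
    exact (congrArg (· ≫ StrictTrans.app α.hom c) (h σ)).trans (Bicategory.Strict.id_comp _)

/-- Here the second variable is the identity transformation of σ, and the unit of HOM(F, G) projects
to the unit of G. The right unit law leaves σ itself. -/
theorem inl_comp_ev (σ : LaxMor F G) :
    (LaxMor.inl F (HOM F G) (show Classifying F G from σ)).comp (ev F G) = σ := by
  refine LaxMor.hext (fun _ => rfl) (fun f => heq_of_eq (Bicategory.Strict.comp_id _)) ?_ ?_
  · intro c d f g θ
    exact whisker_unit_heq (i := 𝟙 (σ.base.obj d)) rfl rfl (σ.base.map₂ θ)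
  · intro c d f
    refine Lax.heq_of_comp_val₂ G (Bicategory.Strict.comp_id _) ?_
    exact (inl_comp_ev_aux (hom_one_π (F := F) (G := G) (σ := σ) _ rfl d) (G.mul_val₂ _ _)
      ((G.mul_one' rfl (Bicategory.Strict.comp_id _)).trans
        (Category.comp_id _).symm)).trans (Category.comp_id _)

variable (C) in
/-- The transformation between two sections `c ↦ (c, b)` given by a 1-morphism. -/
def inlTrans {a b : B} (k : a ⟶ b) : StrictTrans (TwoFunctor.inl C a) (TwoFunctor.inl C b) where
  app c := (𝟙 c, k)
  naturality {c d} f := (LaxMor.inl_comp_inr (x := (c, a)) (y := (d, b)) (f, k)).trans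
    (LaxMor.inr_comp_inl (x := (c, a)) (y := (d, b)) (f, k)).symm
  naturality₂ {c d f g} θ := by
    rw [TwoFunctor.prod_eqToHom, TwoFunctor.prod_eqToHom]
    refine Prod.ext ?_ ?_
    · simp [Bicategory.Strict.leftUnitor_eqToIso, Bicategory.Strict.rightUnitor_eqToIso]
    · simp [Bicategory.Strict.leftUnitor_eqToIso, Bicategory.Strict.rightUnitor_eqToIso]

variable (C) in
/-- The modification between two such transformations given by a 2-morphism. -/
def inlModif {a b : B} {k l : a ⟶ b} (κ : k ⟶ l) : Modif (inlTrans C k) (inlTrans C l) where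
  app c := (𝟙 (𝟙 c), κ)
  naturality {c d} f := by
    rw [TwoFunctor.prod_eqToHom, TwoFunctor.prod_eqToHom]
    refine Prod.ext ?_ ?_
    · exact whiskerLeft_id_comp_eqToHom f
        ((Bicategory.Strict.comp_id f).trans (Bicategory.Strict.id_comp f).symm)
        ((Bicategory.Strict.comp_id f).trans (Bicategory.Strict.id_comp f).symm)
    · exact unit_whiskerLeft_comp_eqToHom κ
        ((Bicategory.Strict.id_comp l).trans (Bicategory.Strict.comp_id l).symm)
        ((Bicategory.Strict.id_comp k).trans (Bicategory.Strict.comp_id k).symm)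

/-- Both composites of the hexagon are the identity of F(f) ⊗ E(k). This is why E(k) maps into the
equalizer ∫ (F ⊠ E)(1, k). -/
theorem compat_inr {a b : B} (k : a ⟶ b) :
    Compat (LaxMor.inl F E a) (LaxMor.inl F E b) (inlTrans C k)
      fun c => (LaxMor.inr F E c).app k :=
  Compat.of_eq fun c d f => ⟨(f, k), LaxMor.inl_comp_inr (x := (c, a)) (y := (d, b)) (f, k),
    LaxMor.inr_comp_inl (x := (c, a)) (y := (d, b)) (f, k),
    (LaxMor.inl_inr_mul (x := (c, a)) (y := (d, b)) (f, k)).trans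
      (LaxMor.inr_inl_mul (x := (c, a)) (y := (d, b)) (f, k)).symm⟩

/-- The map `E(k) ⟶ ∫ (F ⊠ E)(𝟙, k)`. -/
def coevApp {a b : B} (k : a ⟶ b) : E.val k ⟶ integral (F := F) (G := F.tensor E)
    (LaxMor.inl F E a) (LaxMor.inl F E b) (inlTrans C k) :=
  integral.lift (F := F) (G := F.tensor E) (σ := LaxMor.inl F E a) (τ := LaxMor.inl F E b)
    (inlTrans C k) (fun c => (LaxMor.inr F E c).app k) (compat_inr k)

theorem coevApp_π {a b : B} (k : a ⟶ b) (c : C) :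
    coevApp k ≫ integral.π (F := F) (G := F.tensor E) (σ := LaxMor.inl F E a)
      (τ := LaxMor.inl F E b) (inlTrans C k) c = (LaxMor.inr F E c).app k :=
  integral.lift_π (F := F) (G := F.tensor E) (σ := LaxMor.inl F E a) (τ := LaxMor.inl F E b)
    (inlTrans C k) (fun c => (LaxMor.inr F E c).app k) (compat_inr k) c

theorem coev_naturality_aux {X X' I I' A A' : M} {v : X ⟶ X'} {l : X ⟶ I} {l' : X' ⟶ I'}
    {w : I ⟶ I'} {p : I ⟶ A} {p' : I' ⟶ A'} {a : A ⟶ A'} {r : X ⟶ A} {r' : X' ⟶ A'}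
    (h : l ≫ p = r) (h' : l' ≫ p' = r') (hw : w ≫ p' = p ≫ a) (hr : v ≫ r' = r ≫ a) :
    (v ≫ l') ≫ p' = (l ≫ w) ≫ p' := by
  rw [Category.assoc, Category.assoc, h', hw, reassoc_of% h, hr]

theorem coev_mul_aux {X Y Z I J K A B L : M} {m : X ⊗ Y ⟶ Z} {l : X ⟶ I} {l' : Y ⟶ J} {l'' : Z ⟶ K}
    {n : I ⊗ J ⟶ K} {p : I ⟶ A} {p' : J ⟶ B} {p'' : K ⟶ L} {q : A ⊗ B ⟶ L} {r : X ⟶ A} {r' : Y ⟶ B}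
    {r'' : Z ⟶ L} (h : l ≫ p = r) (h' : l' ≫ p' = r') (h'' : l'' ≫ p'' = r'')
    (hn : n ≫ p'' = (p ⊗ₘ p') ≫ q) (hr : m ≫ r'' = (r ⊗ₘ r') ≫ q) :
    (m ≫ l'') ≫ p'' = ((l ⊗ₘ l') ≫ n) ≫ p'' := by
  rw [Category.assoc, Category.assoc, h'', hn, MonoidalCategory.tensorHom_comp_tensorHom_assoc,
    h, h', hr]

variable (F E) in
/-- The coevaluation `E ⟶ HOM(F, F ⊠ E)`. -/
def coev : LaxMor E (HOM F (F.tensor E)) where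
  base :=
    { obj b := LaxMor.inl F E b
      map {a b} k := Bicategory.InducedBicategory.mkHom
        (X := show Classifying F (F.tensor E) from LaxMor.inl F E a)
        (Y := show Classifying F (F.tensor E) from LaxMor.inl F E b) (inlTrans C k)
      map₂ {a b k l} κ := Bicategory.InducedBicategory.Hom₂.mk (inlModif C κ)
      map₂_id k := rfl
      -- At an object c the components are the values of the 2-functor `TwoFunctor.inr B c`, so each
      -- law is the law of that 2-functor.
      map₂_comp κ κ' := Bicategory.InducedBicategory.hom₂_ext (Modif.ext fun c =>
        ((TwoFunctor.inr B c).map₂_comp κ κ'))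
      map_id b := rfl
      map_comp k l := Bicategory.InducedBicategory.hom_ext (StrictTrans.ext fun c =>
        ((TwoFunctor.inr B c).map_comp k l))
      map₂_whisker_left k l l' κ := Bicategory.InducedBicategory.hom₂_ext (Modif.ext fun c => by
        refine Eq.trans ?_ (eqToHom_comp_app (F := F) (G := F.tensor E) _ _ _ c).symm
        exact (TwoFunctor.inr B c).map₂_whisker_left k κ)
      map₂_whisker_right κ l := Bicategory.InducedBicategory.hom₂_ext (Modif.ext fun c => by
        refine Eq.trans ?_ (eqToHom_comp_app (F := F) (G := F.tensor E) _ _ _ c).symm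
        exact (TwoFunctor.inr B c).map₂_whisker_right κ l) }
  app {a b} k := coevApp k
  -- After projection to c the three axioms become those of `LaxMor.inr F E c`.
  naturality {a b k l} κ := hom_ext fun c =>
    coev_naturality_aux (coevApp_π k c) (coevApp_π l c) (hom_val₂_π _ c)
      ((LaxMor.inr F E c).naturality κ)
  one_app a := hom_ext fun c =>
    comp_comp_aux rfl (((Category.assoc _ _ _).trans (congrArg _ (coevApp_π _ c))).trans
      (((LaxMor.inr F E c).one_app a).trans
        (hom_one_π (F := F) (G := F.tensor E) (σ := LaxMor.inl F E a) _ rfl c).symm))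
  mul_app {a b d} k l := hom_ext fun c =>
    coev_mul_aux (coevApp_π k c) (coevApp_π l c) (coevApp_π (k ≫ l) c) (hom_mul_π _ _ _ _ c)
      ((LaxMor.inr F E c).mul_app k l)

theorem coev_comp_evAt (c : C) :
    (coev E F).comp (evAt F (F.tensor E) c) = LaxMor.inr F E c :=
  LaxMor.ext_app rfl fun k => heq_of_eq (coevApp_π (E := E) (F := F) k c)

end HOM

end HomSections

/-! ### Currying of morphisms -/

noncomputable section Currying

open MonoidalCategory Limits

variable {M : Type u₁} [Category.{u} M] [MonoidalCategory M] [SymmetricCategory M]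
  [MonoidalClosed M] [HasLimits M]

variable {B C D B' C' D' : Type u} [Bicategory.{u, u} B] [Bicategory.{u, u} C]
  [Bicategory.{u, u} D] [Bicategory.{u, u} B'] [Bicategory.{u, u} C'] [Bicategory.{u, u} D']
  [Bicategory.Strict B] [Bicategory.Strict C] [Bicategory.Strict D] [Bicategory.Strict B']
  [Bicategory.Strict C'] [Bicategory.Strict D']
variable {E : Lax B M} {F : Lax C M} {G : Lax D M} {E' : Lax B' M} {F' : Lax C' M} {G' : Lax D' M}

namespace HOM

/-- The composite `F ⊠ E ⟶ F ⊠ HOM(F, G) ⟶ G`. -/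
def uncurry (δ : LaxMor E (HOM F G)) : LaxMor (F.tensor E) G :=
  ((LaxMor.id F).tensor δ).comp (ev F G)

/-- The composite `E ⟶ HOM(F, F ⊠ E) ⟶ HOM(F, G)`. -/
def curry (γ : LaxMor (F.tensor E) G) : LaxMor E (HOM F G) :=
  (coev E F).comp (map (LaxMor.id F) γ)

/-- By naturality of the sections, restriction at b evaluates ev at the fixed object δ(b), where
`inl_comp_ev` applies. -/
theorem inl_comp_uncurry (δ : LaxMor E (HOM F G)) (b : B) :
    (LaxMor.inl F E b).comp (uncurry δ) = δ.base.obj b := by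
  rw [uncurry, ← LaxMor.comp_assoc, LaxMor.inl_comp_tensor, LaxMor.id_comp]
  exact inl_comp_ev _

theorem inr_comp_uncurry (δ : LaxMor E (HOM F G)) (c : C) :
    (LaxMor.inr F E c).comp (uncurry δ) = δ.comp (evAt F G c) := by
  rw [uncurry, ← LaxMor.comp_assoc, LaxMor.inr_comp_tensor, LaxMor.comp_assoc, inr_comp_ev]
  rfl

theorem curry_obj (γ : LaxMor (F.tensor E) G) (b : B) :
    (curry γ).base.obj b = (LaxMor.inl F E b).comp γ :=
  LaxMor.id_comp _

/-- Evaluation at c commutes with postcomposition by γ, and the coevaluation followed by evaluation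
is `inr`. -/
theorem curry_comp_evAt (γ : LaxMor (F.tensor E) G) (c : C) :
    (curry γ).comp (evAt F G c) = (LaxMor.inr F E c).comp γ := by
  rw [curry, LaxMor.comp_assoc, map_comp_evAt, ← LaxMor.comp_assoc]
  exact congrArg (fun σ => LaxMor.comp σ γ) (coev_comp_evAt (E := E) (F := F) c)

/-- Both sides have the same restrictions to the sections. In `curry_uncurry` the same four
identities are used, with `lax_ext` in place of `tensor_ext`. -/
theorem uncurry_curry (γ : LaxMor (F.tensor E) G) : uncurry (curry γ) = γ :=
  LaxMor.tensor_ext (fun b => (inl_comp_uncurry _ b).trans (curry_obj γ b))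
    (fun c => (inr_comp_uncurry _ c).trans (curry_comp_evAt γ c))

theorem curry_uncurry (δ : LaxMor E (HOM F G)) : curry (uncurry δ) = δ :=
  lax_ext (fun b => (curry_obj _ b).trans (inl_comp_uncurry δ b))
    (fun c => (curry_comp_evAt _ c).trans (inr_comp_uncurry δ c))

/-- Along `inl` at b both sides restrict to δ(ε(b)) composed with φ and ψ; along `inr` at c both
restrict to ε, then δ, then evaluation at φ(c), then ψ. -/
theorem uncurry_naturality (ε : LaxMor E' E) (φ : LaxMor F' F) (ψ : LaxMor G G')
    (δ : LaxMor E (HOM F G)) :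
    (φ.tensor ε).comp ((uncurry δ).comp ψ) = uncurry (ε.comp (δ.comp (map φ ψ))) := by
  refine LaxMor.tensor_ext (fun b => ?_) (fun c => ?_)
  · rw [inl_comp_uncurry, ← LaxMor.comp_assoc, LaxMor.inl_comp_tensor, LaxMor.comp_assoc,
      ← LaxMor.comp_assoc _ _ ψ, inl_comp_uncurry]
    rfl
  · rw [inr_comp_uncurry, ← LaxMor.comp_assoc, LaxMor.inr_comp_tensor, LaxMor.comp_assoc,
      ← LaxMor.comp_assoc _ _ ψ, inr_comp_uncurry, LaxMor.comp_assoc, LaxMor.comp_assoc,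
      LaxMor.comp_assoc, map_comp_evAt]

end HOM

end Currying

/-! ### Transformations assembled from sections -/

section SectionwiseTransformations

open Bicategory

variable {A B C D : Type u} [Bicategory.{u, u} A] [Bicategory.{u, u} B] [Bicategory.{u, u} C]
  [Bicategory.{u, u} D]

theorem comp_eqToHom_of_heq {x y : D} {f g f' g' : x ⟶ y} {η : f ⟶ g} {η' : f' ⟶ g'}
    (h : HEq η η') (hf : f = f') (hg : g = g') : η ≫ eqToHom hg = eqToHom hf ≫ η' := by
  subst hf hg h
  simp

section

variable [Strict D]

theorem whiskerRight_comp_heq {w x y z : D} {f f' : w ⟶ x} (η : f ⟶ f') (g : x ⟶ y) (h : y ⟶ z) :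
    HEq (η ▷ (g ≫ h)) (η ▷ g ▷ h) := by
  rw [whiskerRight_comp, Strict.associator_eqToIso, Strict.associator_eqToIso]
  exact eqToHom_comp_comp_eqToHom_heq _ (Strict.assoc _ _ _).symm (Strict.assoc _ _ _)

theorem comp_whiskerLeft_heq {w x y z : D} (f : w ⟶ x) (g : x ⟶ y) {h h' : y ⟶ z} (η : h ⟶ h') :
    HEq ((f ≫ g) ◁ η) (f ◁ g ◁ η) := by
  rw [comp_whiskerLeft, Strict.associator_eqToIso, Strict.associator_eqToIso]
  exact eqToHom_comp_comp_eqToHom_heq _ (Strict.assoc _ _ _) (Strict.assoc _ _ _).symm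

theorem whisker_assoc_heq {w x y z : D} (f : w ⟶ x) {g g' : x ⟶ y} (η : g ⟶ g') (h : y ⟶ z) :
    HEq ((f ◁ η) ▷ h) (f ◁ η ▷ h) := by
  rw [whisker_assoc, Strict.associator_eqToIso, Strict.associator_eqToIso]
  exact eqToHom_comp_comp_eqToHom_heq _ (Strict.assoc _ _ _) (Strict.assoc _ _ _).symm

/-- Two naturality squares for 2-morphisms, pasted along their common side b. Heterogeneous equality
absorbs the associators and the rebracketings. -/
theorem whisker_paste_heq {x y z x' y' z' : D} {f g : x ⟶ y} {k l : y ⟶ z} {f' g' : x' ⟶ y'}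
    {k' l' : y' ⟶ z'} {a : x ⟶ x'} {b : y ⟶ y'} {c : z ⟶ z'} {η : f ⟶ g} {θ : k ⟶ l}
    {η' : f' ⟶ g'} {θ' : k' ⟶ l'} (hf : f ≫ b = a ≫ f') (hg : g ≫ b = a ≫ g')
    (hk : k ≫ c = b ≫ k') (hl : l ≫ c = b ≫ l') (hη : HEq (η ▷ b) (a ◁ η'))
    (hθ : HEq (θ ▷ c) (b ◁ θ')) :
    HEq ((η ▷ k ≫ g ◁ θ) ▷ c) (a ◁ (η' ▷ k' ≫ g' ◁ θ')) := by
  -- Since η does not meet k, the square k ≫ c = b ≫ k' exchanges what η is whiskered with; then the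
  -- hypothesis on η applies next to b.
  have e₁ : HEq (η ▷ k ▷ c) (a ◁ η' ▷ k') := by
    refine (whiskerRight_comp_heq η k c).symm.trans ?_
    rw [hk]
    refine (whiskerRight_comp_heq η b k').trans ?_
    exact (whiskerRight_heq rfl rfl rfl (heq_of_eq hf) (heq_of_eq hg) HEq.rfl hη).trans
      (whisker_assoc_heq _ _ _)
  have e₂ : HEq ((g ◁ θ) ▷ c) (a ◁ g' ◁ θ') := by
    refine (whisker_assoc_heq _ _ _).trans ?_
    refine (whiskerLeft_heq rfl rfl rfl HEq.rfl (heq_of_eq hk) (heq_of_eq hl) hθ).trans ?_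
    refine (comp_whiskerLeft_heq _ _ _).symm.trans ?_
    rw [hg]
    exact comp_whiskerLeft_heq _ _ _
  have h : ∀ {f g : x ⟶ y} {f' g' : x' ⟶ y'} {k : y ⟶ z} {k' : y' ⟶ z'}, f ≫ b = a ≫ f' →
      k ≫ c = b ≫ k' → (f ≫ k) ≫ c = a ≫ f' ≫ k' := by
    intro f _ f' _ k k' hf hk
    rw [Strict.assoc, hk, ← Strict.assoc, hf, Strict.assoc]
  rw [comp_whiskerRight, Bicategory.whiskerLeft_comp]
  exact comp₂_heq rfl rfl (heq_of_eq (h (g := g) (g' := g') hf hk))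
    (heq_of_eq (h (g := g) (g' := g') hg hk)) (heq_of_eq (h (g := g) (g' := g') hg hl)) e₁ e₂

end

/-- The restriction of a transformation along a 2-functor. -/
def StrictTrans.restrict (r : TwoFunctor A C) {p q : TwoFunctor C D} (α : StrictTrans p q) :
    StrictTrans (r.comp p) (r.comp q) where
  app a := α.app (r.obj a)
  naturality f := α.naturality (r.map f)
  naturality₂ θ := α.naturality₂ (r.map₂ θ)

/-- A transformation of 2-functors on a product from its restrictions to the sections. -/
def StrictTrans.ofSections [Strict B] [Strict C] [Strict D] {p q : TwoFunctor (C × B) D}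
    (a : ∀ x, p.obj x ⟶ q.obj x)
    (L : ∀ b, StrictTrans ((TwoFunctor.inl C b).comp p) ((TwoFunctor.inl C b).comp q))
    (R : ∀ c, StrictTrans ((TwoFunctor.inr B c).comp p) ((TwoFunctor.inr B c).comp q))
    (hL : ∀ b c, (L b).app c = a (c, b)) (hR : ∀ c b, (R c).app b = a (c, b)) :
    StrictTrans p q where
  app := a
  naturality {x y} f := by
    have h₁ := (L x.2).naturality f.1
    have h₂ := (R y.1).naturality f.2
    rw [hL, hL] at h₁
    rw [hR, hR] at h₂
    -- The square over (f, k) is the square over (f, 1) pasted with the square over (1, k).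
    rw [TwoFunctor.map_eq_inl_comp_inr p, TwoFunctor.map_eq_inl_comp_inr q]
    refine (Strict.assoc _ _ _).trans ((congrArg _ h₂).trans ?_)
    exact (Strict.assoc _ _ _).symm.trans ((congrArg (· ≫ _) h₁).trans (Strict.assoc _ _ _))
  naturality₂ {x y f g} θ := by
    have hl : ∀ {c d : C} (f : c ⟶ d), ((TwoFunctor.inl C x.2).comp p).map f ≫ a (d, x.2) =
        a (c, x.2) ≫ ((TwoFunctor.inl C x.2).comp q).map f := fun {c d} f => by
      rw [← hL, ← hL]
      exact (L x.2).naturality f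
    have hr : ∀ {b d : B} (k : b ⟶ d), ((TwoFunctor.inr B y.1).comp p).map k ≫ a (y.1, d) =
        a (y.1, b) ≫ ((TwoFunctor.inr B y.1).comp q).map k := fun {c d} k => by
      rw [← hR, ← hR]
      exact (R y.1).naturality k
    have h₁ := (whiskerRight_heq rfl rfl rfl HEq.rfl HEq.rfl (heq_of_eq (hL _ _).symm)
      HEq.rfl).trans ((heq_of_comp_eqToHom _ _ ((L x.2).naturality₂ θ.1)).trans
        (whiskerLeft_heq rfl rfl rfl (heq_of_eq (hL _ _)) HEq.rfl HEq.rfl HEq.rfl))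
    have h₂ := (whiskerRight_heq rfl rfl rfl HEq.rfl HEq.rfl (heq_of_eq (hR _ _).symm)
      HEq.rfl).trans ((heq_of_comp_eqToHom _ _ ((R y.1).naturality₂ θ.2)).trans
        (whiskerLeft_heq rfl rfl rfl (heq_of_eq (hR _ _)) HEq.rfl HEq.rfl HEq.rfl))
    have h := whisker_paste_heq (hl f.1) (hl g.1) (hr f.2) (hr g.2) h₁ h₂
    have hp : ∀ (r : TwoFunctor (C × B) D), HEq (r.map₂ θ) _ := fun r =>
      (heq_of_eq (TwoFunctor.map₂_eq_inl_comp_inr r θ)).trans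
        (eqToHom_comp_comp_eqToHom_heq _ _ _)
    -- `h` is the pasted square; p(θ) and q(θ) differ from its two sides only by the `eqToHom`s of
    -- the factorization.
    refine comp_eqToHom_of_heq ?_ _ _
    refine (whiskerRight_heq rfl rfl rfl (heq_of_eq (TwoFunctor.map_eq_inl_comp_inr p f))
      (heq_of_eq (TwoFunctor.map_eq_inl_comp_inr p g)) HEq.rfl (hp p)).trans (h.trans ?_)
    exact (whiskerLeft_heq rfl rfl rfl HEq.rfl (heq_of_eq (TwoFunctor.map_eq_inl_comp_inr q f))
      (heq_of_eq (TwoFunctor.map_eq_inl_comp_inr q g)) (hp q)).symm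

end SectionwiseTransformations

/-! ### Hexagons checked on sections -/

section SectionwiseCompatibility

open MonoidalCategory

variable {M : Type u₁} [Category.{u} M] [MonoidalCategory M] [SymmetricCategory M]

/-- Hexagons compose along the 1-morphisms of the source: the element is moved past Q by `h₂` and
then past P by `h₁`, and the two braidings combine to that of P ⊗ Q with X. By contrast,
`compat_mul_aux` composes the transformations. -/
theorem compat_comp_aux {P Q X S T S' T' Zc Zd Ze ST ST' SZ TZ K : M}
    {l : P ⟶ S} {r : Q ⟶ T} {l' : P ⟶ S'} {r' : Q ⟶ T'} {zc : X ⟶ Zc} {zd : X ⟶ Zd} {ze : X ⟶ Ze}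
    {m : S ⊗ T ⟶ ST} {m' : S' ⊗ T' ⟶ ST'} {m₁ : S ⊗ Zd ⟶ SZ} {m₂ : Zc ⊗ S' ⟶ SZ}
    {m₃ : T ⊗ Ze ⟶ TZ} {m₄ : Zd ⊗ T' ⟶ TZ} {n₁ : ST ⊗ Ze ⟶ K} {n₂ : Zc ⊗ ST' ⟶ K}
    {n₃ : S ⊗ TZ ⟶ K} {n₄ : SZ ⊗ T' ⟶ K}
    (h₁ : (l ⊗ₘ zd) ≫ m₁ = (β_ P X).hom ≫ (zc ⊗ₘ l') ≫ m₂)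
    (h₂ : (r ⊗ₘ ze) ≫ m₃ = (β_ Q X).hom ≫ (zd ⊗ₘ r') ≫ m₄)
    (a₁ : m ▷ Ze ≫ n₁ = (α_ S T Ze).hom ≫ S ◁ m₃ ≫ n₃)
    (a₂ : m₁ ▷ T' ≫ n₄ = (α_ S Zd T').hom ≫ S ◁ m₄ ≫ n₃)
    (a₃ : m₂ ▷ T' ≫ n₄ = (α_ Zc S' T').hom ≫ Zc ◁ m' ≫ n₂) :
    (((l ⊗ₘ r) ≫ m) ⊗ₘ ze) ≫ n₁ =
      (β_ (P ⊗ Q) X).hom ≫ (zc ⊗ₘ ((l' ⊗ₘ r') ≫ m')) ≫ n₂ := by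
  have e₁ := assoc_tensorHom_aux (a := l) (b := r) (c := ze) a₁
  have e₂ := assoc_tensorHom_aux (a := l) (b := zd) (c := r') a₂
  have e₃ := assoc_tensorHom_aux (a := zc) (b := l') (c := r') a₃
  rw [e₁, h₂, ← whiskerLeft_tensorHom_assoc, BraidedCategory.braiding_tensor_left_hom]
  rw [h₁, ← whiskerRight_tensorHom_assoc, e₃] at e₂
  simp only [Category.assoc]
  rw [e₂, Iso.inv_hom_id_assoc]

variable {A B C D : Type u} [Bicategory.{u, u} A] [Bicategory.{u, u} B] [Bicategory.{u, u} C]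
  [Bicategory.{u, u} D] [Bicategory.Strict B] [Bicategory.Strict C] [Bicategory.Strict D]
variable {H : Lax A M} {E : Lax B M} {F : Lax C M} {G : Lax D M}

/-- The hexagon over φ(f), precomposed with the component of φ, which passes the braiding by
naturality. -/
theorem Compat.restrict {σ τ : LaxMor F G} (φ : LaxMor H F) {α : StrictTrans σ.base τ.base} {X : M}
    {x : ∀ c, X ⟶ G.val (α.app c)} (hx : Compat σ τ α x) :
    Compat (φ.comp σ) (φ.comp τ) (α.restrict φ.base) fun a => x (φ.base.obj a) := by
  intro a b f
  have h := φ.app f ▷ X ≫= hx (φ.base.map f)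
  rw [BraidedCategory.braiding_naturality_left_assoc, whiskerRight_tensorHom_assoc,
    whiskerLeft_tensorHom_assoc] at h
  exact h

/-- By `app_eq_inl_inr` the components of γ and γ' at (f, k) are products of their restrictions, so
the hexagon over (f, k) is the composite of those over (f, 1) and (1, k). -/
theorem Compat.ofSections {γ γ' : LaxMor (F.tensor E) G} {α : StrictTrans γ.base γ'.base} {X : M}
    {x : ∀ y, X ⟶ G.val (α.app y)}
    (hl : ∀ b, Compat ((LaxMor.inl F E b).comp γ) ((LaxMor.inl F E b).comp γ')
      (α.restrict (TwoFunctor.inl C b)) fun c => x (c, b))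
    (hr : ∀ c, Compat ((LaxMor.inr F E c).comp γ) ((LaxMor.inr F E c).comp γ')
      (α.restrict (TwoFunctor.inr B c)) fun b => x (c, b)) : Compat γ γ' α x := by
  intro y z f
  rw [LaxMor.app_eq_inl_inr γ f, LaxMor.app_eq_inl_inr γ' f]
  have h₁ := hl y.2 f.1
  have h₂ := hr z.1 f.2
  have hs : ((LaxMor.inl F E y.2).comp γ).base.map f.1 ≫ α.app (z.1, y.2) =
    α.app y ≫ ((LaxMor.inl F E y.2).comp γ').base.map f.1 := α.naturality _
  have ht : ((LaxMor.inr F E z.1).comp γ).base.map f.2 ≫ α.app z =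
    α.app (z.1, y.2) ≫ ((LaxMor.inr F E z.1).comp γ').base.map f.2 := α.naturality _
  have h₃ : ((LaxMor.inl F E y.2).comp γ).base.map f.1 ≫
      ((LaxMor.inr F E z.1).comp γ).base.map f.2 ≫ α.app z = γ.base.map f ≫ α.app z :=
    (Bicategory.Strict.assoc _ _ _).symm.trans
      (congrArg (· ≫ α.app z) (TwoFunctor.map_eq_inl_comp_inr γ.base f).symm)
  have h₄ : (((LaxMor.inl F E y.2).comp γ).base.map f.1 ≫ α.app (z.1, y.2)) ≫
      ((LaxMor.inr F E z.1).comp γ').base.map f.2 = γ.base.map f ≫ α.app z :=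
    (Bicategory.Strict.assoc _ _ _).trans ((congrArg _ ht.symm).trans h₃)
  exact compat_comp_aux h₁ h₂ (G.mul_assoc' _ rfl _ h₃) (G.mul_assoc' rfl ht.symm h₄ h₃)
    (G.mul_assoc' hs.symm (TwoFunctor.map_eq_inl_comp_inr γ'.base f).symm h₄ (α.naturality f).symm)

end SectionwiseCompatibility

/-! ### Currying of nerve-transformations -/

noncomputable section CurryingTransformations

open MonoidalCategory Limits

variable {M : Type u₁} [Category.{u} M] [MonoidalCategory M] [SymmetricCategory M]
  [MonoidalClosed M] [HasLimits M]

variable {B C D B' C' D' : Type u} [Bicategory.{u, u} B] [Bicategory.{u, u} C]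
  [Bicategory.{u, u} D] [Bicategory.{u, u} B'] [Bicategory.{u, u} C'] [Bicategory.{u, u} D']
  [Bicategory.Strict B] [Bicategory.Strict C] [Bicategory.Strict D] [Bicategory.Strict B']
  [Bicategory.Strict C'] [Bicategory.Strict D']
variable {E : Lax B M} {F : Lax C M} {G : Lax D M} {E' : Lax B' M} {F' : Lax C' M} {G' : Lax D' M}

namespace HOM

variable {δ δ' : LaxMor E (HOM F G)}

/-- The nerve-transformation at an object `c` given by a nerve-transformation between morphisms to
the internal hom. -/
def atTrans (η : NerveTrans δ δ') (c : C) :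
    NerveTrans (δ.comp (evAt F G c)) (δ'.comp (evAt F G c)) :=
  NerveTrans.ofCompat
    (TwoFunctor.whiskerTrans (TwoFunctor.id B) η.trans (evAt F G c).base)
    (fun b => η.elt b ≫ π (η.trans.app b) c)
    -- Whiskering leaves a composition with the identity of E at both ends, which is removed here.
    (Compat.copy (LaxMor.id_comp _) (LaxMor.id_comp _) (fun _ => HEq.rfl) (fun _ => HEq.rfl)
      (Compat.whisker (LaxMor.id E) (evAt F G c) (NerveTrans.compat η)))

/-- The transformation underlying the image of a nerve-transformation under currying. -/
def uncurryTrans (η : NerveTrans δ δ') : StrictTrans (uncurry δ).base (uncurry δ').base :=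
  StrictTrans.ofSections (fun x => StrictTrans.app (η.trans.app x.2).hom x.1)
    (fun b => StrictTrans.copy (η.trans.app b).hom
      (congrArg LaxMor.base (inl_comp_uncurry δ b)).symm
      (congrArg LaxMor.base (inl_comp_uncurry δ' b)).symm _ fun _ => HEq.rfl)
    (fun c => StrictTrans.copy (atTrans η c).trans
      (congrArg LaxMor.base (inr_comp_uncurry δ c)).symm
      (congrArg LaxMor.base (inr_comp_uncurry δ' c)).symm _ fun _ => HEq.rfl)
    (fun _ _ => rfl) (fun _ _ => rfl)

/-- The nerve-transformation between the uncurried morphisms. -/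
def uncurryMap (η : NerveTrans δ δ') : NerveTrans (uncurry δ) (uncurry δ') :=
  NerveTrans.ofCompat (uncurryTrans η) (fun x => η.elt x.2 ≫ π (η.trans.app x.2) x.1)
    (Compat.ofSections
      -- For fixed b the hexagons hold because the element of η at b is a point of the equalizer;
      -- for fixed c they are the hexagons of η projected to c.
      (fun b => Compat.copy (inl_comp_uncurry δ b).symm (inl_comp_uncurry δ' b).symm
        (fun _ => HEq.rfl) (fun _ => HEq.rfl) ((π_compat (η.trans.app b)).precomp (η.elt b)))
      (fun c => Compat.copy (inr_comp_uncurry δ c).symm (inr_comp_uncurry δ' c).symm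
        (fun _ => HEq.rfl) (fun _ => HEq.rfl) (atTrans η c).compat))

variable (F E G) in
/-- Uncurrying, as a functor. -/
def uncurryFunctor : LaxMor E (HOM F G) ⥤ LaxMor (F.tensor E) G where
  obj δ := uncurry δ
  map η := uncurryMap η
  map_id δ := NerveTrans.ext_elt (fun _ => rfl) fun x =>
    comp_comp_aux (hom_one_π (F := F) (G := G) (σ := δ.base.obj x.2) _ rfl x.1) (G.one_val₂ _ rfl)
  map_comp _ _ := NerveTrans.ext_elt (fun _ => rfl) fun x =>
    elt_whisker_aux (hom_mul_π _ _ _ rfl x.1) (G.mul_val₂ _ _)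

theorem hom_eqToHom_app {σ τ : Classifying F G} {α β : σ ⟶ τ} (h : α = β) (c : C) :
    Modif.app (eqToHom h).hom c = eqToHom (by rw [h]) := by
  subst h
  rfl

/-- A hexagon with values in ∫ G(α) holds after projection to c once the hexagon of the projected
data holds in G, since the projections respect multiplication. -/
theorem compat_π_aux {P X H I H' I' A Z A' Z' K L : M} {s : P ⟶ H} {x : X ⟶ I} {m : H ⊗ I ⟶ K}
    {s' : P ⟶ H'} {x' : X ⟶ I'} {m' : I' ⊗ H' ⟶ K} {p : K ⟶ L} {p₁ : H ⟶ A} {p₂ : I ⟶ Z}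
    {n : A ⊗ Z ⟶ L} {p₁' : H' ⟶ A'} {p₂' : I' ⟶ Z'} {n' : Z' ⊗ A' ⟶ L} {z : X ⟶ Z} {z' : X ⟶ Z'}
    (hm : m ≫ p = (p₁ ⊗ₘ p₂) ≫ n) (hm' : m' ≫ p = (p₂' ⊗ₘ p₁') ≫ n') (hz : x ≫ p₂ = z)
    (hz' : x' ≫ p₂' = z')
    (h : ((s ≫ p₁) ⊗ₘ z) ≫ n = (β_ P X).hom ≫ (z' ⊗ₘ (s' ≫ p₁')) ≫ n') :
    ((s ⊗ₘ x) ≫ m) ≫ p = ((β_ P X).hom ≫ (x' ⊗ₘ s') ≫ m') ≫ p := by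
  rw [Category.assoc, Category.assoc, Category.assoc, hm, hm',
    MonoidalCategory.tensorHom_comp_tensorHom_assoc,
    MonoidalCategory.tensorHom_comp_tensorHom_assoc, hz, hz', h]

section Preimage

variable (κ : NerveTrans (uncurry δ) (uncurry δ'))

/-- The restriction to `c ↦ (c, b)` of a nerve-transformation between uncurried morphisms. -/
def preimageLeft (b : B) : StrictTrans (LaxMor.base (F := F) (G := G) (δ.base.obj b))
    (LaxMor.base (F := F) (G := G) (δ'.base.obj b)) :=
  StrictTrans.copy (κ.trans.restrict (TwoFunctor.inl C b))
    (congrArg LaxMor.base (inl_comp_uncurry δ b))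
    (congrArg LaxMor.base (inl_comp_uncurry δ' b)) (fun c => κ.trans.app (c, b)) fun _ => HEq.rfl

/-- The restriction to `b ↦ (c, b)` of a nerve-transformation between uncurried morphisms. -/
def preimageRight (c : C) : StrictTrans (δ.comp (evAt F G c)).base (δ'.comp (evAt F G c)).base :=
  StrictTrans.copy (κ.trans.restrict (TwoFunctor.inr B c))
    (congrArg LaxMor.base (inr_comp_uncurry δ c))
    (congrArg LaxMor.base (inr_comp_uncurry δ' c)) (fun b => κ.trans.app (c, b)) fun _ => HEq.rfl

/-- These hexagons, over C with b fixed, let the elements at (c, b) be collected into one point of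
the integral at b. -/
theorem preimageLeft_compat (b : B) :
    Compat (F := F) (G := G) (δ.base.obj b) (δ'.base.obj b) (preimageLeft κ b)
      fun c => κ.elt (c, b) :=
  Compat.copy (inl_comp_uncurry δ b) (inl_comp_uncurry δ' b) (fun _ => HEq.rfl) (fun _ => HEq.rfl)
    (κ.compat.restrict (LaxMor.inl F E b))

/-- These hexagons, over B with c fixed, become the hexagons of the preimage itself, tested at c. -/
theorem preimageRight_compat (c : C) :
    Compat (δ.comp (evAt F G c)) (δ'.comp (evAt F G c)) (preimageRight κ c)
      fun b => κ.elt (c, b) :=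
  Compat.copy (inr_comp_uncurry δ c) (inr_comp_uncurry δ' c) (fun _ => HEq.rfl) (fun _ => HEq.rfl)
    (κ.compat.restrict (LaxMor.inr F E c))

/-- The transformation underlying the preimage. -/
def preimageTrans : StrictTrans δ.base δ'.base where
  app b := Bicategory.InducedBicategory.mkHom (X := δ.base.obj b) (Y := δ'.base.obj b)
    (preimageLeft κ b)
  -- Equalities of transformations and of modifications are tested at each c, where they are the
  -- naturality of the restriction to b ↦ (c, b).
  naturality {a b} k := Bicategory.InducedBicategory.hom_ext (StrictTrans.ext fun c =>
    (preimageRight κ c).naturality k)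
  naturality₂ {a b k l} θ := Bicategory.InducedBicategory.hom₂_ext (Modif.ext fun c => by
    refine (congrArg (_ ≫ ·) (hom_eqToHom_app _ c)).trans ?_
    refine Eq.trans ?_ (congrArg (· ≫ _) (hom_eqToHom_app _ c)).symm
    exact (preimageRight κ c).naturality₂ θ)

/-- The elements of the preimage. -/
def preimageElt (b : B) : 𝟙_ M ⟶ (HOM F G).val ((preimageTrans κ).app b) :=
  integral.lift (F := F) (G := G) (σ := δ.base.obj b) (τ := δ'.base.obj b) (preimageLeft κ b)
    (fun c => κ.elt (c, b)) (preimageLeft_compat κ b)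

theorem preimageElt_π (b : B) (c : C) :
    preimageElt κ b ≫ π ((preimageTrans κ).app b) c = κ.elt (c, b) :=
  integral.lift_π (F := F) (G := G) (σ := δ.base.obj b) (τ := δ'.base.obj b) (preimageLeft κ b)
    (fun c => κ.elt (c, b)) (preimageLeft_compat κ b) c

theorem preimageElt_compat : Compat δ δ' (preimageTrans κ) (preimageElt κ) := by
  intro a b k
  refine hom_ext fun c => ?_
  exact compat_π_aux (hom_mul_π _ _ _ _ c) (hom_mul_π _ _ _ _ c) (preimageElt_π κ b c)
    (preimageElt_π κ a c) (preimageRight_compat κ c k)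

/-- The nerve-transformation that is mapped to a given one between uncurried morphisms. -/
def preimage : NerveTrans δ δ' :=
  NerveTrans.ofCompat (preimageTrans κ) (preimageElt κ) (preimageElt_compat κ)

/-- The components of the transformation agree by definition. The elements were collected by a lift
into the integral, so projecting returns them. -/
theorem uncurryMap_preimage : uncurryMap (preimage κ) = κ :=
  NerveTrans.ext_elt (fun _ => rfl) fun x =>
    comp_comp_aux (preimageElt_π κ x.2 x.1) ((congrArg _ (G.val₂_id _)).trans (Category.comp_id _))

end Preimage

theorem preimage_uncurryMap (η : NerveTrans δ δ') : preimage (uncurryMap η) = η :=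
  NerveTrans.ext_elt (fun _ => rfl) fun b => hom_ext fun c => by
    have h := preimageElt_π (uncurryMap η) b c
    refine (congrArg (· ≫ _) ((congrArg _ ((HOM F G).val₂_id _)).trans
      (Category.comp_id _))).trans h

end HOM

end CurryingTransformations

/-! ### Inverting a fully faithful functor that is bijective on objects -/

section InverseFunctor

universe v₁ v₂ w₁ w₂

variable {𝒜 : Type w₁} [Category.{v₁} 𝒜] {ℬ : Type w₂} [Category.{v₂} ℬ]

/-- The inverse of a fully faithful functor with an inverse on objects. -/
def inverseFunctor {Ψ : 𝒜 ⥤ ℬ} (ff : Ψ.FullyFaithful) (g : ℬ → 𝒜) (hr : ∀ y, Ψ.obj (g y) = y) :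
    ℬ ⥤ 𝒜 where
  obj := g
  -- Since Ψ(g(y)) equals y only propositionally, f is conjugated to a morphism between the objects
  -- Ψ(g(y)) before its preimage is taken.
  map f := ff.preimage (eqToHom (hr _) ≫ f ≫ eqToHom (hr _).symm)
  map_id y := ff.map_injective (by simp)
  map_comp f f' := ff.map_injective (by simp)

theorem inverseFunctor_comp {Ψ : 𝒜 ⥤ ℬ} (ff : Ψ.FullyFaithful) (g : ℬ → 𝒜)
    (hr : ∀ y, Ψ.obj (g y) = y) : inverseFunctor ff g hr ⋙ Ψ = 𝟭 ℬ :=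
  CategoryTheory.Functor.ext hr fun _ _ _ => ff.map_preimage _

theorem comp_inverseFunctor {Ψ : 𝒜 ⥤ ℬ} (ff : Ψ.FullyFaithful) (g : ℬ → 𝒜)
    (hr : ∀ y, Ψ.obj (g y) = y) (hl : ∀ x, g (Ψ.obj x) = x) :
    Ψ ⋙ inverseFunctor ff g hr = 𝟭 𝒜 :=
  CategoryTheory.Functor.ext hl fun _ _ f => ff.map_injective <|
    (ff.map_preimage _).trans <| Eq.symm <| (Ψ.map_comp _ _).trans <|
      congrArg₂ (· ≫ ·) (eqToHom_map Ψ (hl _)) <| (Ψ.map_comp _ _).trans <|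
        congrArg (Ψ.map f ≫ ·) (eqToHom_map Ψ (hl _).symm)

end InverseFunctor

/-! ### The isomorphism of categories and its naturality -/

noncomputable section CurryingIso

open MonoidalCategory Limits

variable {M : Type u₁} [Category.{u} M] [MonoidalCategory M] [SymmetricCategory M]
  [MonoidalClosed M] [HasLimits M]

namespace HOM

variable {B C D B' C' D' : Type u} [Bicategory.{u, u} B] [Bicategory.{u, u} C]
  [Bicategory.{u, u} D] [Bicategory.{u, u} B'] [Bicategory.{u, u} C'] [Bicategory.{u, u} D']
  [Bicategory.Strict B] [Bicategory.Strict C] [Bicategory.Strict D] [Bicategory.Strict B']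
  [Bicategory.Strict C'] [Bicategory.Strict D']
variable {E : Lax B M} {F : Lax C M} {G : Lax D M} {E' : Lax B' M} {F' : Lax C' M} {G' : Lax D' M}

/-- On objects this is `uncurry_naturality`. On arrows the transformations have the same components,
and the elements agree because the map between integrals is defined through its projections. -/
theorem uncurryFunctor_naturality (ε : LaxMor E' E) (φ : LaxMor F' F) (ψ : LaxMor G G') :
    uncurryFunctor E F G ⋙ LaxMor.whisker (φ.tensor ε) ψ =
      LaxMor.whisker ε (map φ ψ) ⋙ uncurryFunctor E' F' G' :=
  Functor.hext (uncurry_naturality ε φ ψ) fun δ δ' _ =>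
    NerveTrans.hext (uncurry_naturality ε φ ψ δ) (uncurry_naturality ε φ ψ δ')
      (fun _ => HEq.rfl) fun x => heq_of_eq
        ((Category.assoc _ _ _).trans ((congrArg _ (mapApp_π φ ψ _ x.1).symm).trans
          (Category.assoc _ _ _).symm))

variable (E F G) in
/-- Uncurrying is fully faithful. -/
def uncurryFullyFaithful : (uncurryFunctor E F G).FullyFaithful where
  preimage κ := preimage κ
  map_preimage κ := uncurryMap_preimage κ
  preimage_map η := preimage_uncurryMap η

end HOM

namespace LaxCat

/-- The isomorphism of categories `Hom[F ⊠ E, G] ≅ Hom[E, HOM(F, G)]`. -/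
def curryIso (E F G : LaxCat M) : (F.tensorObj E).homCat G ≅ E.homCat (F.homObj G) where
  hom := (inverseFunctor (HOM.uncurryFullyFaithful E.functor F.functor G.functor) HOM.curry
    HOM.uncurry_curry).toCatHom
  -- The explicit direction is uncurrying, so the formula for the inverse through ev holds by
  -- definition.
  inv := (HOM.uncurryFunctor E.functor F.functor G.functor).toCatHom
  hom_inv_id := Cat.Hom.ext (inverseFunctor_comp _ _ HOM.uncurry_curry)
  inv_hom_id := Cat.Hom.ext (comp_inverseFunctor _ _ HOM.uncurry_curry HOM.curry_uncurry)

theorem curryIso_inv_naturality {E E' F F' G G' : LaxCat M} (e : E' ⟶ E) (f : F' ⟶ F)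
    (g : G ⟶ G') :
    (curryIso E F G).inv ≫ homCatMap (tensorHom f e) g =
      homCatMap e (homMap f g) ≫ (curryIso E' F' G').inv :=
  Cat.Hom.ext (HOM.uncurryFunctor_naturality e f g)

/-- Naturality passes from the inverse, where it is explicit, to the isomorphism by cancelling on
both sides. -/
theorem curryIso_hom_naturality {E E' F F' G G' : LaxCat M} (e : E' ⟶ E) (f : F' ⟶ F)
    (g : G ⟶ G') :
    homCatMap (tensorHom f e) g ≫ (curryIso E' F' G').hom =
      (curryIso E F G).hom ≫ homCatMap e (homMap f g) := by
  rw [← cancel_epi (curryIso E F G).inv, Iso.inv_hom_id_assoc, ← Category.assoc,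
    curryIso_inv_naturality, Category.assoc, Iso.inv_hom_id, Category.comp_id]

end LaxCat

end CurryingIso

end LaxDiagram

theorem mainTheorem1 {M : Type u₁} [CategoryTheory.Category.{u} M]
    [CategoryTheory.MonoidalCategory M] [CategoryTheory.SymmetricCategory M]
    [CategoryTheory.MonoidalClosed M] [CategoryTheory.Limits.HasLimits M]
    [CategoryTheory.Limits.HasColimits M] :
    ∃ Φ : ∀ E F G : LaxDiagram.LaxCat M,
      (F.tensorObj E).homCat G ≅ E.homCat (F.homObj G),
      (∀ {E E' F F' G G' : LaxDiagram.LaxCat M} (e : E' ⟶ E) (f : F' ⟶ F) (g : G ⟶ G'),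
        LaxDiagram.LaxCat.homCatMap (LaxDiagram.LaxCat.tensorHom f e) g ≫ (Φ E' F' G').hom =
          (Φ E F G).hom ≫ LaxDiagram.LaxCat.homCatMap e (LaxDiagram.LaxCat.homMap f g)) ∧
      (∀ (E F G : LaxDiagram.LaxCat M) (δ : E ⟶ F.homObj G),
        (Φ E F G).inv.toFunctor.obj (LaxDiagram.LaxCat.homCatObj δ) =
          LaxDiagram.LaxCat.homCatObj
            (LaxDiagram.LaxCat.tensorHom (𝟙 F) δ ≫ LaxDiagram.LaxCat.ev F G)) ∧
      ∀ (E F G : LaxDiagram.LaxCat M) (γ : F.tensorObj E ⟶ G), ∃! δ : E ⟶ F.homObj G,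
        LaxDiagram.LaxCat.tensorHom (𝟙 F) δ ≫ LaxDiagram.LaxCat.ev F G = γ :=
  ⟨LaxDiagram.LaxCat.curryIso, LaxDiagram.LaxCat.curryIso_hom_naturality, fun _ _ _ _ => rfl,
    -- Existence and uniqueness of the factorization are the two round trips between currying and
    -- uncurrying.
    fun _ _ _ γ => ⟨LaxDiagram.HOM.curry γ, LaxDiagram.HOM.uncurry_curry γ, fun δ hδ =>
      (LaxDiagram.HOM.curry_uncurry δ).symm.trans (congrArg LaxDiagram.HOM.curry hδ)⟩⟩
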